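/- Let $N\ge 4$, $2^*=\frac{2N}{N-2}$, $2\le q<2^*$, let $\Omega\subset\mathbb R^N$ be a nonempty bounded open set (in particular, any bounded domain with smooth boundary), and let $A:\mathbb R^N\to\mathbb R^N$ be continuous and bounded. For $\mu>0$ put $A_\mu(x)=A(\mu x)$ and $\nabla_{A_\mu}u=-i\nabla u-A_\mu u$. For $\mathbb K\in\{\mathbb R,\mathbb C\}$ let $H^1_0(\Omega,\mathbb K)$ be the closure of $C_c^\infty(\Omega,\mathbb K)$ in the $H^1$ norm. Define on $H^1_0(\Omega,\mathbb C)$ $$I_\mu(u)=\frac12\int_\Omega|\nabla_{A_\mu}u|^2\,dx-\frac{\mu}{q}\int_\Omega|u|^q\,dx-\frac1{2^*}\int_\Omega|u|^{2^*}\,dx,$$ let $\Gamma=\{\gamma\in C([0,1],H^1_0(\Omega,\mathbb C)):\gamma(0)=0,\ I_\mu(\gamma(1))<0\}$, and let $$b_\mu=\inf_{\gamma\in\Gamma}\max_{t\in[0,1]}I_\mu(\gamma(t))$$ be the mountain pass level. Let $$\lambda_1=\lambda_1(\mu)=\inf_{u\in H^1_0(\Omega,\mathbb C)\setminus\{0\}}\frac{\int_\Omega|\nabla_{A_\mu}u|^2\,dx}{\int_\Omega|u|^2\,dx},\qquad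 S=\inf_{u\in H^1_0(\Omega,\mathbb R)\setminus\{0\}}\frac{\int_\Omega|\nabla u|^2\,dx}{\left(\int_\Omega|u|^{2^*}\,dx\right)^{2/2^*}}.$$ Then $$0<b_\mu<\frac1N S^{N/2}$$ for every $\mu>0$ if $q>2$, and for every $\mu>0$ with $\mu<\lambda_1(\mu)$ if $q=2$. -/

import Mathlib

open MeasureTheory
open scoped ContDiff

noncomputable section

namespace MagneticBN

/-- Euclidean space of dimension `N`. -/
abbrev Space (N : ℕ) : Type := EuclideanSpace ℝ (Fin N)

/-- The vector of partial derivatives of `φ` at `x`. -/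
def grad (𝕜 : Type) [RCLike 𝕜] {N : ℕ} (φ : Space N → 𝕜) (x : Space N) :
    EuclideanSpace 𝕜 (Fin N) :=
  WithLp.toLp 2 fun j => fderiv ℝ φ x (EuclideanSpace.single j (1 : ℝ))

/-- The Hilbert space `L²(Ω, 𝕜) × L²(Ω, 𝕜ᴺ)`; the map `u ↦ (u, ∇u)` embeds `H¹(Ω, 𝕜)` into it
isometrically. -/
abbrev GraphSpace (𝕜 : Type) [RCLike 𝕜] {N : ℕ} (Ω : Set (Space N)) : Type :=
  WithLp 2 (Lp 𝕜 2 (volume.restrict Ω) × Lp (EuclideanSpace 𝕜 (Fin N)) 2 (volume.restrict Ω))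

/-- The space of pairs `(φ, ∇φ)` with `φ ∈ C_c^∞(Ω, 𝕜)`. -/
def testGraph (𝕜 : Type) [RCLike 𝕜] {N : ℕ} (Ω : Set (Space N)) :
    Submodule 𝕜 (GraphSpace 𝕜 Ω) where
  carrier := {p | ∃ φ : Space N → 𝕜, ContDiff ℝ ∞ φ ∧ HasCompactSupport φ ∧ tsupport φ ⊆ Ω ∧
    p.fst =ᵐ[volume.restrict Ω] φ ∧ p.snd =ᵐ[volume.restrict Ω] grad 𝕜 φ}
  zero_mem' := by
    refine ⟨0, contDiff_const, HasCompactSupport.zero, by simp [tsupport], ?_, ?_⟩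
    · exact Lp.coeFn_zero _ _ _
    · have h : grad 𝕜 (0 : Space N → 𝕜) = 0 := by
        ext x j
        simp [grad]
      rw [h]
      exact Lp.coeFn_zero _ _ _
  add_mem' := by
    rintro p r ⟨φ, hφ, hφc, hφs, hp1, hp2⟩ ⟨ψ, hψ, hψc, hψs, hr1, hr2⟩
    refine ⟨φ + ψ, hφ.add hψ, hφc.add hψc, ?_, ?_, ?_⟩
    · exact (tsupport_add φ ψ).trans (Set.union_subset hφs hψs)
    · filter_upwards [Lp.coeFn_add p.fst r.fst, hp1, hr1] with x h h1 h2
      simp only [WithLp.add_fst, h, Pi.add_apply, h1, h2]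
    · filter_upwards [Lp.coeFn_add p.snd r.snd, hp2, hr2] with x h h1 h2
      simp only [WithLp.add_snd, h, Pi.add_apply, h1, h2]
      ext j
      have e : fderiv ℝ (φ + ψ) x = fderiv ℝ φ x + fderiv ℝ ψ x :=
        fderiv_add (hφ.differentiable (by simp) x) (hψ.differentiable (by simp) x)
      simp [grad, e]
  smul_mem' := by
    rintro c p ⟨φ, hφ, hφc, hφs, hp1, hp2⟩
    refine ⟨c • φ, hφ.const_smul c, ?_, ?_, ?_, ?_⟩
    · exact hφc.smul_left (f := fun _ => c)
    · exact (closure_mono (Function.support_const_smul_subset c φ)).trans hφs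
    · filter_upwards [Lp.coeFn_smul c p.fst, hp1] with x h h1
      simp only [WithLp.smul_fst, h, Pi.smul_apply, h1]
    · filter_upwards [Lp.coeFn_smul c p.snd, hp2] with x h h1
      simp only [WithLp.smul_snd, h, Pi.smul_apply, h1]
      ext j
      have e : fderiv ℝ (c • φ) x = c • fderiv ℝ φ x :=
        fderiv_const_smul (hφ.differentiable (by simp) x) c
      simp [grad, e]

/-- The Sobolev space `H¹₀(Ω, 𝕜)`: the closure of `C_c^∞(Ω, 𝕜)` in the `H¹` norm. An element is
the pair of a function and its weak gradient, and the topology is that of the `H¹` norm. -/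
def H10 (𝕜 : Type) [RCLike 𝕜] {N : ℕ} (Ω : Set (Space N)) : Submodule 𝕜 (GraphSpace 𝕜 Ω) :=
  (testGraph 𝕜 Ω).topologicalClosure

/-- The underlying function of an element of `H¹₀(Ω, 𝕜)`. -/
def sobFun {𝕜 : Type} [RCLike 𝕜] {N : ℕ} {Ω : Set (Space N)} (u : H10 𝕜 Ω) (x : Space N) : 𝕜 :=
  (u : GraphSpace 𝕜 Ω).fst x

/-- The weak gradient of an element of `H¹₀(Ω, 𝕜)`. -/
def sobGrad {𝕜 : Type} [RCLike 𝕜] {N : ℕ} {Ω : Set (Space N)} (u : H10 𝕜 Ω) (x : Space N) :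
    EuclideanSpace 𝕜 (Fin N) :=
  (u : GraphSpace 𝕜 Ω).snd x

/-- The critical exponent `2* = 2N / (N - 2)`. -/
def critExp (N : ℕ) : ℝ := 2 * (N : ℝ) / ((N : ℝ) - 2)

/-- The magnetic gradient `-i∇u - A(μx)u`. -/
def magGrad {N : ℕ} (A : Space N → Space N) (μ : ℝ) {Ω : Set (Space N)} (u : H10 ℂ Ω)
    (x : Space N) : EuclideanSpace ℂ (Fin N) :=
  WithLp.toLp 2 fun j => -Complex.I * sobGrad u x j - ((A (μ • x) j : ℝ) : ℂ) * sobFun u x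

/-- The energy functional `I_μ` on `H¹₀(Ω, ℂ)`. -/
def energy {N : ℕ} (A : Space N → Space N) (Ω : Set (Space N)) (q μ : ℝ) (u : H10 ℂ Ω) : ℝ :=
  (1 / 2) * (∫ x in Ω, ‖magGrad A μ u x‖ ^ 2)
    - μ / q * (∫ x in Ω, ‖sobFun u x‖ ^ q)
    - 1 / critExp N * (∫ x in Ω, ‖sobFun u x‖ ^ critExp N)

/-- The least value `λ₁` of the Rayleigh quotient of the magnetic operator with potential
`A(μ ·)`. -/
def lambdaOne {N : ℕ} (A : Space N → Space N) (Ω : Set (Space N)) (μ : ℝ) : ℝ :=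
  ⨅ u : {u : H10 ℂ Ω // u ≠ 0},
    (∫ x in Ω, ‖magGrad A μ u.1 x‖ ^ 2) / (∫ x in Ω, ‖sobFun u.1 x‖ ^ 2)

/-- The best constant `S` of the Sobolev embedding `H¹₀(Ω, ℝ) ↪ L^{2*}(Ω, ℝ)`. -/
def sobolevConst {N : ℕ} (Ω : Set (Space N)) : ℝ :=
  ⨅ u : {u : H10 ℝ Ω // u ≠ 0},
    (∫ x in Ω, ‖sobGrad u.1 x‖ ^ 2) / (∫ x in Ω, ‖sobFun u.1 x‖ ^ critExp N) ^ (2 / critExp N)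

/-- The continuous paths in `H¹₀(Ω, ℂ)` from `0` to a point of negative energy. -/
def mountainPaths {N : ℕ} (A : Space N → Space N) (Ω : Set (Space N)) (q μ : ℝ) :
    Set C(unitInterval, H10 ℂ Ω) :=
  {γ | γ 0 = 0 ∧ energy A Ω q μ (γ 1) < 0}

/-- The mountain pass level `b_μ`. -/
def mountainPassLevel {N : ℕ} (A : Space N → Space N) (Ω : Set (Space N)) (q μ : ℝ) : ℝ :=
  ⨅ γ : mountainPaths A Ω q μ, ⨆ t : unitInterval, energy A Ω q μ (γ.1 t)

end MagneticBN

end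

/-! Positivity is mountain pass geometry. Write `E` for the magnetic energy `∫ |∇_A u|²`. The
Sobolev inequality, helped by the Rayleigh quotient `lambdaOne` when `q = 2`, gives `I_μ ≥ κ E - a
E^r - a E^s` with `κ > 0` and `r, s > 1` (`energy_ge`). Along an admissible path `E` is continuous,
starts at `0`, and cannot end below a certain level `e`, since `I_μ ≥ 0` there. So it takes the
value `e`, where `I_μ ≥ κ e / 2`.

For the strict upper bound one good ray suffices (`exists_ray_lt`). Truncate the Talenti function `U
= (1 + |y|²)^(-(N-2)/2)` to a compactly supported `v`, concentrate it at `x₀ ∈ Ω` at scale `1/l`,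
and multiply by the phase `exp(i⟨A(μx₀), x⟩)`. The phase leaves only `A(μx₀) - A(μx)`, which is
small near `x₀`, so the magnetic error is at most `δ l^(-2) ∫ v²` with `δ` at our disposal. The
truncation does not raise the Dirichlet energy above that of `U` and lowers `∫ U^{2*}` by
`O(l^(-(N-2)))`. The perturbation `(μ/q) ∫ |u|^q` has size `l^((N-2)q/2 - N) ∫ v^q` and beats both
errors. For `q > 2` this is a comparison of powers. For `q = 2` the magnetic error has the same
order and loses by the choice of `δ`. For `q = 2`, `N = 4` the truncation error also has order
`l^(-2)`, and loses because `∫ U²` diverges. `exists_fiber_lt` turns this comparison into a strict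
inequality uniform along the ray.

The unperturbed ray peaks at `(1/N) C^(N/2)`, where `C` is `talentiConst`, the Sobolev quotient of
`U`. To compare with `S` only `C ≤ S` is needed, that is, the sharp Sobolev inequality
(`sharp_sobolev`). It is proved by mass transport. A map `T` carries `|u|^{2*}` to a multiple of
`U^{2*}`; the inequality of arithmetic and geometric means bounds its Jacobian by its divergence;
integration by parts and Cauchy-Schwarz bring in `∇u`. An integral identity
(`dim_mul_integral_bracketPow`) shows that the constant obtained is `C`. Only the determinant and
the trace of `DT` enter, so the elementary triangular (Knothe) map can replace the optimal one. The
inequality is stated for `h = |u|²` and any `v` with `|∇h|² ≤ 4 h v²`, so it also covers the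
magnetic gradient, which gives the diamagnetic version. -/

open MeasureTheory
open scoped ContDiff

/-! ### Integration on cubes and the Knothe map -/

namespace MagneticBN

/-- Lebesgue measure on the cube `(a, b]ⁿ`. -/
noncomputable def cubeMeasure (a b : ℝ) (n : ℕ) : Measure (Fin n → ℝ) :=
  Measure.pi fun _ => volume.restrict (Set.Ioc a b)

instance (a b : ℝ) (n : ℕ) : IsFiniteMeasure (cubeMeasure a b n) := by
  unfold cubeMeasure; infer_instance

theorem cubeMeasure_eq (a b : ℝ) (n : ℕ) :
    cubeMeasure a b n = volume.restrict (Set.univ.pi fun _ => Set.Ioc a b) := by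
  rw [cubeMeasure, volume_pi, Measure.restrict_pi_pi]

theorem integrable_cubeMeasure {a b : ℝ} {n : ℕ} {φ : (Fin n → ℝ) → ℝ} (hφ : Continuous φ) :
    Integrable φ (cubeMeasure a b n) := by
  rw [cubeMeasure_eq]
  have h : IntegrableOn φ (Set.univ.pi fun _ => Set.Icc a b) :=
    hφ.continuousOn.integrableOn_compact (isCompact_univ_pi fun _ => isCompact_Icc)
  exact h.mono_set (Set.pi_mono fun _ _ => Set.Ioc_subset_Icc_self)

theorem ae_cubeMeasure_mem (a b : ℝ) (n : ℕ) :
    ∀ᵐ x ∂cubeMeasure a b n, ∀ k, x k ∈ Set.Icc a b := by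
  rw [cubeMeasure_eq]
  filter_upwards [ae_restrict_mem (MeasurableSet.univ_pi fun _ => measurableSet_Ioc)] with x hx k
  exact Set.Ioc_subset_Icc_self (hx k (Set.mem_univ k))

/-- Fubini's theorem on a cube, one coordinate being integrated first. -/
theorem integral_cubeMeasure_succ {a b : ℝ} (hab : a ≤ b) {n : ℕ} (k : Fin (n + 1))
    {φ : (Fin (n + 1) → ℝ) → ℝ} (hφ : Continuous φ) :
    ∫ x, φ x ∂cubeMeasure a b (n + 1) =
      ∫ x, (∫ s in a..b, φ (k.insertNth s x)) ∂cubeMeasure a b n := by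
  have hmp := (measurePreserving_piFinSuccAbove (α := fun _ : Fin (n + 1) => ℝ)
    (fun _ => volume.restrict (Set.Ioc a b)) k).symm
  have h1 := hmp.integral_comp (MeasurableEquiv.measurableEmbedding _) φ
  have h2 : Integrable (fun p : ℝ × (Fin n → ℝ) => φ (k.insertNth p.1 p.2))
      ((volume.restrict (Set.Ioc a b)).prod (cubeMeasure a b n)) := by
    exact (hmp.integrable_comp_emb (MeasurableEquiv.measurableEmbedding _)).2
      (integrable_cubeMeasure hφ)
  change _ = ∫ x, φ x ∂cubeMeasure a b (n + 1) at h1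
  rw [← h1]
  have h3 := integral_prod_symm _ h2
  simp only [intervalIntegral.integral_of_le hab]
  exact h3

theorem primitive_sub_ge {g : ℝ → ℝ} (hg : Continuous g) {m : ℝ} (hm : ∀ s, m ≤ g s)
    (c : ℝ) {u v : ℝ} (huv : u ≤ v) :
    m * (v - u) ≤ (∫ s in c..v, g s) - ∫ s in c..u, g s := by
  rw [intervalIntegral.integral_interval_sub_left (hg.intervalIntegrable _ _)
    (hg.intervalIntegrable _ _)]
  have h := intervalIntegral.integral_mono_on huv
    ((continuous_const (y := m)).intervalIntegrable (μ := volume) u v) (hg.intervalIntegrable u v)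
    fun s _ => hm s
  simpa [mul_comm] using h

theorem primitive_abs_sub_ge {g : ℝ → ℝ} (hg : Continuous g) {m : ℝ} (hm : ∀ s, m ≤ g s)
    (c u v : ℝ) :
    m * |v - u| ≤ |(∫ s in c..v, g s) - ∫ s in c..u, g s| := by
  rcases le_total u v with h | h
  · rw [abs_of_nonneg (sub_nonneg.2 h)]
    exact (primitive_sub_ge hg hm c h).trans (le_abs_self _)
  · rw [abs_sub_comm, abs_of_nonneg (sub_nonneg.2 h), abs_sub_comm (∫ s in c..v, g s)]
    exact (primitive_sub_ge hg hm c h).trans (le_abs_self _)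

theorem hasDerivAt_primitive {g : ℝ → ℝ} (hg : Continuous g) (c x : ℝ) :
    HasDerivAt (fun t => ∫ s in c..t, g s) (g x) x :=
  intervalIntegral.integral_hasDerivAt_right (hg.intervalIntegrable _ _)
    hg.stronglyMeasurable.stronglyMeasurableAtFilter hg.continuousAt

/-- The equation `∫_c^t g z = α z` with `g` bounded below by a positive constant has a solution
`t` that depends continuously on `z`. -/
theorem exists_continuous_primitive_eq {Z : Type*} [TopologicalSpace Z]
    [FirstCountableTopology Z] {g : Z → ℝ → ℝ}
    (hg : Continuous g.uncurry) {m : ℝ} (hm0 : 0 < m) (hm : ∀ z s, m ≤ g z s) (c : ℝ)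
    {α : Z → ℝ} (hα : Continuous α) :
    ∃ t : Z → ℝ, Continuous t ∧ ∀ z, ∫ s in c..t z, g z s = α z := by
  have hgz : ∀ z, Continuous (g z) := fun z => hg.comp (Continuous.prodMk_right z)
  have hex : ∀ z, ∃ t, ∫ s in c..t, g z s = α z := by
    intro z
    have hc : Continuous fun t => ∫ s in c..t, g z s :=
      intervalIntegral.continuous_primitive (fun _ _ => (hgz z).intervalIntegrable _ _) c
    refine mem_range_of_exists_le_of_exists_ge hc ⟨c - |α z| / m, ?_⟩ ⟨c + |α z| / m, ?_⟩
    · have h := primitive_sub_ge (hgz z) (hm z) c (u := c - |α z| / m) (v := c)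
        (by have : 0 ≤ |α z| / m := by positivity
            linarith)
      have e : m * (c - (c - |α z| / m)) = |α z| := by field_simp; ring
      rw [e, intervalIntegral.integral_same] at h
      have := neg_abs_le (α z)
      linarith
    · have h := primitive_sub_ge (hgz z) (hm z) c (u := c) (v := c + |α z| / m)
        (by have : 0 ≤ |α z| / m := by positivity
            linarith)
      have e : m * (c + |α z| / m - c) = |α z| := by field_simp; ring
      rw [e, intervalIntegral.integral_same] at h
      have := le_abs_self (α z)
      linarith
  choose t ht using hex
  refine ⟨t, ?_, ht⟩
  rw [continuous_iff_continuousAt]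
  intro z₀
  have hB : Continuous fun z => ∫ s in c..t z₀, g z s :=
    intervalIntegral.continuous_parametric_intervalIntegral_of_continuous' hg c (t z₀)
  have hlim : Filter.Tendsto (fun z => m⁻¹ * |α z - ∫ s in c..t z₀, g z s|) (nhds z₀)
      (nhds 0) := by
    have h : Continuous fun z => m⁻¹ * |α z - ∫ s in c..t z₀, g z s| :=
      continuous_const.mul (hα.sub hB).abs
    have h2 := h.tendsto z₀
    simpa [ht z₀] using h2
  rw [ContinuousAt, tendsto_iff_dist_tendsto_zero]
  refine squeeze_zero (fun _ => dist_nonneg) (fun z => ?_) hlim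
  -- Since `g ≥ m`, the defect of `t z₀` in the equation at `z` controls `|t z - t z₀|`, and the
  -- defect tends to `0`.
  have h := primitive_abs_sub_ge (hgz z) (hm z) c (t z₀) (t z)
  rw [ht z] at h
  rw [Real.dist_eq, ← div_eq_inv_mul, le_div_iff₀ hm0, mul_comm]
  exact h

/-- The primitive of `g` has a continuous inverse `β`, so `t = β ∘ α`, and the inverse function rule
applies to `β`. No regularity of `t` has to be assumed. -/
theorem hasDerivAt_of_primitive_eq {g t α : ℝ → ℝ} (hg : Continuous g) {m : ℝ} (hm0 : 0 < m)
    (hm : ∀ s, m ≤ g s) {c x α' : ℝ} (ht : ∀ z, ∫ s in c..t z, g s = α z)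
    (hα : HasDerivAt α α' x) : HasDerivAt t (α' / g (t x)) x := by
  obtain ⟨β, hβc, hβ⟩ := exists_continuous_primitive_eq (Z := ℝ) (g := fun _ => g)
    (hg.comp continuous_snd) hm0 (fun _ => hm) c continuous_id
  have e : ∀ z, t z = β (α z) := by
    intro z
    have h := primitive_abs_sub_ge hg hm c (t z) (β (α z))
    rw [ht, hβ, id, sub_self, abs_zero] at h
    have : |β (α z) - t z| ≤ 0 := by
      by_contra! h0
      have := mul_pos hm0 h0
      linarith
    have := abs_nonpos_iff.1 this
    linarith
  have hd : HasDerivAt β (g (t x))⁻¹ (α x) := by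
    refine HasDerivAt.of_local_left_inverse (f := fun s => ∫ r in c..s, g r) hβc.continuousAt ?_
      (hm0.trans_le (hm _)).ne' (Filter.Eventually.of_forall hβ)
    rw [← e]
    exact hasDerivAt_primitive hg c _
  have h := hd.comp x hα
  rw [mul_comm, ← div_eq_mul_inv] at h
  exact h.congr_of_eventuallyEq (Filter.Eventually.of_forall e)

/-- The marginal of `F` obtained by integrating out the first coordinate. -/
noncomputable def marginal (a b : ℝ) {n : ℕ} (F : (Fin (n + 1) → ℝ) → ℝ) (x : Fin n → ℝ) : ℝ :=
  ∫ s in a..b, F (Fin.cons s x)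

theorem continuous_cons_uncurry {n : ℕ} :
    Continuous fun p : (Fin n → ℝ) × ℝ => (Fin.cons p.2 p.1 : Fin (n + 1) → ℝ) := by
  refine continuous_pi fun i => ?_
  refine Fin.cases ?_ (fun j => ?_) i
  · simpa using continuous_snd
  · simp only [Fin.cons_succ]
    exact (continuous_apply j).comp continuous_fst

theorem continuous_marginal (a b : ℝ) {n : ℕ} {F : (Fin (n + 1) → ℝ) → ℝ} (hF : Continuous F) :
    Continuous (marginal a b F) :=
  intervalIntegral.continuous_parametric_intervalIntegral_of_continuous'
    (f := fun (x : Fin n → ℝ) s => F (Fin.cons s x)) (hF.comp continuous_cons_uncurry) a b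

theorem continuous_comp_cons {n : ℕ} {F : (Fin (n + 1) → ℝ) → ℝ} (hF : Continuous F)
    (x : Fin n → ℝ) : Continuous fun s : ℝ => F (Fin.cons s x) :=
  hF.comp (continuous_cons_uncurry.comp (Continuous.prodMk_right x))

theorem le_marginal {a b m : ℝ} (hab : a ≤ b) {n : ℕ} {F : (Fin (n + 1) → ℝ) → ℝ}
    (hF : Continuous F) (hm : ∀ x, m ≤ F x) (x : Fin n → ℝ) : m * (b - a) ≤ marginal a b F x := by
  have h := primitive_sub_ge (continuous_comp_cons hF x) (fun s => hm _) a hab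
  simpa [marginal] using h

theorem integral_marginal {a b : ℝ} (hab : a ≤ b) {n : ℕ} {F : (Fin (n + 1) → ℝ) → ℝ}
    (hF : Continuous F) :
    ∫ x, marginal a b F x ∂cubeMeasure a b n = ∫ x, F x ∂cubeMeasure a b (n + 1) := by
  rw [integral_cubeMeasure_succ hab 0 hF]
  simp [marginal]

/-- **Knothe rearrangement.** Between two continuous densities of equal mass on cubes, bounded
below by a positive constant, there is a triangular transport map `T`; `D x k` is the derivative
of its `k`-th component in the `k`-th variable. -/
theorem exists_knothe_map {a b c d : ℝ} (hab : a < b) (hcd : c < d) (n : ℕ) :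
    ∀ (F G : (Fin n → ℝ) → ℝ), Continuous F → Continuous G →
    (∃ m, 0 < m ∧ ∀ x, m ≤ F x) → (∃ m, 0 < m ∧ ∀ x, m ≤ G x) →
    ∫ x, F x ∂cubeMeasure a b n = ∫ y, G y ∂cubeMeasure c d n →
    ∃ T D : (Fin n → ℝ) → (Fin n → ℝ), Continuous T ∧ Continuous D ∧
      (∀ x k, HasDerivAt (fun s => T (Function.update x k s) k) (D x k) (x k)) ∧
      (∀ x k, 0 < D x k) ∧
      (∀ x, (∏ k, D x k) * G (T x) = F x) ∧
      (∀ x, (∀ k, x k ∈ Set.Icc a b) → ∀ k, T x k ∈ Set.Icc c d) ∧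
      (∀ φ : (Fin n → ℝ) → ℝ, Continuous φ →
        ∫ x, φ (T x) * F x ∂cubeMeasure a b n = ∫ y, φ y * G y ∂cubeMeasure c d n) := by
  induction n with
  | zero =>
    intro F G hF hG _ _ h
    -- In dimension `0` the cube measure is a Dirac mass, so equal masses means equal densities.
    have hFG : ∀ x, G x = F x := by
      intro x
      have e1 : cubeMeasure a b 0 = Measure.dirac x := Measure.pi_of_empty _ x
      have e2 : cubeMeasure c d 0 = Measure.dirac x := Measure.pi_of_empty _ x
      rw [e1, e2, integral_dirac, integral_dirac] at h
      exact h.symm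
    refine ⟨id, id, continuous_id, continuous_id, fun _ k => k.elim0, fun _ k => k.elim0,
      fun x => by simp [hFG], fun _ _ k => k.elim0, fun φ _ => ?_⟩
    have e : cubeMeasure a b 0 = cubeMeasure c d 0 := by
      rw [cubeMeasure, cubeMeasure, Measure.pi_of_empty _ (0 : Fin 0 → ℝ),
        Measure.pi_of_empty _ (0 : Fin 0 → ℝ)]
    simp only [id, hFG, e]
  | succ n ih =>
    intro F G hF hG hFm hGm hFG
    obtain ⟨mF, hmF0, hmF⟩ := hFm
    obtain ⟨mG, hmG0, hmG⟩ := hGm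
    have hF' := continuous_marginal a b hF
    have hG' := continuous_marginal c d hG
    have hF'm := le_marginal hab.le hF hmF
    have hG'm := le_marginal hcd.le hG hmG
    have hba : 0 < mF * (b - a) := mul_pos hmF0 (sub_pos.2 hab)
    have hdc : 0 < mG * (d - c) := mul_pos hmG0 (sub_pos.2 hcd)
    obtain ⟨T, D, hT, hD, hTD, hD0, hprod, hbox, hpush⟩ := ih (marginal a b F) (marginal c d G)
      hF' hG' ⟨_, hba, hF'm⟩ ⟨_, hdc, hG'm⟩
      (by rw [integral_marginal hab.le hF, integral_marginal hcd.le hG, hFG])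
    have hF'0 : ∀ x, 0 < marginal a b F x := fun x => hba.trans_le (hF'm x)
    have hG'0 : ∀ x, 0 < marginal c d G x := fun x => hdc.trans_le (hG'm x)
    have htail : Continuous fun x : Fin (n + 1) → ℝ => (Fin.tail x : Fin n → ℝ) :=
      continuous_pi fun j => continuous_apply j.succ
    -- The last `n` coordinates are transported by the map between the marginals. On each fibre the
    -- first coordinate matches conditional distribution functions, and `ρ` rescales the fibre mass
    -- of `F` to that of `G` over the image point.
    set ρ : (Fin n → ℝ) → ℝ := fun x => marginal c d G (T x) / marginal a b F x with hρ
    have hρc : Continuous ρ := (hG'.comp hT).div hF' fun x => (hF'0 x).ne'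
    set α : (Fin (n + 1) → ℝ) → ℝ := fun x =>
      ρ (Fin.tail x) * ∫ s in a..x 0, F (Fin.cons s (Fin.tail x)) with hα
    have hαc : Continuous α := by
      refine (hρc.comp htail).mul ?_
      exact intervalIntegral.continuous_parametric_intervalIntegral_of_continuous
        (f := fun (x : Fin (n + 1) → ℝ) s => F (Fin.cons s (Fin.tail x)))
        (hF.comp (continuous_cons_uncurry.comp (htail.prodMap continuous_id))) (continuous_apply 0)
    obtain ⟨t, htc, ht⟩ := exists_continuous_primitive_eq
      (g := fun (x : Fin (n + 1) → ℝ) s => G (Fin.cons s (T (Fin.tail x))))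
      (hG.comp (continuous_cons_uncurry.comp ((hT.comp htail).prodMap continuous_id)))
      hmG0 (fun _ _ => hmG _) c hαc
    set T₁ : (Fin (n + 1) → ℝ) → (Fin (n + 1) → ℝ) := fun x => Fin.cons (t x) (T (Fin.tail x))
      with hT₁
    have hT₁c : Continuous T₁ := continuous_cons_uncurry.comp ((hT.comp htail).prodMk htc)
    set δ : (Fin (n + 1) → ℝ) → ℝ := fun x => ρ (Fin.tail x) * F x / G (T₁ x) with hδ
    have hG0 : ∀ y, 0 < G y := fun y => hmG0.trans_le (hmG y)
    have hF0 : ∀ y, 0 < F y := fun y => hmF0.trans_le (hmF y)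
    have hδc : Continuous δ :=
      ((hρc.comp htail).mul hF).div (hG.comp hT₁c) fun x => (hG0 _).ne'
    have hρ0 : ∀ x, 0 < ρ x := fun x => div_pos (hG'0 _) (hF'0 _)
    have hderiv : ∀ (x : Fin n → ℝ) (r : ℝ),
        HasDerivAt (fun s => t (Fin.cons s x)) (δ (Fin.cons r x)) r := by
      intro x r
      have h := hasDerivAt_of_primitive_eq (g := fun s => G (Fin.cons s (T x)))
        (t := fun s => t (Fin.cons s x)) (c := c) (x := r)
        (α := fun s => ρ x * ∫ r in a..s, F (Fin.cons r x)) (continuous_comp_cons hG _) hmG0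
        (fun _ => hmG _) (fun z => by simpa [hα] using ht (Fin.cons z x))
        ((hasDerivAt_primitive (continuous_comp_cons hF x) a r).const_mul (ρ x))
      simpa [hδ, hT₁] using h
    have hta : ∀ x : Fin n → ℝ, t (Fin.cons a x) = c := by
      intro x
      have h := ht (Fin.cons a x)
      simp only [hα, Fin.cons_zero, Fin.tail_cons, intervalIntegral.integral_same,
        mul_zero] at h
      have h2 := primitive_abs_sub_ge (continuous_comp_cons hG (T x)) (fun _ => hmG _) c c
        (t (Fin.cons a x))
      rw [h, intervalIntegral.integral_same, sub_self, abs_zero] at h2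
      have : |t (Fin.cons a x) - c| ≤ 0 := by
        by_contra! h0
        have := mul_pos hmG0 h0
        linarith
      have := abs_nonpos_iff.1 this
      linarith
    have htb : ∀ x : Fin n → ℝ, t (Fin.cons b x) = d := by
      intro x
      have h := ht (Fin.cons b x)
      simp only [hα, Fin.cons_zero, Fin.tail_cons] at h
      have e : ρ x * ∫ s in a..b, F (Fin.cons s x) = ∫ s in c..d, G (Fin.cons s (T x)) := by
        change marginal c d G (T x) / marginal a b F x * marginal a b F x = marginal c d G (T x)
        exact div_mul_cancel₀ _ (hF'0 x).ne'
      have h2 := primitive_abs_sub_ge (continuous_comp_cons hG (T x)) (fun _ => hmG _) c d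
        (t (Fin.cons b x))
      rw [h, e, sub_self, abs_zero] at h2
      have : |t (Fin.cons b x) - d| ≤ 0 := by
        by_contra! h0
        have := mul_pos hmG0 h0
        linarith
      have := abs_nonpos_iff.1 this
      linarith
    have hδ0 : ∀ x, 0 < δ x := fun x => div_pos (mul_pos (hρ0 _) (hF0 _)) (hG0 _)
    have hmono : ∀ x : Fin n → ℝ, StrictMono fun s => t (Fin.cons s x) := fun x =>
      strictMono_of_hasDerivAt_pos (hderiv x) fun s => hδ0 _
    refine ⟨T₁, fun x => Fin.cons (δ x) (D (Fin.tail x)), hT₁c,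
      continuous_cons_uncurry.comp ((hD.comp htail).prodMk hδc), ?_, ?_, ?_, ?_, ?_⟩
    · intro x k
      refine Fin.cases ?_ (fun j => ?_) k
      · have h := hderiv (Fin.tail x) (x 0)
        rw [Fin.cons_self_tail] at h
        change HasDerivAt _ (δ x) (x 0)
        convert h using 2 with s
        simp only [hT₁, Fin.cons_zero]
        congr 1
        conv_lhs => rw [← Fin.cons_self_tail x]
        rw [Fin.update_cons_zero]
      · have h := hTD (Fin.tail x) j
        change HasDerivAt _ (D (Fin.tail x) j) (Fin.tail x j)
        convert h using 2 with s
        simp only [hT₁, Fin.cons_succ]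
        conv_lhs => rw [← Fin.cons_self_tail x]
        rw [← Fin.cons_update, Fin.tail_cons]
    · intro x k
      refine Fin.cases ?_ (fun j => ?_) k
      · simpa using hδ0 x
      · simpa using hD0 (Fin.tail x) j
    · intro x
      have h := hprod (Fin.tail x)
      rw [Fin.prod_univ_succ]
      simp only [Fin.cons_zero, Fin.cons_succ]
      have h1 : δ x * G (T₁ x) = ρ (Fin.tail x) * F x := div_mul_cancel₀ _ (hG0 _).ne'
      have h2 : (∏ k, D (Fin.tail x) k) * ρ (Fin.tail x) = 1 := by
        simp only [hρ]
        rw [← mul_div_assoc, h, div_self (hF'0 _).ne']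
      calc δ x * (∏ k, D (Fin.tail x) k) * G (T₁ x)
          = (∏ k, D (Fin.tail x) k) * (δ x * G (T₁ x)) := by ring
        _ = ((∏ k, D (Fin.tail x) k) * ρ (Fin.tail x)) * F x := by rw [h1]; ring
        _ = F x := by rw [h2, one_mul]
    · intro x hx k
      refine Fin.cases ?_ (fun j => ?_) k
      · simp only [hT₁, Fin.cons_zero]
        have h0 := hx 0
        have hm := (hmono (Fin.tail x)).monotone
        have h1 := hm h0.1
        have h2 := hm h0.2
        simp only [Fin.cons_self_tail, hta, htb] at h1 h2
        exact ⟨h1, h2⟩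
      · simp only [hT₁, Fin.cons_succ]
        exact hbox _ (fun i => hx i.succ) j
    · intro φ hφ
      -- `Ψ` is the conditional mean of `φ` under `G`. The substitution `r = t (s, x)` in the inner
      -- integral reduces the push-forward formula to the induction hypothesis for `Ψ`.
      set Ψ : (Fin n → ℝ) → ℝ := fun y =>
        marginal c d (fun y => φ y * G y) y / marginal c d G y with hΨ
      have hΨc : Continuous Ψ := (continuous_marginal c d (hφ.mul hG)).div hG'
        fun y => (hG'0 y).ne'
      have hin : ∀ x : Fin n → ℝ,
          marginal a b (fun x => φ (T₁ x) * F x) x = Ψ (T x) * marginal a b F x := by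
        intro x
        have hcv := intervalIntegral.integral_comp_mul_deriv (a := a) (b := b)
          (f := fun s => t (Fin.cons s x)) (f' := fun s => δ (Fin.cons s x))
          (g := fun r => φ (Fin.cons r (T x)) * G (Fin.cons r (T x)))
          (fun s _ => hderiv x s) (continuous_comp_cons hδc x).continuousOn
          ((continuous_comp_cons hφ _).mul (continuous_comp_cons hG _))
        rw [hta, htb] at hcv
        have e : ∀ s, φ (T₁ (Fin.cons s x)) * F (Fin.cons s x) = (ρ x)⁻¹ *
            (((fun r => φ (Fin.cons r (T x)) * G (Fin.cons r (T x))) ∘ fun s => t (Fin.cons s x)) s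
              * δ (Fin.cons s x)) := by
          intro s
          have h1 : δ (Fin.cons s x) * G (T₁ (Fin.cons s x)) = ρ x * F (Fin.cons s x) := by
            simp only [hδ, Fin.tail_cons]
            exact div_mul_cancel₀ _ (hG0 _).ne'
          have h2 : T₁ (Fin.cons s x) = Fin.cons (t (Fin.cons s x)) (T x) := by simp [hT₁]
          simp only [Function.comp]
          rw [← h2]
          have h3 := (hρ0 x).ne'
          field_simp
          linear_combination (-φ (T₁ (Fin.cons s x))) * h1
        rw [marginal]
        simp only [e]
        rw [intervalIntegral.integral_const_mul, hcv]
        simp only [hΨ, hρ, marginal, inv_div]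
        ring
      have h1 := integral_marginal hab.le (F := fun x => φ (T₁ x) * F x) ((hφ.comp hT₁c).mul hF)
      have h2 := integral_marginal hcd.le (F := fun y => φ y * G y) (hφ.mul hG)
      rw [← h1, ← h2]
      simp only [hin]
      rw [hpush Ψ hΨc]
      congr 1
      ext y
      exact div_mul_cancel₀ _ (hG'0 y).ne'

end MagneticBN

/-! ### The mass transport inequality on cubes -/

namespace MagneticBN

/-- Integration by parts in the variable `x k` alone, so only the diagonal derivative of a transport
map is needed. On the two faces `H = e` and `|T| ≤ R`, and each face has volume `(b - a)^n`. -/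
theorem integral_deriv_mul_cube_le {a b : ℝ} (hab : a ≤ b) {n : ℕ} (k : Fin (n + 1)) {R e : ℝ}
    (he : 0 ≤ e) {T D H H' : (Fin (n + 1) → ℝ) → ℝ} (hT : Continuous T) (hD : Continuous D)
    (hH : Continuous H) (hH' : Continuous H')
    (hTD : ∀ x, HasDerivAt (fun s => T (Function.update x k s)) (D x) (x k))
    (hHH' : ∀ x, HasDerivAt (fun s => H (Function.update x k s)) (H' x) (x k))
    (hTR : ∀ x, (∀ j, x j ∈ Set.Icc a b) → |T x| ≤ R)
    (hHe : ∀ x, x k = a ∨ x k = b → H x = e) :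
    ∫ x, D x * H x ∂cubeMeasure a b (n + 1) ≤
      2 * R * e * (b - a) ^ n - ∫ x, T x * H' x ∂cubeMeasure a b (n + 1) := by
  have hins : ∀ r : ℝ, Continuous fun y : Fin n → ℝ => (k.insertNth r y : Fin (n + 1) → ℝ) :=
    fun r => continuous_const.finInsertNth k continuous_id
  have hins' : ∀ y : Fin n → ℝ, Continuous fun r : ℝ => (k.insertNth r y : Fin (n + 1) → ℝ) :=
    fun y => (continuous_id (X := ℝ)).finInsertNth k (continuous_const (y := y))
  have hsum : ∫ x, D x * H x ∂cubeMeasure a b (n + 1) + ∫ x, T x * H' x ∂cubeMeasure a b (n + 1)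
      = ∫ y, (T (k.insertNth b y) * e - T (k.insertNth a y) * e) ∂cubeMeasure a b n := by
    rw [← integral_add (f := fun x => D x * H x) (g := fun x => T x * H' x)
      (integrable_cubeMeasure (hD.mul hH)) (integrable_cubeMeasure (hT.mul hH')),
      integral_cubeMeasure_succ hab k (φ := fun x => D x * H x + T x * H' x)
        ((hD.mul hH).add (hT.mul hH'))]
    congr 1
    ext y
    have h1 : ∀ s, HasDerivAt (fun s => T (k.insertNth s y)) (D (k.insertNth s y)) s := by
      intro s
      have h := hTD (k.insertNth s y)
      simpa using h
    have h2 : ∀ s, HasDerivAt (fun s => H (k.insertNth s y)) (H' (k.insertNth s y)) s := by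
      intro s
      have h := hHH' (k.insertNth s y)
      simpa using h
    have h3 := intervalIntegral.integral_deriv_mul_eq_sub (a := a) (b := b)
      (fun s _ => h1 s) (fun s _ => h2 s)
      ((hD.comp (hins' y)).intervalIntegrable _ _) ((hH'.comp (hins' y)).intervalIntegrable _ _)
    rw [hHe (k.insertNth b y) (by simp), hHe (k.insertNth a y) (by simp)] at h3
    exact h3
  have hle : ∫ y, (T (k.insertNth b y) * e - T (k.insertNth a y) * e) ∂cubeMeasure a b n
      ≤ ∫ _y, 2 * R * e ∂cubeMeasure a b n := by
    refine integral_mono_ae (integrable_cubeMeasure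
      (((hT.comp (hins b)).mul_const e).sub ((hT.comp (hins a)).mul_const e)))
      (integrable_const _) ?_
    filter_upwards [ae_cubeMeasure_mem a b n] with y hy
    have hb : |T (k.insertNth b y)| ≤ R := hTR _ fun j => by
      refine Fin.succAboveCases k ?_ (fun i => ?_) j
      · simpa using hab
      · simpa using hy i
    have ha : |T (k.insertNth a y)| ≤ R := hTR _ fun j => by
      refine Fin.succAboveCases k ?_ (fun i => ?_) j
      · simpa using hab
      · simpa using hy i
    have h1 := mul_le_mul_of_nonneg_right ((le_abs_self _).trans hb) he
    have h2 := mul_le_mul_of_nonneg_right ((neg_le_abs _).trans ha) he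
    linarith
  have hvol : (cubeMeasure a b n).real Set.univ = (b - a) ^ n := by
    rw [measureReal_def, cubeMeasure, Measure.pi_univ]
    simp [ENNReal.toReal_ofReal (sub_nonneg.2 hab)]
  rw [integral_const, hvol, smul_eq_mul] at hle
  linarith

/-- The mass transport inequality of Cordero-Erausquin, Nazaret and Villani on cubes, with the
Cauchy-Schwarz inequality replaced by Young's inequality with parameter `θ`. -/
theorem transport_inequality {n : ℕ} (hn : 2 ≤ n) {L R : ℝ} (hL : 0 < L) (hR : 0 < R)
    {p α : ℝ} (hp : p = 2 * ((n : ℝ) + 1) / ((n : ℝ) - 1)) (hα : α = 2 * (n : ℝ) / ((n : ℝ) - 1))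
    {η : ℝ} (hη : 0 < η) {w v : (Fin (n + 1) → ℝ) → ℝ} {w' : Fin (n + 1) → (Fin (n + 1) → ℝ) → ℝ}
    (hw : Continuous w) (hv : Continuous v) (hw' : ∀ k, Continuous (w' k))
    (hwη : ∀ x, η ≤ w x) (hv0 : ∀ x, 0 ≤ v x)
    (hww' : ∀ k x, HasDerivAt (fun s => w (Function.update x k s)) (w' k x) (x k))
    (hbd : ∀ k x, x k = -L ∨ x k = L → w x = η)
    (hwv : ∀ x, ∑ k, w' k x ^ 2 ≤ v x ^ 2)
    {G : (Fin (n + 1) → ℝ) → ℝ} (hG : Continuous G) (hGm : ∃ m, 0 < m ∧ ∀ y, m ≤ G y)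
    (hmass : ∫ x, w x ^ p ∂cubeMeasure (-L) L (n + 1) = ∫ y, G y ∂cubeMeasure (-R) R (n + 1))
    {θ : ℝ} (hθ : 0 < θ) :
    ∫ y, G y ^ (1 - 1 / ((n : ℝ) + 1)) ∂cubeMeasure (-R) R (n + 1) ≤
      2 * R * η ^ α * (2 * L) ^ n + α / ((n : ℝ) + 1) *
        (θ / 2 * (∫ y, (∑ k, y k ^ 2) * G y ∂cubeMeasure (-R) R (n + 1)) +
          1 / (2 * θ) * ∫ x, v x ^ 2 ∂cubeMeasure (-L) L (n + 1)) := by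
  have hn1 : (0 : ℝ) < (n : ℝ) - 1 := by
    have : (2 : ℝ) ≤ n := by exact_mod_cast hn
    linarith
  have hN : (0 : ℝ) < (n : ℝ) + 1 := by positivity
  have hα0 : 0 < α := by
    rw [hα]
    have : (0 : ℝ) < n := by linarith
    positivity
  have hw0 : ∀ x, 0 < w x := fun x => hη.trans_le (hwη x)
  have hp0 : 0 < p := by rw [hp]; positivity
  have hFc : Continuous fun x => w x ^ p := hw.rpow_const fun x => Or.inl (hw0 x).ne'
  obtain ⟨T, D, hT, hD, hTD, hD0, hprod, hbox, hpush⟩ := exists_knothe_map (a := -L) (b := L)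
    (c := -R) (d := R) (by linarith) (by linarith) (n + 1) (fun x => w x ^ p) G hFc hG
    ⟨η ^ p, Real.rpow_pos_of_pos hη p, fun x => Real.rpow_le_rpow hη.le (hwη x) hp0.le⟩ hGm hmass
  obtain ⟨m, hm0, hm⟩ := hGm
  have hG0 : ∀ y, 0 < G y := fun y => hm0.trans_le (hm y)
  set N : ℝ := (n : ℝ) + 1 with hNdef
  set H : (Fin (n + 1) → ℝ) → ℝ := fun x => w x ^ α with hH
  set H' : Fin (n + 1) → (Fin (n + 1) → ℝ) → ℝ := fun k x => w' k x * α * w x ^ (α - 1) with hH'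
  have hHc : Continuous H := hw.rpow_const fun x => Or.inl (hw0 x).ne'
  have hH'c : ∀ k, Continuous (H' k) := fun k =>
    ((hw' k).mul continuous_const).mul (hw.rpow_const fun x => Or.inl (hw0 x).ne')
  have hHH' : ∀ k x, HasDerivAt (fun s => H (Function.update x k s)) (H' k x) (x k) := by
    intro k x
    have h := (hww' k x).rpow_const (p := α) (Or.inl (by simpa using (hw0 x).ne'))
    simpa [hH, hH'] using h
  -- The two relations that fix `α`: `F^(1 - 1/N) = w^α`, and the derivative of `w^α` carries the
  -- factor `w^(α-1) = F^(1/2)`, as Cauchy-Schwarz requires.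
  have hpα : p * (1 - 1 / N) = α := by
    rw [hp, hα, hNdef]; field_simp; ring
  have hpα2 : α - 1 = p / 2 := by
    rw [hp, hα]; field_simp; ring
  have h1 : ∫ y, G y ^ (1 - 1 / N) ∂cubeMeasure (-R) R (n + 1)
      = ∫ x, G (T x) ^ (-(1 / N)) * w x ^ p ∂cubeMeasure (-L) L (n + 1) := by
    rw [hpush (fun y => G y ^ (-(1 / N))) (hG.rpow_const fun x => Or.inl (hG0 x).ne')]
    congr 1
    ext y
    nth_rw 3 [← Real.rpow_one (G y)]
    rw [← Real.rpow_add (hG0 y)]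
    congr 1
    ring
  -- By the Jacobian equation the left side is `(∏ D)^(1/N) w^α`; the inequality of means replaces
  -- the determinant by the divergence.
  have h2 : ∀ x, G (T x) ^ (-(1 / N)) * w x ^ p ≤ 1 / N * ∑ k, D x k * H x := by
    intro x
    have hP : 0 < ∏ k, D x k := Finset.prod_pos fun k _ => hD0 x k
    have e1 : G (T x) ^ (-(1 / N)) * w x ^ p = (∏ k, D x k) ^ (1 / N) * H x := by
      have hw' : w x ^ p = (w x ^ p) ^ (1 / N) * H x := by
        rw [← Real.rpow_mul (hw0 x).le, hH, ← Real.rpow_add (hw0 x), ← hpα]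
        congr 1
        ring
      nth_rw 1 [hw', ← hprod x]
      rw [Real.mul_rpow hP.le (hG0 _).le, Real.rpow_neg (hG0 _).le]
      have := (Real.rpow_pos_of_pos (hG0 (T x)) (1 / N)).ne'
      field_simp
    have e2 : (∏ k, D x k) ^ (1 / N) ≤ ∑ k, 1 / N * D x k := by
      rw [← Real.finsetProd_rpow _ _ fun k _ => (hD0 x k).le]
      refine Real.geom_mean_le_arith_mean_weighted _ (fun _ => 1 / N) _ (fun _ _ => by positivity)
        ?_ fun k _ => (hD0 x k).le
      simp only [Finset.sum_const, Finset.card_univ, Fintype.card_fin, nsmul_eq_mul, one_div]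
      push_cast
      exact mul_inv_cancel₀ hN.ne'
    rw [e1, ← Finset.sum_mul, ← mul_assoc, Finset.mul_sum]
    exact mul_le_mul_of_nonneg_right e2 (Real.rpow_nonneg (hw0 x).le _)
  have hTk : ∀ k, Continuous fun x => T x k := fun k => (continuous_apply k).comp hT
  have hDk : ∀ k, Continuous fun x => D x k := fun k => (continuous_apply k).comp hD
  have h3 : ∀ k, ∫ x, D x k * H x ∂cubeMeasure (-L) L (n + 1) ≤ 2 * R * η ^ α * (2 * L) ^ n -
      ∫ x, T x k * H' k x ∂cubeMeasure (-L) L (n + 1) := by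
    intro k
    have h := integral_deriv_mul_cube_le (a := -L) (b := L) (by linarith) k (R := R)
      (e := η ^ α) (Real.rpow_nonneg hη.le _) (hTk k) (hDk k) hHc (hH'c k)
      (fun x => hTD x k) (hHH' k) (fun x hx => abs_le.2 (hbox x hx k))
      (fun x hx => by simp only [hH, hbd k x hx])
    rwa [show L - -L = 2 * L by ring] at h
  -- Young's inequality splits `|T| w^(p/2) · v`. The first square, `|T|² w^p`, is then pushed
  -- forward to the second moment of `G`.
  have h4 : ∀ x, -(∑ k, T x k * H' k x) ≤
      α * (θ / 2 * ((∑ k, T x k ^ 2) * w x ^ p) + 1 / (2 * θ) * v x ^ 2) := by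
    intro x
    have hcs := Finset.sum_mul_sq_le_sq_mul_sq Finset.univ (fun k => T x k) (fun k => w' k x)
    set A := ∑ k, T x k * w' k x
    set B := ∑ k, T x k ^ 2
    have hB : 0 ≤ B := Finset.sum_nonneg fun k _ => sq_nonneg _
    have e1 : ∑ k, T x k * H' k x = α * w x ^ (p / 2) * A := by
      simp only [hH', Finset.mul_sum, A, hpα2]
      exact Finset.sum_congr rfl fun k _ => by ring
    have e2 : w x ^ p = (w x ^ (p / 2)) ^ 2 := by
      rw [← Real.rpow_natCast, ← Real.rpow_mul (hw0 x).le]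
      norm_num
    set W := w x ^ (p / 2)
    have hW : 0 < W := Real.rpow_pos_of_pos (hw0 x) _
    rw [e1, e2]
    have hA2 : A ^ 2 ≤ B * v x ^ 2 := hcs.trans (mul_le_mul_of_nonneg_left (hwv x) hB)
    have hA : |A| ≤ √B * v x := by
      refine abs_le_of_sq_le_sq ?_ (mul_nonneg (Real.sqrt_nonneg _) (hv0 x))
      rw [mul_pow, Real.sq_sqrt hB]
      exact hA2
    have hy : W * (√B * v x) ≤ θ / 2 * (B * W ^ 2) + 1 / (2 * θ) * v x ^ 2 := by
      have h := sq_nonneg (θ * (√B * W) - v x)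
      have hs := Real.sq_sqrt hB
      have h5 : θ / 2 * (B * W ^ 2) + 1 / (2 * θ) * v x ^ 2 - W * (√B * v x) =
          (θ * (√B * W) - v x) ^ 2 / (2 * θ) := by
        field_simp
        linear_combination (-θ ^ 2 * W ^ 2) * hs
      have := div_nonneg h (by positivity : 0 ≤ 2 * θ)
      linarith
    have h6 : -A ≤ √B * v x := (neg_le_abs A).trans hA
    have h7 := mul_le_mul_of_nonneg_left h6 hW.le
    have h8 := mul_le_mul_of_nonneg_left (h7.trans hy) hα0.le
    linarith
  have hsq : Continuous fun y : Fin (n + 1) → ℝ => ∑ k, y k ^ 2 :=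
    continuous_finsetSum _ fun k _ => (continuous_apply k).pow 2
  have hint : ∀ k, Integrable (fun x => T x k * H' k x) (cubeMeasure (-L) L (n + 1)) := fun k =>
    integrable_cubeMeasure ((hTk k).mul (hH'c k))
  have hTF : Continuous fun x => (∑ k, T x k ^ 2) * w x ^ p := (hsq.comp hT).mul hFc
  have h5 : -(∑ k, ∫ x, T x k * H' k x ∂cubeMeasure (-L) L (n + 1)) ≤
      α * (θ / 2 * (∫ y, (∑ k, y k ^ 2) * G y ∂cubeMeasure (-R) R (n + 1)) +
          1 / (2 * θ) * ∫ x, v x ^ 2 ∂cubeMeasure (-L) L (n + 1)) := by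
    rw [← hpush _ hsq, ← integral_finsetSum _ fun k _ => hint k, ← integral_neg,
      ← integral_const_mul, ← integral_const_mul,
      ← integral_add (f := fun x => θ / 2 * ((∑ k, T x k ^ 2) * w x ^ p))
        (g := fun x => 1 / (2 * θ) * v x ^ 2) (integrable_cubeMeasure (hTF.const_mul _))
        (integrable_cubeMeasure ((hv.pow 2).const_mul _)), ← integral_const_mul]
    refine integral_mono (integrable_finsetSum _ fun k _ => hint k).neg ?_ h4
    exact integrable_cubeMeasure
      (((hTF.const_mul _).add ((hv.pow 2).const_mul _)).const_mul _)
  have h6 : ∫ x, G (T x) ^ (-(1 / N)) * w x ^ p ∂cubeMeasure (-L) L (n + 1) ≤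
      1 / N * ∑ k, ∫ x, D x k * H x ∂cubeMeasure (-L) L (n + 1) := by
    rw [← integral_finsetSum (f := fun k x => D x k * H x) _
      fun k _ => integrable_cubeMeasure ((hDk k).mul hHc), ← integral_const_mul]
    refine integral_mono (integrable_cubeMeasure ?_) ?_ h2
    · exact ((hG.comp hT).rpow_const fun x => Or.inl (hG0 _).ne').mul hFc
    · exact (integrable_finsetSum (f := fun k x => D x k * H x) _ fun k _ =>
        integrable_cubeMeasure ((hDk k).mul hHc)).const_mul _
  have h7 := Finset.sum_le_sum fun k (_ : k ∈ Finset.univ) => h3 k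
  rw [Finset.sum_sub_distrib, Finset.sum_const, Finset.card_univ, Fintype.card_fin,
    nsmul_eq_mul] at h7
  push_cast at h7
  rw [h1]
  refine h6.trans ?_
  have h8 := mul_le_mul_of_nonneg_left (h7.trans (by linarith [h5] :
    _ ≤ N * (2 * R * η ^ α * (2 * L) ^ n) + α * (θ / 2 * (∫ y, (∑ k, y k ^ 2) * G y
      ∂cubeMeasure (-R) R (n + 1)) + 1 / (2 * θ) * ∫ x, v x ^ 2 ∂cubeMeasure (-L) L (n + 1))))
    (by positivity : 0 ≤ 1 / N)
  refine h8.trans (le_of_eq ?_)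
  field_simp

end MagneticBN

/-! ### Vanishing boundary values, targets on the whole space, optimal `θ` -/

namespace MagneticBN

/-- Here `h` stands for `|u|²`, which is smooth where `|u|` need not be, and the hypothesis on `h'`
says `|∇√h| ≤ v`. Apply the transport inequality to `√(h + η²)`, which is positive and equals `η` on
the boundary, and let `η` tend to `0`. -/
theorem transport_inequality_vanishing {n : ℕ} (hn : 2 ≤ n) {L R : ℝ} (hL : 0 < L) (hR : 0 < R)
    {p α : ℝ} (hp : p = 2 * ((n : ℝ) + 1) / ((n : ℝ) - 1)) (hα : α = 2 * (n : ℝ) / ((n : ℝ) - 1))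
    {h v : (Fin (n + 1) → ℝ) → ℝ} {h' : Fin (n + 1) → (Fin (n + 1) → ℝ) → ℝ}
    (hh : Continuous h) (hv : Continuous v) (hh'c : ∀ k, Continuous (h' k))
    (hh0 : ∀ x, 0 ≤ h x) (hv0 : ∀ x, 0 ≤ v x)
    (hhh' : ∀ k x, HasDerivAt (fun s => h (Function.update x k s)) (h' k x) (x k))
    (hbd : ∀ k x, x k = -L ∨ x k = L → h x = 0)
    (hhv : ∀ x, ∑ k, h' k x ^ 2 ≤ 4 * h x * v x ^ 2)
    {g : (Fin (n + 1) → ℝ) → ℝ} (hg : Continuous g) (hgm : ∃ m, 0 < m ∧ ∀ y, m ≤ g y)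
    {J Z : ℝ} (hJ : J = ∫ x, h x ^ (p / 2) ∂cubeMeasure (-L) L (n + 1)) (hJ0 : 0 < J)
    (hZ : Z = ∫ y, g y ∂cubeMeasure (-R) R (n + 1)) {θ : ℝ} (hθ : 0 < θ) :
    (J / Z) ^ (1 / 2 - 1 / ((n : ℝ) + 1)) *
      (∫ y, g y ^ (1 - 1 / ((n : ℝ) + 1)) ∂cubeMeasure (-R) R (n + 1)) ≤
      α / ((n : ℝ) + 1) * (θ / 2 * (∫ y, (∑ k, y k ^ 2) * g y ∂cubeMeasure (-R) R (n + 1)) +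
          1 / (2 * θ) * ∫ x, v x ^ 2 ∂cubeMeasure (-L) L (n + 1)) := by
  have hn1 : (0 : ℝ) < (n : ℝ) - 1 := by
    have : (2 : ℝ) ≤ n := by exact_mod_cast hn
    linarith
  have hn0 : (0 : ℝ) < n := by linarith
  have hα0 : 0 < α := by rw [hα]; positivity
  have hp0 : 0 < p := by rw [hp]; positivity
  have hexp : 0 < 1 / 2 - 1 / ((n : ℝ) + 1) := by
    rw [sub_pos, div_lt_div_iff₀ (by positivity) (by positivity)]
    linarith
  obtain ⟨m₀, hm₀, hgm'⟩ := hgm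
  have hg0 : ∀ y, 0 < g y := fun y => hm₀.trans_le (hgm' y)
  have hvolR : 0 < (cubeMeasure (-R) R (n + 1)).real Set.univ := by
    rw [measureReal_def, cubeMeasure, Measure.pi_univ]
    simp only [Measure.restrict_apply_univ, Real.volume_Ioc, Finset.prod_const,
      Finset.card_univ, Fintype.card_fin, ENNReal.toReal_pow]
    rw [ENNReal.toReal_ofReal (by linarith)]
    have : 0 < R - -R := by linarith
    positivity
  have hZ0 : 0 < Z := by
    have h1 : ∫ _y, m₀ ∂cubeMeasure (-R) R (n + 1) ≤ Z := by
      rw [hZ]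
      exact integral_mono (integrable_const _) (integrable_cubeMeasure hg) hgm'
    rw [integral_const, smul_eq_mul] at h1
    exact (mul_pos hvolR hm₀).trans_le h1
  set P := ∫ y, g y ^ (1 - 1 / ((n : ℝ) + 1)) ∂cubeMeasure (-R) R (n + 1) with hP
  set K := ∫ y, (∑ k, y k ^ 2) * g y ∂cubeMeasure (-R) R (n + 1) with hK
  set V := ∫ x, v x ^ 2 ∂cubeMeasure (-L) L (n + 1) with hV
  have hP0 : 0 ≤ P := integral_nonneg fun y => Real.rpow_nonneg (hg0 y).le _
  have main : ∀ η : ℝ, 0 < η → (J / Z) ^ (1 / 2 - 1 / ((n : ℝ) + 1)) * P ≤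
      2 * R * η ^ α * (2 * L) ^ n * (√(J / Z))⁻¹ +
        α / ((n : ℝ) + 1) * (θ / 2 * K + 1 / (2 * θ) * V) := by
    intro η hη
    have hpos : ∀ x, 0 < h x + η ^ 2 := fun x => by
      have := hh0 x
      positivity
    set w : (Fin (n + 1) → ℝ) → ℝ := fun x => √(h x + η ^ 2) with hw
    have hwc : Continuous w := (hh.add continuous_const).sqrt
    have hwη : ∀ x, η ≤ w x := fun x =>
      Real.le_sqrt_of_sq_le (by linarith [hh0 x])
    have hw0 : ∀ x, 0 < w x := fun x => hη.trans_le (hwη x)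
    have hwsq : ∀ x, w x ^ 2 = h x + η ^ 2 := fun x => Real.sq_sqrt (hpos x).le
    have hwp : ∀ x, h x ^ (p / 2) ≤ w x ^ p := by
      intro x
      have e : w x ^ p = (h x + η ^ 2) ^ (p / 2) := by
        rw [← hwsq, ← Real.rpow_natCast, ← Real.rpow_mul (hw0 x).le]
        congr 1
        push_cast
        ring
      rw [e]
      exact Real.rpow_le_rpow (hh0 x) (by linarith [sq_nonneg η]) (by positivity)
    set Jη := ∫ x, w x ^ p ∂cubeMeasure (-L) L (n + 1) with hJη
    have hJJ : J ≤ Jη := by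
      rw [hJ, hJη]
      refine integral_mono (integrable_cubeMeasure ?_) (integrable_cubeMeasure ?_) hwp
      · exact hh.rpow_const fun x => Or.inr (by positivity)
      · exact hwc.rpow_const fun x => Or.inr hp0.le
    -- The target `m g` has the mass of the regularised source. The bound `J / Z ≤ m` does not
    -- involve `η`, so `m` itself need not be followed in the limit.
    set m := Jη / Z with hm
    have hm1 : J / Z ≤ m := div_le_div_of_nonneg_right hJJ hZ0.le
    have hJZ : 0 < J / Z := by positivity
    have hm0 : 0 < m := hJZ.trans_le hm1
    have hsm : 0 < √m := Real.sqrt_pos.2 hm0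
    have key := transport_inequality hn hL hR hp hα hη hwc hv
      (w' := fun k x => h' k x / (2 * w x))
      (fun k => (hh'c k).div (continuous_const.mul hwc) fun x => by
        have := hw0 x
        positivity) hwη hv0
      (fun k x => by
        have h1 := (hhh' k x).add_const (η ^ 2)
        have h2 := h1.sqrt (by simpa using (hpos x).ne')
        simpa [hw] using h2)
      (fun k x hx => by
        simp only [hw, hbd k x hx, zero_add]
        exact Real.sqrt_sq hη.le)
      (fun x => by
        have e : ∑ k, (h' k x / (2 * w x)) ^ 2 = (∑ k, h' k x ^ 2) / (4 * w x ^ 2) := by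
          rw [Finset.sum_div]
          exact Finset.sum_congr rfl fun k _ => by rw [div_pow]; ring
        rw [e, div_le_iff₀ (by have := hw0 x; positivity)]
        refine (hhv x).trans ?_
        have h1 : h x ≤ w x ^ 2 := by rw [hwsq]; linarith [sq_nonneg η]
        have h2 := mul_le_mul_of_nonneg_right h1 (sq_nonneg (v x))
        linarith)
      (G := fun y => m * g y) (continuous_const.mul hg)
      ⟨m * m₀, by positivity, fun y => mul_le_mul_of_nonneg_left (hgm' y) hm0.le⟩
      (by
        rw [integral_const_mul, ← hZ, hm, div_mul_cancel₀ _ hZ0.ne'])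
      -- With this scaling both terms of Young's inequality carry the factor `√m`, which is divided
      -- out below.
      (θ := θ / √m) (by positivity)
    have e1 : ∫ y, (m * g y) ^ (1 - 1 / ((n : ℝ) + 1)) ∂cubeMeasure (-R) R (n + 1)
        = √m * (m ^ (1 / 2 - 1 / ((n : ℝ) + 1)) * P) := by
      rw [hP, ← mul_assoc, ← integral_const_mul]
      congr 1
      ext y
      rw [Real.mul_rpow hm0.le (hg0 y).le, Real.sqrt_eq_rpow, ← Real.rpow_add hm0]
      congr 2
      ring
    have e2 : ∫ y, (∑ k, y k ^ 2) * (m * g y) ∂cubeMeasure (-R) R (n + 1) = √m * √m * K := by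
      rw [Real.mul_self_sqrt hm0.le, hK, ← integral_const_mul]
      congr 1
      ext y
      ring
    rw [e1, e2, ← hV] at key
    have key2 : m ^ (1 / 2 - 1 / ((n : ℝ) + 1)) * P ≤
        2 * R * η ^ α * (2 * L) ^ n * (√m)⁻¹ +
        α / ((n : ℝ) + 1) * (θ / 2 * K + 1 / (2 * θ) * V) := by
      refine le_of_mul_le_mul_left (key.trans (le_of_eq ?_)) hsm
      field_simp
    refine (mul_le_mul_of_nonneg_right (Real.rpow_le_rpow hJZ.le hm1 hexp.le) hP0).trans
      (key2.trans ?_)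
    have : (√m)⁻¹ ≤ (√(J / Z))⁻¹ := by
      have := Real.sqrt_pos.2 hJZ
      gcongr
    have hηα := Real.rpow_pos_of_pos hη α
    gcongr
  have hlim : Filter.Tendsto (fun η : ℝ => 2 * R * η ^ α * (2 * L) ^ n * (√(J / Z))⁻¹ +
        α / ((n : ℝ) + 1) * (θ / 2 * K + 1 / (2 * θ) * V)) (nhdsWithin 0 (Set.Ioi 0))
      (nhds (α / ((n : ℝ) + 1) * (θ / 2 * K + 1 / (2 * θ) * V))) := by
    have hc : Continuous fun η : ℝ => 2 * R * η ^ α * (2 * L) ^ n * (√(J / Z))⁻¹ +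
        α / ((n : ℝ) + 1) * (θ / 2 * K + 1 / (2 * θ) * V) := by
      have := Real.continuous_rpow_const hα0.le
      fun_prop
    have h1 := (hc.tendsto 0).mono_left (nhdsWithin_le_nhds (s := Set.Ioi 0))
    simpa [Real.zero_rpow hα0.ne'] using h1
  exact ge_of_tendsto hlim (by
    filter_upwards [self_mem_nhdsWithin] with η hη using main η hη)

/-- Truncation of all coordinates to `[-R, R]`. -/
noncomputable def clampCube (R : ℝ) {n : ℕ} (y : Fin n → ℝ) : Fin n → ℝ :=
  fun k => max (-R) (min R (y k))

theorem continuous_clampCube (R : ℝ) {n : ℕ} :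
    Continuous (clampCube R : (Fin n → ℝ) → Fin n → ℝ) :=
  continuous_pi fun k => continuous_const.max (continuous_const.min (continuous_apply k))

theorem clampCube_of_mem {R : ℝ} {n : ℕ} {y : Fin n → ℝ} (hy : ∀ k, y k ∈ Set.Icc (-R) R) :
    clampCube R y = y := by
  ext k
  rw [clampCube, min_eq_right (hy k).2, max_eq_right (hy k).1]

/-- The Knothe map asks for a target bounded below by a positive constant on the whole space, while
`U^{2*}` decays. Clamping the argument provides the bound and changes nothing on the cube. -/
theorem exists_pos_le_comp_clampCube {R : ℝ} (hR : 0 < R) {n : ℕ} {g : (Fin n → ℝ) → ℝ}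
    (hg : Continuous g) (hg0 : ∀ y, 0 < g y) : ∃ m, 0 < m ∧ ∀ y, m ≤ g (clampCube R y) := by
  have hcpt : IsCompact (Set.univ.pi fun _ : Fin n => Set.Icc (-R) R) :=
    isCompact_univ_pi fun _ => isCompact_Icc
  obtain ⟨x, -, hx⟩ := hcpt.exists_isMinOn ⟨0, fun k _ => by
    simp only [Pi.zero_apply, Set.mem_Icc]
    constructor <;> linarith⟩ hg.continuousOn
  refine ⟨g x, hg0 x, fun y => hx fun k _ => ?_⟩
  exact ⟨le_max_left _ _, max_le (by linarith) (min_le_left _ _)⟩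

theorem tendsto_integral_cubeMeasure {n : ℕ} {f : (Fin n → ℝ) → ℝ} (hf : Integrable f) :
    Filter.Tendsto (fun j : ℕ => ∫ y, f y ∂cubeMeasure (-(j : ℝ)) j n) Filter.atTop
      (nhds (∫ y, f y)) := by
  have hU : (⋃ j : ℕ, Set.univ.pi fun _ : Fin n => Set.Ioc (-(j : ℝ)) j) = Set.univ := by
    rw [Set.eq_univ_iff_forall]
    intro y
    obtain ⟨j, hj⟩ := exists_nat_gt (∑ k, |y k|)
    refine Set.mem_iUnion.2 ⟨j, fun k _ => ?_⟩
    have h1 : |y k| ≤ ∑ k, |y k| :=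
      Finset.single_le_sum (f := fun k => |y k|) (fun _ _ => abs_nonneg _) (Finset.mem_univ k)
    have h2 := abs_lt.1 (h1.trans_lt hj)
    exact ⟨h2.1, h2.2.le⟩
  have h := tendsto_setIntegral_of_monotone (μ := volume) (f := f)
    (s := fun j : ℕ => Set.univ.pi fun _ : Fin n => Set.Ioc (-(j : ℝ)) j)
    (fun j => MeasurableSet.univ_pi fun _ => measurableSet_Ioc)
    (fun i j hij => Set.pi_mono fun _ _ => Set.Ioc_subset_Ioc (by simpa using hij)
      (by simpa using hij)) (by rw [hU]; exact hf.integrableOn)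
  rw [hU, Measure.restrict_univ] at h
  simpa only [cubeMeasure_eq] using h

/-- Sharp Sobolev inequality in coordinates, with the mass `M`, the second moment `K` and the
integral `P` of the power `1 - 1/N` of a target density `g`. -/
theorem sq_mul_le_of_transport {n : ℕ} (hn : 2 ≤ n) {L : ℝ} (hL : 0 < L)
    {p α : ℝ} (hp : p = 2 * ((n : ℝ) + 1) / ((n : ℝ) - 1)) (hα : α = 2 * (n : ℝ) / ((n : ℝ) - 1))
    {h v : (Fin (n + 1) → ℝ) → ℝ} {h' : Fin (n + 1) → (Fin (n + 1) → ℝ) → ℝ}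
    (hh : Continuous h) (hv : Continuous v) (hh'c : ∀ k, Continuous (h' k))
    (hh0 : ∀ x, 0 ≤ h x) (hv0 : ∀ x, 0 ≤ v x)
    (hhh' : ∀ k x, HasDerivAt (fun s => h (Function.update x k s)) (h' k x) (x k))
    (hbd : ∀ k x, x k = -L ∨ x k = L → h x = 0)
    (hhv : ∀ x, ∑ k, h' k x ^ 2 ≤ 4 * h x * v x ^ 2)
    {g : (Fin (n + 1) → ℝ) → ℝ} (hg : Continuous g) (hg0 : ∀ y, 0 < g y) (hgi : Integrable g)
    (hPi : Integrable fun y => g y ^ (1 - 1 / ((n : ℝ) + 1)))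
    (hKi : Integrable fun y => (∑ k, y k ^ 2) * g y)
    {J V : ℝ} (hJ : J = ∫ x, h x ^ (p / 2) ∂cubeMeasure (-L) L (n + 1)) (hJ0 : 0 < J)
    (hV : V = ∫ x, v x ^ 2 ∂cubeMeasure (-L) L (n + 1)) :
    ((J / ∫ y, g y) ^ (1 / 2 - 1 / ((n : ℝ) + 1)) *
      (∫ y, g y ^ (1 - 1 / ((n : ℝ) + 1)))) ^ 2 ≤
      (α / ((n : ℝ) + 1)) ^ 2 * ((∫ y, (∑ k, y k ^ 2) * g y) * V) := by
  have hn1 : (0 : ℝ) < (n : ℝ) - 1 := by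
    have : (2 : ℝ) ≤ n := by exact_mod_cast hn
    linarith
  have hn0 : (0 : ℝ) < n := by linarith
  have hα0 : 0 < α := by rw [hα]; positivity
  set P := ∫ y, g y ^ (1 - 1 / ((n : ℝ) + 1)) with hP
  set K := ∫ y, (∑ k, y k ^ 2) * g y with hK
  set M := ∫ y, g y with hM
  have hM0 : 0 < M := by
    rw [hM, integral_pos_iff_support_of_nonneg (fun y => (hg0 y).le) hgi]
    have : Function.support g = Set.univ := Set.eq_univ_of_forall fun y => (hg0 y).ne'
    rw [this]
    simp
  have hP0 : 0 ≤ P := integral_nonneg fun y => Real.rpow_nonneg (hg0 y).le _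
  have hV0 : 0 ≤ V := by rw [hV]; exact integral_nonneg fun y => sq_nonneg _
  have hK0 : 0 ≤ K := integral_nonneg fun y => mul_nonneg
    (Finset.sum_nonneg fun k _ => sq_nonneg _) (hg0 y).le
  have main : ∀ θ : ℝ, 0 < θ → (J / M) ^ (1 / 2 - 1 / ((n : ℝ) + 1)) * P ≤
      α / ((n : ℝ) + 1) * (θ / 2 * K + 1 / (2 * θ) * V) := by
    intro θ hθ
    have hZlim := tendsto_integral_cubeMeasure hgi
    have hPlim := tendsto_integral_cubeMeasure hPi
    have hKlim := tendsto_integral_cubeMeasure hKi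
    have hl : Filter.Tendsto (fun j : ℕ => (J / ∫ y, g y ∂cubeMeasure (-(j : ℝ)) j (n + 1)) ^
        (1 / 2 - 1 / ((n : ℝ) + 1)) *
        (∫ y, g y ^ (1 - 1 / ((n : ℝ) + 1)) ∂cubeMeasure (-(j : ℝ)) j (n + 1))) Filter.atTop
        (nhds ((J / M) ^ (1 / 2 - 1 / ((n : ℝ) + 1)) * P)) :=
      ((tendsto_const_nhds.div hZlim hM0.ne').rpow_const
        (Or.inl (div_pos hJ0 hM0).ne')).mul hPlim
    have hr : Filter.Tendsto (fun j : ℕ => α / ((n : ℝ) + 1) *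
        (θ / 2 * (∫ y, (∑ k, y k ^ 2) * g y ∂cubeMeasure (-(j : ℝ)) j (n + 1)) +
          1 / (2 * θ) * V)) Filter.atTop
        (nhds (α / ((n : ℝ) + 1) * (θ / 2 * K + 1 / (2 * θ) * V))) :=
      ((hKlim.const_mul _).add_const _).const_mul _
    refine le_of_tendsto_of_tendsto hl hr ?_
    filter_upwards [Filter.eventually_gt_atTop 0] with j hj
    have hj' : (0 : ℝ) < j := by exact_mod_cast hj
    have key := transport_inequality_vanishing hn hL hj' hp hα hh hv hh'c hh0 hv0 hhh' hbd hhv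
      (g := fun y => g (clampCube j y)) (hg.comp (continuous_clampCube _))
      (exists_pos_le_comp_clampCube hj' hg hg0) hJ hJ0 rfl hθ
    have hcl : ∀ᵐ y ∂cubeMeasure (-(j : ℝ)) j (n + 1), clampCube (j : ℝ) y = y := by
      filter_upwards [ae_cubeMeasure_mem (-(j : ℝ)) j (n + 1)] with y hy using clampCube_of_mem hy
    rw [integral_congr_ae (f := fun y => g (clampCube j y)) (g := g)
        (hcl.mono fun y hy => by simp only [hy]),
      integral_congr_ae (f := fun y => g (clampCube j y) ^ (1 - 1 / ((n : ℝ) + 1)))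
        (g := fun y => g y ^ (1 - 1 / ((n : ℝ) + 1))) (hcl.mono fun y hy => by simp only [hy]),
      integral_congr_ae (f := fun y => (∑ k, y k ^ 2) * g (clampCube j y))
        (g := fun y => (∑ k, y k ^ 2) * g y) (hcl.mono fun y hy => by simp only [hy]),
      ← hV] at key
    exact key
  set X := (J / M) ^ (1 / 2 - 1 / ((n : ℝ) + 1)) * P with hX
  have hX0 : 0 ≤ X := mul_nonneg (Real.rpow_nonneg (by positivity) _) hP0
  set c := α / ((n : ℝ) + 1) with hc
  have hc0 : 0 < c := by positivity
  -- Optimising over `θ`: `main` times `θ` is a quadratic inequality, valid also for `θ ≤ 0` since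
  -- `X ≥ 0`, so its discriminant `X² - c² K V` is nonpositive. This restores Cauchy-Schwarz.
  have hdisc : discrim (c * K / 2) (-X) (c * V / 2) ≤ 0 := by
    refine discrim_le_zero fun θ => ?_
    rcases le_or_gt θ 0 with h0 | h0
    · have h1 : 0 ≤ c * K / 2 * (θ * θ) := mul_nonneg (by positivity) (mul_self_nonneg θ)
      have h2 : 0 ≤ -X * θ := by nlinarith
      have h3 : 0 ≤ c * V / 2 := by positivity
      linarith
    · have h1 := mul_le_mul_of_nonneg_left (main θ h0) h0.le
      have e : θ * (c * (θ / 2 * K + 1 / (2 * θ) * V)) = c * K / 2 * (θ * θ) + c * V / 2 := by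
        field_simp
      rw [e] at h1
      linarith
  rw [discrim] at hdisc
  nlinarith

end MagneticBN

/-! ### The Talenti function and the sharp Sobolev inequality -/

namespace MagneticBN

/-- The function `(1 + |y|²)^(-s)`. -/
noncomputable def bracketPow {N : ℕ} (s : ℝ) (y : Space N) : ℝ := (1 + ‖y‖ ^ 2) ^ (-s)

section Bracket

variable {N : ℕ}

theorem bracketPow_pos (s : ℝ) (y : Space N) : 0 < bracketPow s y :=
  Real.rpow_pos_of_pos (by positivity) _

theorem contDiff_bracketPow (s : ℝ) : ContDiff ℝ ∞ (bracketPow s : Space N → ℝ) := by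
  refine ContDiff.rpow_const_of_ne ?_ fun y => ?_
  · exact contDiff_const.add (contDiff_norm_sq ℝ)
  · positivity

theorem continuous_bracketPow (s : ℝ) : Continuous (bracketPow s : Space N → ℝ) :=
  (contDiff_bracketPow s).continuous

theorem bracketPow_rpow (s r : ℝ) (y : Space N) : bracketPow s y ^ r = bracketPow (s * r) y := by
  rw [bracketPow, bracketPow, ← Real.rpow_mul (by positivity)]
  congr 1
  ring

theorem bracketPow_mul (s r : ℝ) (y : Space N) :
    bracketPow s y * bracketPow r y = bracketPow (s + r) y := by
  rw [bracketPow, bracketPow, bracketPow, ← Real.rpow_add (by positivity)]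
  congr 1
  ring

theorem integral_bracketPow_pos {s : ℝ} (hs : Integrable (bracketPow s : Space N → ℝ)) :
    0 < ∫ y : Space N, bracketPow s y := by
  rw [integral_pos_iff_support_of_nonneg (fun y => (bracketPow_pos _ y).le) hs]
  have h : Function.support (bracketPow s : Space N → ℝ) = Set.univ :=
    Set.eq_univ_of_forall fun y => (bracketPow_pos s y).ne'
  change 0 < volume (Function.support (bracketPow s : Space N → ℝ))
  rw [h]
  exact isOpen_univ.measure_pos volume Set.univ_nonempty

theorem norm_sq_mul_bracketPow_le (s : ℝ) (y : Space N) :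
    ‖y‖ ^ 2 * bracketPow s y ≤ bracketPow (s - 1) y := by
  have e : bracketPow (s - 1) y = (1 + ‖y‖ ^ 2) * bracketPow s y := by
    have h : (1 + ‖y‖ ^ 2) = (1 + ‖y‖ ^ 2) ^ (1 : ℝ) := (Real.rpow_one _).symm
    rw [bracketPow, bracketPow]
    nth_rw 2 [h]
    rw [← Real.rpow_add (by positivity)]
    congr 1
    ring
  rw [e]
  have := bracketPow_pos s y
  nlinarith

theorem integrable_bracketPow {s : ℝ} (hs : (N : ℝ) < 2 * s) :
    Integrable (bracketPow s : Space N → ℝ) := by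
  have h := integrable_rpow_neg_one_add_norm_sq (E := Space N) (μ := volume) (r := 2 * s)
    (by simpa using hs)
  refine h.congr (Filter.Eventually.of_forall fun y => ?_)
  simp only [bracketPow]
  congr 1
  ring

theorem integrable_norm_sq_mul_bracketPow {s : ℝ} (hs : (N : ℝ) + 2 < 2 * s) :
    Integrable fun y : Space N => ‖y‖ ^ 2 * bracketPow s y := by
  refine (integrable_bracketPow (N := N) (s := s - 1) (by linarith)).mono'
    ((continuous_norm.pow 2).mul (continuous_bracketPow s)).aestronglyMeasurable
    (Filter.Eventually.of_forall fun y => ?_)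
  rw [Real.norm_of_nonneg (mul_nonneg (sq_nonneg _) (bracketPow_pos s y).le)]
  exact norm_sq_mul_bracketPow_le s y

theorem fderiv_bracketPow (s : ℝ) (y z : Space N) :
    fderiv ℝ (bracketPow s) y z = -(2 * s) * bracketPow (s + 1) y * inner ℝ y z := by
  have h1 : HasFDerivAt (fun y : Space N => 1 + ‖y‖ ^ 2) (2 • innerSL ℝ y) y :=
    (hasStrictFDerivAt_norm_sq y).hasFDerivAt.const_add 1
  have h2 := h1.rpow_const (p := -s) (Or.inl (by positivity))
  have h3 : fderiv ℝ (bracketPow s) y = _ := h2.fderiv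
  rw [h3]
  simp only [bracketPow, neg_add, smul_apply, smul_eq_mul, nsmul_eq_mul,
    innerSL_apply_apply, sub_eq_add_neg]
  push_cast
  ring

theorem sum_coord_sq (y : Space N) : ∑ k, y k ^ 2 = ‖y‖ ^ 2 :=
  (EuclideanSpace.real_norm_sq_eq y).symm

theorem abs_coord_le (y : Space N) (k : Fin N) : |y k| ≤ ‖y‖ := by
  simpa using PiLp.norm_apply_le y k

/-- Integration by parts in `∫ div(y) (1 + |y|²)^(-s)`. -/
theorem dim_mul_integral_bracketPow {s : ℝ} (hs : (N : ℝ) + 1 < 2 * s) :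
    (N : ℝ) * ∫ y : Space N, bracketPow s y
      = 2 * s * ∫ y : Space N, ‖y‖ ^ 2 * bracketPow (s + 1) y := by
  have hint : ∀ k : Fin N, Integrable fun y : Space N => y k ^ 2 * bracketPow (s + 1) y := by
    intro k
    refine (integrable_norm_sq_mul_bracketPow (N := N) (s := s + 1) (by linarith)).mono'
      ?_ (Filter.Eventually.of_forall fun y => ?_)
    · have := continuous_bracketPow (N := N) (s + 1)
      exact (Continuous.mul (by fun_prop) this).aestronglyMeasurable
    · have := bracketPow_pos (s + 1) y
      rw [Real.norm_of_nonneg (by positivity)]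
      exact mul_le_mul_of_nonneg_right (sq_le_sq.2 (by simpa using abs_coord_le y k)) this.le
  have hk : ∀ k : Fin N, ∫ y : Space N, bracketPow s y
      = 2 * s * ∫ y : Space N, y k ^ 2 * bracketPow (s + 1) y := by
    intro k
    have hd : ∀ y : Space N, fderiv ℝ (fun y : Space N => y k) y
        (EuclideanSpace.single k (1 : ℝ)) = 1 := by
      intro y
      have : fderiv ℝ (fun y : Space N => y k) y = PiLp.proj 2 (fun _ : Fin N => ℝ) k :=
        (PiLp.proj (𝕜 := ℝ) 2 (fun _ : Fin N => ℝ) k).hasFDerivAt.fderiv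
      rw [this]
      simp
    have hd2 : ∀ y : Space N, y k * fderiv ℝ (bracketPow s) y (EuclideanSpace.single k (1 : ℝ))
        = -(2 * s) * (y k ^ 2 * bracketPow (s + 1) y) := by
      intro y
      rw [fderiv_bracketPow, EuclideanSpace.inner_single_right]
      simp
      ring
    have hc : Continuous fun y : Space N => y k * bracketPow s y := by
      have := continuous_bracketPow (N := N) s
      exact Continuous.mul (by fun_prop) this
    have h := integral_mul_fderiv_eq_neg_fderiv_mul_of_integrable (μ := volume) (𝕜 := ℝ)
      (f := fun y : Space N => y k) (g := bracketPow s)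
      (v := EuclideanSpace.single k (1 : ℝ)) (by
        simpa only [hd, one_mul] using integrable_bracketPow (N := N) (s := s) (by linarith))
      (by simpa only [hd2] using (hint k).const_mul (-(2 * s))) (by
        refine (integrable_bracketPow (N := N) (s := s - 1 / 2) (by linarith)).mono'
          hc.aestronglyMeasurable (Filter.Eventually.of_forall fun y => ?_)
        have hb := bracketPow_pos s y
        have e : bracketPow (s - 1 / 2) y = √(1 + ‖y‖ ^ 2) * bracketPow s y := by
          rw [Real.sqrt_eq_rpow, bracketPow, bracketPow, ← Real.rpow_add (by positivity)]
          congr 1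
          ring
        rw [norm_mul, Real.norm_of_nonneg hb.le, e, Real.norm_eq_abs]
        refine mul_le_mul_of_nonneg_right ((abs_coord_le y k).trans ?_) hb.le
        exact Real.le_sqrt_of_sq_le (by linarith))
      (fun y _ => (PiLp.proj (𝕜 := ℝ) 2 (fun _ : Fin N => ℝ) k).differentiableAt)
      (fun y _ => (contDiff_bracketPow s).differentiable (by simp) y)
    simp only [hd, hd2, one_mul] at h
    rw [integral_const_mul] at h
    linarith
  calc (N : ℝ) * ∫ y : Space N, bracketPow s y
      = ∑ _k : Fin N, ∫ y : Space N, bracketPow s y := by simp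
    _ = ∑ k : Fin N, 2 * s * ∫ y : Space N, y k ^ 2 * bracketPow (s + 1) y :=
        Finset.sum_congr rfl fun k _ => hk k
    _ = 2 * s * ∫ y : Space N, ‖y‖ ^ 2 * bracketPow (s + 1) y := by
        rw [← Finset.mul_sum, ← integral_finsetSum _ fun k _ => hint k]
        congr 2
        ext y
        rw [← Finset.sum_mul, sum_coord_sq]

end Bracket

/-- `∫ U^{2*}` for the Talenti function `U = (1 + |y|²)^(-(N-2)/2)`. -/
noncomputable def talentiMass (N : ℕ) : ℝ := ∫ y : Space N, bracketPow (N : ℝ) y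

/-- `∫ |∇U|²` for the Talenti function `U = (1 + |y|²)^(-(N-2)/2)`. -/
noncomputable def talentiEnergy (N : ℕ) : ℝ :=
  ((N : ℝ) - 2) ^ 2 * ∫ y : Space N, ‖y‖ ^ 2 * bracketPow (N : ℝ) y

/-- The Sobolev quotient of the Talenti function. -/
noncomputable def talentiConst (N : ℕ) : ℝ :=
  talentiEnergy N / talentiMass N ^ (2 / critExp N)

section Talenti

variable {N : ℕ}

theorem talentiMass_pos (hN : 4 ≤ N) : 0 < talentiMass N := by
  have h4 : (4 : ℝ) ≤ N := by exact_mod_cast hN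
  exact integral_bracketPow_pos (integrable_bracketPow (by linarith))

theorem talentiEnergy_pos (hN : 4 ≤ N) : 0 < talentiEnergy N := by
  have h4 : (4 : ℝ) ≤ N := by exact_mod_cast hN
  have h := dim_mul_integral_bracketPow (N := N) (s := (N : ℝ) - 1) (by linarith)
  rw [sub_add_cancel] at h
  have h1 : 0 < ∫ y : Space N, bracketPow ((N : ℝ) - 1) y := by
    exact integral_bracketPow_pos (integrable_bracketPow (by linarith))
  have h2 : 0 < (N : ℝ) * ∫ y : Space N, bracketPow ((N : ℝ) - 1) y := by positivity
  rw [h] at h2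
  have h3 := pos_of_mul_pos_right h2 (by linarith)
  have : (0 : ℝ) < (N : ℝ) - 2 := by linarith
  rw [talentiEnergy]
  positivity

theorem critExp_gt_two (hN : 4 ≤ N) : 2 < critExp N := by
  have h4 : (4 : ℝ) ≤ N := by exact_mod_cast hN
  rw [critExp, lt_div_iff₀ (by linarith)]
  linarith

theorem talentiConst_pos (hN : 4 ≤ N) : 0 < talentiConst N :=
  div_pos (talentiEnergy_pos hN) (Real.rpow_pos_of_pos (talentiMass_pos hN) _)

/-- With dimension `n + 1`, `1 - 2 / (n + 1) = 2 / p` turns the squared power of `J / M` into the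
Sobolev exponent. The relation `hPK` between `P` and `K` makes the remaining constants combine to
the quotient of the Talenti function. -/
theorem talenti_quotient_le {n p J M P K V : ℝ} (hn : 4 ≤ n + 1)
    (hp : p = 2 * (n + 1) / (n - 1)) (hM : 0 < M) (hJ : 0 < J) (hK : 0 < (n - 1) ^ 2 * K)
    (hPK : (n + 1) * P = 2 * n * K)
    (h : ((J / M) ^ (1 / 2 - 1 / (n + 1)) * P) ^ 2 ≤
      (2 * n / (n - 1) / (n + 1)) ^ 2 * (K * V)) :
    (n - 1) ^ 2 * K / M ^ (2 / p) * J ^ (2 / p) ≤ V := by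
  have hn1 : 0 < n - 1 := by linarith
  have hn0 : 0 < n := by linarith
  have hK0 : 0 < K := pos_of_mul_pos_right hK (by positivity)
  have hJM : 0 < J / M := by positivity
  have hpow : ((J / M) ^ (1 / 2 - 1 / (n + 1))) ^ 2 = J ^ (2 / p) / M ^ (2 / p) := by
    rw [← Real.rpow_natCast, ← Real.rpow_mul hJM.le, ← Real.div_rpow hJ.le hM.le]
    congr 1
    rw [hp]
    push_cast
    field_simp
    ring
  have hP : P = 2 * n * K / (n + 1) := by
    rw [eq_div_iff (by positivity)]
    linarith
  rw [mul_pow, hpow, hP] at h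
  have e : (n - 1) ^ 2 * K / M ^ (2 / p) * J ^ (2 / p) =
      (n - 1) ^ 2 * K * (J ^ (2 / p) / M ^ (2 / p)) := by
    ring
  rw [e]
  generalize J ^ (2 / p) / M ^ (2 / p) = Q at h
  have hc : 0 < (2 * n / (n - 1) / (n + 1)) ^ 2 * K := by positivity
  refine le_of_mul_le_mul_left ?_ hc
  refine le_trans (le_of_eq ?_) (h.trans (le_of_eq ?_))
  · field_simp
  · ring

theorem hasDerivAt_comp_toLp_update {h : Space N → ℝ} (hh : Differentiable ℝ h) (k : Fin N)
    (x : Fin N → ℝ) : HasDerivAt (fun s => h (WithLp.toLp 2 (Function.update x k s)))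
      (fderiv ℝ h (WithLp.toLp 2 x) (EuclideanSpace.single k (1 : ℝ))) (x k) := by
  have h1 : HasDerivAt (fun s => (WithLp.toLp 2 (Function.update x k s) : Space N))
      (EuclideanSpace.single k (1 : ℝ)) (x k) := by
    have h2 := hasDerivAt_update x k (x k)
    exact (PiLp.continuousLinearEquiv 2 ℝ fun _ : Fin N => ℝ).symm.hasFDerivAt.comp_hasDerivAt
      (x k) h2
  have h2 : HasFDerivAt h (fderiv ℝ h (WithLp.toLp 2 x))
      (WithLp.toLp 2 (Function.update x k (x k))) := by
    rw [Function.update_eq_self]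
    exact (hh _).hasFDerivAt
  exact h2.comp_hasDerivAt (x k) h1

theorem measurableEmbedding_toLp :
    MeasurableEmbedding (WithLp.toLp 2 : (Fin N → ℝ) → Space N) :=
  (MeasurableEquiv.toLp 2 (Fin N → ℝ)).measurableEmbedding

theorem integral_eq_integral_cubeMeasure {L : ℝ} {f : Space N → ℝ}
    (hf : ∀ x, L ≤ ‖x‖ → f x = 0) :
    ∫ x, f x = ∫ x, f (WithLp.toLp 2 x) ∂cubeMeasure (-L) L N := by
  rw [← (PiLp.volume_preserving_toLp (Fin N)).integral_comp measurableEmbedding_toLp,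
    cubeMeasure_eq, setIntegral_eq_integral_of_forall_compl_eq_zero]
  intro x hx
  apply hf
  by_contra! hlt
  refine hx fun k _ => ?_
  have := (abs_coord_le (WithLp.toLp 2 x) k).trans_lt hlt
  have := abs_lt.1 this
  exact ⟨this.1, this.2.le⟩

/-- The sharp Sobolev inequality for `√h`, where `v` bounds the gradient of `√h`. -/
theorem sharp_sobolev (hN : 4 ≤ N) {h v : Space N → ℝ} (hh : ContDiff ℝ 1 h)
    (hhc : HasCompactSupport h) (hh0 : ∀ x, 0 ≤ h x) (hv : Continuous v)
    (hvc : HasCompactSupport v) (hv0 : ∀ x, 0 ≤ v x)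
    (hhv : ∀ x, ∑ k, fderiv ℝ h x (EuclideanSpace.single k (1 : ℝ)) ^ 2 ≤ 4 * h x * v x ^ 2) :
    talentiConst N * (∫ x, h x ^ (critExp N / 2)) ^ (2 / critExp N) ≤ ∫ x, v x ^ 2 := by
  have hp2 := critExp_gt_two hN
  have hM0 := talentiMass_pos hN
  have hE0 := talentiEnergy_pos hN
  have hS0 := talentiConst_pos hN
  have h4 : (4 : ℝ) ≤ N := by exact_mod_cast hN
  rcases (integral_nonneg fun x => Real.rpow_nonneg (hh0 x) (critExp N / 2) :
    0 ≤ ∫ x, h x ^ (critExp N / 2)).eq_or_lt with hJ | hJ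
  · rw [← hJ, Real.zero_rpow (by have : 0 < 2 / critExp N := by positivity
                                 exact this.ne'), mul_zero]
    exact integral_nonneg fun x => sq_nonneg _
  have hv2 : Integrable fun x => v x ^ 2 := by
    have h1 : Continuous fun x => v x ^ 2 := hv.pow 2
    have h2 : HasCompactSupport fun x => v x ^ 2 := by
      simp only [sq]
      exact hvc.mul_right (f' := v)
    exact h1.integrable_of_hasCompactSupport h2
  obtain ⟨n, rfl⟩ : ∃ n, N = n + 1 := ⟨N - 1, by omega⟩
  push_cast at h4
  have hemb : MeasurableEmbedding (WithLp.toLp 2 : (Fin (n + 1) → ℝ) → Space (n + 1)) :=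
    measurableEmbedding_toLp
  have hmp := PiLp.volume_preserving_toLp (Fin (n + 1))
  have hcont : Continuous (WithLp.toLp 2 : (Fin (n + 1) → ℝ) → Space (n + 1)) :=
    PiLp.continuous_toLp 2 _
  obtain ⟨L, hL, hLh⟩ : ∃ L : ℝ, 0 < L ∧ ∀ x : Space (n + 1), L ≤ ‖x‖ → h x = 0 := by
    obtain ⟨L, hL⟩ := hhc.isCompact.isBounded.subset_ball_lt 0 0
    refine ⟨L, hL.1, fun x hx => image_eq_zero_of_notMem_tsupport fun hx' => ?_⟩
    have := hL.2 hx'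
    rw [mem_ball_zero_iff] at this
    linarith
  have hp : critExp (n + 1) = 2 * ((n : ℝ) + 1) / ((n : ℝ) - 1) := by
    rw [critExp]
    push_cast
    ring_nf
  generalize hpe : critExp (n + 1) = p at *
  have hup := fun k x => hasDerivAt_comp_toLp_update (hh.differentiable (by simp)) k x
  have hcube := fun (f : Space (n + 1) → ℝ) (hf : ∀ x : Space (n + 1), L ≤ ‖x‖ → f x = 0) =>
    integral_eq_integral_cubeMeasure hf
  have hnorm : ∀ x : Fin (n + 1) → ℝ, ∑ k, x k ^ 2 = ‖(WithLp.toLp 2 x : Space (n + 1))‖ ^ 2 :=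
    fun x => sum_coord_sq (WithLp.toLp 2 x)
  have hgP : ∀ y : Space (n + 1), bracketPow ((n : ℝ) + 1) y ^ (1 - 1 / ((n : ℝ) + 1))
      = bracketPow (n : ℝ) y := by
    intro y
    rw [bracketPow_rpow]
    congr 1
    field_simp
    ring
  -- The target density is `U^{2*}`, so the mass, the second moment and the power integral are those
  -- of the Talenti function. The choice is optimal, since `U` should be an equality case.
  have key := sq_mul_le_of_transport (n := n) (by
      have : (2 : ℝ) ≤ n := by linarith
      exact_mod_cast this) hL hp rfl (hh.continuous.comp hcont)
    (hv.comp hcont) (h' := fun k x => fderiv ℝ h (WithLp.toLp 2 x) (EuclideanSpace.single k 1))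
    (fun k => ((hh.continuous_fderiv (by simp)).comp hcont).clm_apply continuous_const)
    (fun x => hh0 _) (fun x => hv0 _) hup
    (fun k x hx => hLh _ (by
      refine le_trans ?_ (abs_coord_le (WithLp.toLp 2 x) k)
      rcases hx with hx | hx <;> simp [hx, abs_of_pos hL]))
    (fun x => hhv _)
    (g := fun y => bracketPow ((n : ℝ) + 1) (WithLp.toLp 2 y))
    ((continuous_bracketPow _).comp hcont) (fun y => bracketPow_pos _ _)
    ((hmp.integrable_comp_emb hemb).2 (integrable_bracketPow (by push_cast; linarith)))
    (by
      simp only [hgP]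
      exact (hmp.integrable_comp_emb hemb).2 (integrable_bracketPow (by push_cast; linarith)))
    (by
      simp only [hnorm]
      exact (hmp.integrable_comp_emb hemb).2
        (integrable_norm_sq_mul_bracketPow (by push_cast; linarith)))
    (hcube (fun x => h x ^ (p / 2)) fun x hx => by
      rw [hLh x hx, Real.zero_rpow (by linarith)]) hJ rfl
  simp only [hgP, hnorm] at key
  rw [hmp.integral_comp hemb (fun y => bracketPow ((n : ℝ) + 1) y),
    hmp.integral_comp hemb (fun y => bracketPow (n : ℝ) y),
    hmp.integral_comp hemb (fun y => ‖y‖ ^ 2 * bracketPow ((n : ℝ) + 1) y)] at key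
  have hPK := dim_mul_integral_bracketPow (N := n + 1) (s := n) (by push_cast; linarith)
  have hVle : ∫ x, (v ∘ WithLp.toLp 2) x ^ 2 ∂cubeMeasure (-L) L (n + 1) ≤ ∫ x, v x ^ 2 := by
    rw [← hmp.integral_comp hemb, cubeMeasure_eq]
    exact setIntegral_le_integral ((hmp.integrable_comp_emb hemb).2 hv2)
      (Filter.Eventually.of_forall fun x => sq_nonneg _)
  have hMdef : talentiMass (n + 1) = ∫ y : Space (n + 1), bracketPow ((n : ℝ) + 1) y := by
    rw [talentiMass]; push_cast; rfl
  have hEdef : talentiEnergy (n + 1) = ((n : ℝ) - 1) ^ 2 *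
      ∫ y : Space (n + 1), ‖y‖ ^ 2 * bracketPow ((n : ℝ) + 1) y := by
    rw [talentiEnergy]; push_cast; ring_nf
  rw [← hMdef] at key
  rw [talentiConst, hEdef, hpe]
  rw [hEdef] at hE0
  push_cast at hPK
  exact (talenti_quotient_le h4 hp hM0 hJ hE0 hPK key).trans hVle

end Talenti

end MagneticBN

/-! ### Sobolev inequalities in `H10`, real and magnetic -/

namespace MagneticBN

/-- `φ ∈ C_c^∞(Ω, 𝕜)`. -/
structure IsTest (𝕜 : Type) [RCLike 𝕜] {N : ℕ} (Ω : Set (Space N)) (φ : Space N → 𝕜) : Prop where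
  smooth : ContDiff ℝ ∞ φ
  compact : HasCompactSupport φ
  support : tsupport φ ⊆ Ω

section Test

variable {𝕜 : Type} [RCLike 𝕜] {N : ℕ} {Ω : Set (Space N)} {φ : Space N → 𝕜}

theorem grad_apply (φ : Space N → 𝕜) (x : Space N) (k : Fin N) :
    grad 𝕜 φ x k = fderiv ℝ φ x (EuclideanSpace.single k (1 : ℝ)) := rfl

theorem IsTest.continuous_grad (h : IsTest 𝕜 Ω φ) : Continuous (grad 𝕜 φ) := by
  refine (PiLp.continuous_toLp 2 _).comp (continuous_pi fun j => ?_)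
  exact (h.smooth.continuous_fderiv (by simp)).clm_apply continuous_const

theorem grad_eq_zero_of_notMem_tsupport {x : Space N} (hx : x ∉ tsupport φ) :
    grad 𝕜 φ x = 0 := by
  have h : fderiv ℝ φ x = 0 := by
    by_contra h0
    exact hx (support_fderiv_subset ℝ h0)
  ext j
  simp [grad_apply, h]

theorem IsTest.compact_grad (h : IsTest 𝕜 Ω φ) : HasCompactSupport (grad 𝕜 φ) :=
  HasCompactSupport.intro h.compact fun _ hx => grad_eq_zero_of_notMem_tsupport hx

theorem IsTest.memLp (h : IsTest 𝕜 Ω φ) (p : ENNReal) (μ : Measure (Space N))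
    [IsFiniteMeasureOnCompacts μ] : MemLp φ p μ :=
  h.smooth.continuous.memLp_of_hasCompactSupport h.compact

theorem IsTest.memLp_grad (h : IsTest 𝕜 Ω φ) (p : ENNReal) (μ : Measure (Space N))
    [IsFiniteMeasureOnCompacts μ] : MemLp (grad 𝕜 φ) p μ :=
  h.continuous_grad.memLp_of_hasCompactSupport h.compact_grad

/-- `u` is the class of the test function `φ`. -/
def Represents (u : H10 𝕜 Ω) (φ : Space N → 𝕜) : Prop :=
  sobFun u =ᵐ[volume.restrict Ω] φ ∧ sobGrad u =ᵐ[volume.restrict Ω] grad 𝕜 φ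

theorem IsTest.exists_represents (h : IsTest 𝕜 Ω φ) : ∃ u : H10 𝕜 Ω, Represents u φ := by
  have h1 := (h.memLp 2 (volume.restrict Ω)).coeFn_toLp
  have h2 := (h.memLp_grad 2 (volume.restrict Ω)).coeFn_toLp
  refine ⟨⟨WithLp.toLp 2 ((h.memLp 2 _).toLp φ, (h.memLp_grad 2 _).toLp (grad 𝕜 φ)), ?_⟩, h1, h2⟩
  exact (testGraph 𝕜 Ω).le_topologicalClosure ⟨φ, h.smooth, h.compact, h.support, h1, h2⟩

theorem exists_seq_test (u : H10 𝕜 Ω) : ∃ (v : ℕ → H10 𝕜 Ω) (φ : ℕ → Space N → 𝕜),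
    (∀ n, IsTest 𝕜 Ω (φ n) ∧ Represents (v n) (φ n)) ∧
      Filter.Tendsto v Filter.atTop (nhds u) := by
  have hu : (u : GraphSpace 𝕜 Ω) ∈ closure (testGraph 𝕜 Ω : Set (GraphSpace 𝕜 Ω)) := u.2
  obtain ⟨w, hw, hwu⟩ := mem_closure_iff_seq_limit.1 hu
  choose φ h1 h2 h3 h4 h5 using hw
  refine ⟨fun n => ⟨w n, (testGraph 𝕜 Ω).le_topologicalClosure
    ⟨φ n, h1 n, h2 n, h3 n, h4 n, h5 n⟩⟩, φ, fun n => ⟨⟨h1 n, h2 n, h3 n⟩, h4 n, h5 n⟩, ?_⟩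
  exact tendsto_subtype_rng.2 hwu

theorem sq_inner_grad (h : IsTest 𝕜 Ω φ) (x : Space N) (k : Fin N) :
    fderiv ℝ (fun x => ‖φ x‖ ^ 2) x (EuclideanSpace.single k (1 : ℝ)) =
      2 * RCLike.re (inner 𝕜 (φ x) (grad 𝕜 φ x k)) := by
  have h1 := ((h.smooth.differentiable (by simp) x).hasFDerivAt).norm_sq
  rw [h1.fderiv]
  simp [grad_apply, real_inner_eq_re_inner]
  ring

/-- The Sobolev inequality for a test function, with the gradient replaced by a field `m` that
has the same components in the direction of `φ`. -/
theorem IsTest.sobolev (hN : 4 ≤ N) (h : IsTest 𝕜 Ω φ) {m : Space N → EuclideanSpace 𝕜 (Fin N)}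
    (hm : Continuous m) (hms : ∀ x, x ∉ tsupport φ → m x = 0)
    (hφm : ∀ x k, |RCLike.re (inner 𝕜 (φ x) (grad 𝕜 φ x k))| ≤ ‖φ x‖ * ‖m x k‖) :
    talentiConst N * (∫ x in Ω, ‖φ x‖ ^ critExp N) ^ (2 / critExp N) ≤ ∫ x in Ω, ‖m x‖ ^ 2 := by
  have hp2 := critExp_gt_two hN
  have hmc : HasCompactSupport m := HasCompactSupport.intro h.compact hms
  have key := sharp_sobolev hN (h := fun x => ‖φ x‖ ^ 2) (v := fun x => ‖m x‖)
    ((h.smooth.norm_sq ℝ).of_le (by simp))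
    (HasCompactSupport.intro h.compact fun x hx => by
      simp [image_eq_zero_of_notMem_tsupport hx])
    (fun x => sq_nonneg _) hm.norm hmc.norm (fun x => norm_nonneg _) (fun x => by
      have e : ∀ k, fderiv ℝ (fun x => ‖φ x‖ ^ 2) x (EuclideanSpace.single k (1 : ℝ)) ^ 2
          ≤ 4 * ‖φ x‖ ^ 2 * ‖m x k‖ ^ 2 := by
        intro k
        rw [sq_inner_grad h]
        have h1 := hφm x k
        have h2 := sq_le_sq' (by linarith [abs_le.1 h1]) ((le_abs_self _).trans h1)
        nlinarith
      calc _ ≤ ∑ k, 4 * ‖φ x‖ ^ 2 * ‖m x k‖ ^ 2 := Finset.sum_le_sum fun k _ => e k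
        _ = 4 * ‖φ x‖ ^ 2 * ‖m x‖ ^ 2 := by
          rw [← Finset.mul_sum, EuclideanSpace.norm_sq_eq])
  have e1 : ∀ x, (‖φ x‖ ^ 2) ^ (critExp N / 2) = ‖φ x‖ ^ critExp N := by
    intro x
    rw [← Real.rpow_natCast, ← Real.rpow_mul (norm_nonneg _)]
    congr 1
    push_cast
    ring
  simp only [e1] at key
  rw [setIntegral_eq_integral_of_forall_compl_eq_zero,
    setIntegral_eq_integral_of_forall_compl_eq_zero]
  · exact key
  · intro x hx
    rw [hms x fun h' => hx (h.support h')]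
    simp
  · intro x hx
    rw [image_eq_zero_of_notMem_tsupport fun h' => hx (h.support h'), norm_zero,
      Real.zero_rpow (by linarith)]

end Test

theorem Lp_two_norm_sq {α E : Type*} [MeasurableSpace α] {ν : Measure α} [NormedAddCommGroup E]
    (f : Lp E 2 ν) : ‖f‖ ^ 2 = ∫ x, ‖f x‖ ^ 2 ∂ν := by
  have h0 : 0 ≤ ∫ x, ‖f x‖ ^ (2 : ℝ) ∂ν := integral_nonneg fun _ => by positivity
  rw [Lp.norm_def, (Lp.memLp f).eLpNorm_eq_integral_rpow_norm (by simp) (by simp)]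
  simp only [ENNReal.toReal_ofNat]
  rw [ENNReal.toReal_ofReal (Real.rpow_nonneg h0 _), ← Real.rpow_natCast, ← Real.rpow_mul h0]
  norm_num

section Limits

variable {𝕜 : Type} [RCLike 𝕜] {N : ℕ} {Ω : Set (Space N)}

theorem aestronglyMeasurable_sobFun (u : H10 𝕜 Ω) :
    AEStronglyMeasurable (sobFun u) (volume.restrict Ω) := Lp.aestronglyMeasurable _

theorem aestronglyMeasurable_sobGrad (u : H10 𝕜 Ω) :
    AEStronglyMeasurable (sobGrad u) (volume.restrict Ω) := Lp.aestronglyMeasurable _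

theorem memLp_sobGrad (u : H10 𝕜 Ω) : MemLp (sobGrad u) 2 (volume.restrict Ω) := Lp.memLp _

/-- Puts the Sobolev inequality in the form of an `eLpNorm` bound, to which lower semicontinuity
under convergence in measure applies. -/
theorem integral_rpow_le_of_eLpNorm_le {α E : Type*} [MeasurableSpace α] {ν : Measure α}
    [NormedAddCommGroup E] {f : α → E} {p C e : ℝ} (hp : 0 < p) (hC : 0 < C) (he : 0 ≤ e)
    (hf : MemLp f (ENNReal.ofReal p) ν) :
    eLpNorm f (ENNReal.ofReal p) ν ≤ ENNReal.ofReal √(e / C) ↔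
      C * (∫ x, ‖f x‖ ^ p ∂ν) ^ (2 / p) ≤ e := by
  have h0 : 0 ≤ ∫ x, ‖f x‖ ^ p ∂ν := integral_nonneg fun _ => by positivity
  have hp0 : ENNReal.ofReal p ≠ 0 := by simpa using hp
  have heC : 0 ≤ e / C := div_nonneg he hC.le
  rw [hf.eLpNorm_eq_integral_rpow_norm hp0 ENNReal.ofReal_ne_top, ENNReal.toReal_ofReal hp.le,
    ENNReal.ofReal_le_ofReal_iff (Real.sqrt_nonneg _), Real.le_sqrt (Real.rpow_nonneg h0 _),
    ← Real.rpow_natCast, ← Real.rpow_mul h0, le_div_iff₀ hC, mul_comm]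
  have : p⁻¹ * ((2 : ℕ) : ℝ) = 2 / p := by push_cast; ring
  · rw [this]
  · exact heC

/-- Lower semicontinuity of the `Lᵖ` norm along convergent sequences of `H¹₀`. -/
theorem sobolev_of_tendsto {p C e : ℝ} (hp : 0 < p) (hC : 0 < C) {v : ℕ → H10 𝕜 Ω} {u : H10 𝕜 Ω}
    {E : ℕ → ℝ} (hE0 : ∀ n, 0 ≤ E n)
    (hv : ∀ n, MemLp (sobFun (v n)) (ENNReal.ofReal p) (volume.restrict Ω))
    (hvE : ∀ n, C * (∫ x in Ω, ‖sobFun (v n) x‖ ^ p) ^ (2 / p) ≤ E n)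
    (hvu : Filter.Tendsto v Filter.atTop (nhds u))
    (hE : Filter.Tendsto E Filter.atTop (nhds e)) :
    MemLp (sobFun u) (ENNReal.ofReal p) (volume.restrict Ω) ∧
      C * (∫ x in Ω, ‖sobFun u x‖ ^ p) ^ (2 / p) ≤ e := by
  have he : 0 ≤ e := ge_of_tendsto' hE hE0
  have hfst : Filter.Tendsto (fun n => (v n : GraphSpace 𝕜 Ω).fst) Filter.atTop
      (nhds (u : GraphSpace 𝕜 Ω).fst) :=
    (((WithLp.fstL 2 𝕜 (Lp 𝕜 2 (volume.restrict Ω))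
      (Lp (EuclideanSpace 𝕜 (Fin N)) 2 (volume.restrict Ω))).continuous.comp
        continuous_subtype_val).tendsto u).comp hvu
  -- Convergence in `H¹` gives convergence in measure, and Fatou's lemma carries the bound to the
  -- limit. The slack `ε` is there because `E n` only tends to `e`.
  have hmeas := tendstoInMeasure_of_tendsto_Lp hfst
  have key : ∀ ε : ℝ, 0 < ε →
      eLpNorm (sobFun u) (ENNReal.ofReal p) (volume.restrict Ω) ≤ ENNReal.ofReal √((e + ε) / C) := by
    intro ε hε
    refine eLpNorm_le_of_tendstoInMeasure ?_ hmeas fun n => aestronglyMeasurable_sobFun (v n)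
    filter_upwards [hE.eventually_lt_const (show e < e + ε by linarith)] with n hn
    exact (integral_rpow_le_of_eLpNorm_le hp hC (by linarith) (hv n)).2 ((hvE n).trans hn.le)
  have hmem : MemLp (sobFun u) (ENNReal.ofReal p) (volume.restrict Ω) :=
    ⟨aestronglyMeasurable_sobFun u, (key 1 one_pos).trans_lt ENNReal.ofReal_lt_top⟩
  refine ⟨hmem, le_of_forall_pos_le_add fun ε hε => ?_⟩
  exact (integral_rpow_le_of_eLpNorm_le hp hC (by linarith) hmem).1 (key ε hε)

theorem Represents.memLp {u : H10 𝕜 Ω} {φ : Space N → 𝕜} (h : Represents u φ)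
    (hφ : IsTest 𝕜 Ω φ) (p : ENNReal) : MemLp (sobFun u) p (volume.restrict Ω) :=
  (hφ.memLp p _).ae_eq h.1.symm

theorem Represents.integral_rpow {u : H10 𝕜 Ω} {φ : Space N → 𝕜} (h : Represents u φ) (p : ℝ) :
    ∫ x in Ω, ‖sobFun u x‖ ^ p = ∫ x in Ω, ‖φ x‖ ^ p :=
  integral_congr_ae (h.1.mono fun x hx => by simp only [hx])

/-- The `L²` norm of the gradient is continuous on `H¹₀`. -/
theorem continuous_integral_norm_sobGrad_sq :
    Continuous fun u : H10 𝕜 Ω => ∫ x in Ω, ‖sobGrad u x‖ ^ 2 := by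
  have h : (fun u : H10 𝕜 Ω => ∫ x in Ω, ‖sobGrad u x‖ ^ 2) =
      fun u : H10 𝕜 Ω => ‖(u : GraphSpace 𝕜 Ω).snd‖ ^ 2 := by
    ext u
    rw [Lp_two_norm_sq]
    rfl
  rw [h]
  exact (((WithLp.sndL 2 𝕜 (Lp 𝕜 2 (volume.restrict Ω))
      (Lp (EuclideanSpace 𝕜 (Fin N)) 2 (volume.restrict Ω))).continuous.comp
        continuous_subtype_val).norm.pow 2)

theorem H10_real_sobolev (hN : 4 ≤ N) (u : H10 ℝ Ω) :
    MemLp (sobFun u) (ENNReal.ofReal (critExp N)) (volume.restrict Ω) ∧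
      talentiConst N * (∫ x in Ω, ‖sobFun u x‖ ^ critExp N) ^ (2 / critExp N) ≤
        ∫ x in Ω, ‖sobGrad u x‖ ^ 2 := by
  obtain ⟨v, φ, hφ, hv⟩ := exists_seq_test u
  have hp2 := critExp_gt_two hN
  refine sobolev_of_tendsto (by linarith) (talentiConst_pos hN)
    (E := fun n => ∫ x in Ω, ‖sobGrad (v n) x‖ ^ 2)
    (fun n => integral_nonneg fun x => sq_nonneg _) (fun n => (hφ n).2.memLp (hφ n).1 _)
    (fun n => ?_) hv ((continuous_integral_norm_sobGrad_sq.tendsto u).comp hv)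
  rw [(hφ n).2.integral_rpow]
  refine ((hφ n).1.sobolev hN (hφ n).1.continuous_grad
    (fun x hx => grad_eq_zero_of_notMem_tsupport hx) fun x k => ?_).trans (le_of_eq ?_)
  · exact (RCLike.abs_re_le_norm _).trans (norm_inner_le_norm _ _)
  · exact integral_congr_ae ((hφ n).2.2.mono fun x hx => by simp only [hx])

end Limits

/-- The vector potential `A(μ ·)` with complex values. -/
noncomputable def potential {N : ℕ} (A : Space N → Space N) (μ : ℝ) (x : Space N) :
    EuclideanSpace ℂ (Fin N) :=
  WithLp.toLp 2 fun j => ((A (μ • x) j : ℝ) : ℂ)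

section Magnetic

variable {N : ℕ} {Ω : Set (Space N)} {A : Space N → Space N} {μ : ℝ}

theorem norm_potential (x : Space N) : ‖potential A μ x‖ = ‖A (μ • x)‖ := by
  simp [EuclideanSpace.norm_eq, potential]

theorem continuous_potential (hA : Continuous A) : Continuous (potential A μ) := by
  refine (PiLp.continuous_toLp 2 _).comp (continuous_pi fun j => ?_)
  fun_prop

theorem magGrad_eq (u : H10 ℂ Ω) (x : Space N) :
    magGrad A μ u x = (-Complex.I) • sobGrad u x - sobFun u x • potential A μ x := by
  ext j
  simp [magGrad, potential, mul_comm]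

theorem memLp_potential (hA : Continuous A) (hAb : ∃ C : ℝ, ∀ x, ‖A x‖ ≤ C) :
    MemLp (potential A μ) ⊤ (volume.restrict Ω) := by
  obtain ⟨C, hC⟩ := hAb
  exact memLp_top_of_bound (continuous_potential hA).aestronglyMeasurable C
    (Filter.Eventually.of_forall fun x => by rw [norm_potential]; exact hC _)

/-- The magnetic gradient as a bounded operator, for a bounded potential `a`. -/
noncomputable def magGradL (a : Lp (EuclideanSpace ℂ (Fin N)) ⊤ (volume.restrict Ω)) :
    GraphSpace ℂ Ω →L[ℂ] Lp (EuclideanSpace ℂ (Fin N)) 2 (volume.restrict Ω) :=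
  (-Complex.I) • WithLp.sndL 2 ℂ _ _ -
    (((ContinuousLinearMap.lsmul ℂ ℂ).flip.holderL (volume.restrict Ω) ⊤ 2 2) a).comp
      (WithLp.fstL 2 ℂ _ _)

theorem coeFn_magGradL (hA : Continuous A) (hAb : ∃ C : ℝ, ∀ x, ‖A x‖ ≤ C) (u : H10 ℂ Ω) :
    magGradL ((memLp_potential (μ := μ) hA hAb).toLp _) (u : GraphSpace ℂ Ω) =ᵐ[volume.restrict Ω]
      magGrad A μ u := by
  set a := (memLp_potential (Ω := Ω) (μ := μ) hA hAb).toLp _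
  have h1 := ContinuousLinearMap.coeFn_holder (r := 2) (ContinuousLinearMap.lsmul ℂ ℂ).flip a
    (u : GraphSpace ℂ Ω).fst
  have h2 := (memLp_potential (Ω := Ω) (μ := μ) hA hAb).coeFn_toLp
  have h3 := Lp.coeFn_smul (-Complex.I) (u : GraphSpace ℂ Ω).snd
  have h4 := Lp.coeFn_sub ((-Complex.I) • (u : GraphSpace ℂ Ω).snd)
    ((ContinuousLinearMap.lsmul ℂ ℂ).flip.holder 2 a (u : GraphSpace ℂ Ω).fst)
  filter_upwards [h1, h2, h3, h4] with x h1 h2 h3 h4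
  rw [magGrad_eq]
  refine h4.trans ?_
  rw [Pi.sub_apply, h1, h3, Pi.smul_apply, h2]
  rfl

theorem magEnergy_eq (hA : Continuous A) (hAb : ∃ C : ℝ, ∀ x, ‖A x‖ ≤ C) (u : H10 ℂ Ω) :
    ∫ x in Ω, ‖magGrad A μ u x‖ ^ 2 =
      ‖magGradL ((memLp_potential (μ := μ) hA hAb).toLp _) (u : GraphSpace ℂ Ω)‖ ^ 2 := by
  rw [Lp_two_norm_sq]
  exact integral_congr_ae ((coeFn_magGradL (μ := μ) hA hAb u).symm.mono fun x hx => by simp only [hx])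

theorem continuous_magEnergy (hA : Continuous A) (hAb : ∃ C : ℝ, ∀ x, ‖A x‖ ≤ C) :
    Continuous fun u : H10 ℂ Ω => ∫ x in Ω, ‖magGrad A μ u x‖ ^ 2 := by
  simp only [magEnergy_eq hA hAb]
  exact ((ContinuousLinearMap.continuous _).comp continuous_subtype_val).norm.pow 2

theorem magEnergy_smul (hA : Continuous A) (hAb : ∃ C : ℝ, ∀ x, ‖A x‖ ≤ C) (c : ℂ)
    (u : H10 ℂ Ω) :
    ∫ x in Ω, ‖magGrad A μ (c • u) x‖ ^ 2 = ‖c‖ ^ 2 * ∫ x in Ω, ‖magGrad A μ u x‖ ^ 2 := by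
  rw [magEnergy_eq hA hAb, magEnergy_eq hA hAb, Submodule.coe_smul, map_smul, norm_smul, mul_pow]

/-- The diamagnetic mechanism: a real potential adds `i a z` to the derivative, and this is
orthogonal to `z` over the reals. -/
theorem re_inner_I_mul_add (z m : ℂ) (a : ℝ) :
    (inner ℂ z (Complex.I * (m + a * z))).re = (inner ℂ z (Complex.I * m)).re := by
  simp [RCLike.inner_apply, Complex.mul_re, Complex.mul_im]
  ring

/-- The diamagnetic Sobolev inequality with the sharp constant. -/
theorem H10_magnetic_sobolev (hN : 4 ≤ N) (hA : Continuous A) (hAb : ∃ C : ℝ, ∀ x, ‖A x‖ ≤ C)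
    (u : H10 ℂ Ω) :
    MemLp (sobFun u) (ENNReal.ofReal (critExp N)) (volume.restrict Ω) ∧
      talentiConst N * (∫ x in Ω, ‖sobFun u x‖ ^ critExp N) ^ (2 / critExp N) ≤
        ∫ x in Ω, ‖magGrad A μ u x‖ ^ 2 := by
  obtain ⟨v, φ, hφ, hv⟩ := exists_seq_test u
  have hp2 := critExp_gt_two hN
  refine sobolev_of_tendsto (by linarith) (talentiConst_pos hN)
    (E := fun n => ∫ x in Ω, ‖magGrad A μ (v n) x‖ ^ 2)
    (fun n => integral_nonneg fun x => sq_nonneg _) (fun n => (hφ n).2.memLp (hφ n).1 _)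
    (fun n => ?_) hv (((continuous_magEnergy hA hAb).tendsto u).comp hv)
  rw [(hφ n).2.integral_rpow]
  obtain ⟨ht, h1, h2⟩ := hφ n
  have hpot := continuous_potential (μ := μ) hA
  have hgr := ht.continuous_grad
  have hφc := ht.smooth.continuous
  refine (ht.sobolev hN (m := fun x => (-Complex.I) • grad ℂ (φ n) x - φ n x • potential A μ x)
    (by fun_prop) (fun x hx => ?_) fun x k => ?_).trans (le_of_eq ?_)
  · simp [grad_eq_zero_of_notMem_tsupport hx, image_eq_zero_of_notMem_tsupport hx]
  · set z := φ n x
    set d := grad ℂ (φ n) x k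
    set m : ℂ := ((-Complex.I) • grad ℂ (φ n) x - z • potential A μ x) k with hm
    -- Solves the definition of the magnetic gradient for `∂_k φ`, so that the derivative of `|φ|²`
    -- is expressed through `m` alone.
    have hd : d = Complex.I * (m + (A (μ • x) k : ℝ) * z) := by
      have : m = -Complex.I * d - z * (A (μ • x) k : ℝ) := rfl
      rw [this]
      linear_combination d * Complex.I_sq
    have h3 := re_inner_I_mul_add z m (A (μ • x) k)
    rw [← hd] at h3
    change |(inner ℂ z d).re| ≤ _
    rw [h3]
    refine (Complex.abs_re_le_norm _).trans ((norm_inner_le_norm _ _).trans ?_)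
    simp
  · refine integral_congr_ae ?_
    filter_upwards [h1, h2] with x h1 h2
    rw [magGrad_eq, h1, h2]

end Magnetic

end MagneticBN

/-! ### The Talenti constant bounds `sobolevConst` from below -/

namespace MagneticBN

section Real

variable {N : ℕ} {Ω : Set (Space N)}

theorem isFiniteMeasure_restrict (hΩb : Bornology.IsBounded Ω) :
    IsFiniteMeasure (volume.restrict Ω) :=
  ⟨by rw [Measure.restrict_apply_univ]; exact hΩb.measure_lt_top⟩

/-- The second component of an element of `H¹₀` is the weak gradient of the first. -/
theorem weak_gradient (u : H10 ℝ Ω) {g : Space N → ℝ} (hg : IsTest ℝ Ω g) (k : Fin N) :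
    ∫ x in Ω, g x * sobGrad u x k = -∫ x in Ω, grad ℝ g x k * sobFun u x := by
  have hgk : Continuous fun x => EuclideanSpace.single k (g x) :=
    (PiLp.continuous_toLp 2 _).comp
      (continuous_pi fun j => (continuous_apply j).comp
        ((continuous_single k).comp hg.smooth.continuous))
  have hgkc : HasCompactSupport fun x => EuclideanSpace.single k (g x) :=
    HasCompactSupport.intro hg.compact fun x hx => by
      simp [image_eq_zero_of_notMem_tsupport hx]
  have hG : MemLp (fun x => EuclideanSpace.single k (g x)) 2 (volume.restrict Ω) :=
    hgk.memLp_of_hasCompactSupport hgkc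
  have hdc : Continuous fun x => grad ℝ g x k := by
    exact (PiLp.continuous_apply 2 _ k).comp hg.continuous_grad
  have hdcc : HasCompactSupport fun x => grad ℝ g x k :=
    HasCompactSupport.intro hg.compact fun x hx => by
      simp [grad_eq_zero_of_notMem_tsupport hx]
  have hD : MemLp (fun x => grad ℝ g x k) 2 (volume.restrict Ω) :=
    hdc.memLp_of_hasCompactSupport hdcc
  -- Both sides of the identity are `L²` pairings, hence continuous in the pair. It suffices to
  -- check the test graph, where the identity is integration by parts.
  set Φ : GraphSpace ℝ Ω → ℝ := fun w => inner ℝ (hG.toLp _) w.snd + inner ℝ (hD.toLp _) w.fst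
  have hΦ : ∀ w : GraphSpace ℝ Ω, Φ w =
      (∫ x in Ω, g x * w.snd x k) + ∫ x in Ω, grad ℝ g x k * w.fst x := by
    intro w
    simp only [Φ, L2.inner_def]
    congr 1
    · refine integral_congr_ae ?_
      filter_upwards [hG.coeFn_toLp] with x hx
      rw [hx, EuclideanSpace.inner_single_left]
      simp
    · refine integral_congr_ae ?_
      filter_upwards [hD.coeFn_toLp] with x hx
      rw [hx]
      simp [mul_comm]
  have hΦc : Continuous Φ := by
    have h1 := (WithLp.sndL 2 ℝ (Lp ℝ 2 (volume.restrict Ω))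
      (Lp (EuclideanSpace ℝ (Fin N)) 2 (volume.restrict Ω))).continuous
    have h2 := (WithLp.fstL 2 ℝ (Lp ℝ 2 (volume.restrict Ω))
      (Lp (EuclideanSpace ℝ (Fin N)) 2 (volume.restrict Ω))).continuous
    exact (continuous_const.inner h1).add (continuous_const.inner h2)
  have hcl : closure (testGraph ℝ Ω : Set (GraphSpace ℝ Ω)) ⊆ {w | Φ w = 0} := by
    refine closure_minimal ?_ (isClosed_eq hΦc continuous_const)
    rintro w ⟨φ, h1, h2, h3, h4, h5⟩
    have hφ : IsTest ℝ Ω φ := ⟨h1, h2, h3⟩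
    change Φ w = 0
    rw [hΦ]
    have e1 : ∫ x in Ω, g x * w.snd x k = ∫ x, g x * fderiv ℝ φ x (EuclideanSpace.single k 1) := by
      rw [← setIntegral_eq_integral_of_forall_compl_eq_zero (s := Ω)
        (f := fun x => g x * fderiv ℝ φ x (EuclideanSpace.single k 1)) fun x hx => by
        rw [image_eq_zero_of_notMem_tsupport fun h' => hx (hg.support h'), zero_mul]]
      exact integral_congr_ae (h5.mono fun x hx => by simp only [hx, grad_apply])
    have e2 : ∫ x in Ω, grad ℝ g x k * w.fst x =
        ∫ x, fderiv ℝ g x (EuclideanSpace.single k 1) * φ x := by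
      rw [← setIntegral_eq_integral_of_forall_compl_eq_zero (s := Ω)
        (f := fun x => fderiv ℝ g x (EuclideanSpace.single k 1) * φ x) fun x hx => by
        rw [image_eq_zero_of_notMem_tsupport fun h' => hx (h3 h'), mul_zero]]
      exact integral_congr_ae (h4.mono fun x hx => by simp only [hx, grad_apply])
    have hφk : Continuous fun x => fderiv ℝ φ x (EuclideanSpace.single k (1 : ℝ)) :=
      (h1.continuous_fderiv (by simp)).clm_apply continuous_const
    have hip := integral_mul_fderiv_eq_neg_fderiv_mul_of_integrable (μ := volume) (𝕜 := ℝ)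
      (f := g) (g := φ) (v := EuclideanSpace.single k (1 : ℝ))
      ((hdc.mul h1.continuous).integrable_of_hasCompactSupport
        (h2.mul_left (f := fun x => grad ℝ g x k)))
      ((hg.smooth.continuous.mul hφk).integrable_of_hasCompactSupport
        (hg.compact.mul_right (f' := fun x => fderiv ℝ φ x (EuclideanSpace.single k (1 : ℝ)))))
      ((hg.smooth.continuous.mul h1.continuous).integrable_of_hasCompactSupport
        (hg.compact.mul_right (f' := φ)))
      (fun x _ => hg.smooth.differentiable (by simp) x)
      (fun x _ => h1.differentiable (by simp) x)
    rw [e1, e2, hip]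
    ring
  have h := hcl u.2
  change Φ u = 0 at h
  rw [hΦ] at h
  exact eq_neg_of_add_eq_zero_left h

/-- Elements of `H10` are pairs, so a nonzero one might have zero function part; its quotient would
then be `0` by the convention for division and would spoil the infimum `S`. The weak gradient
identity and the fundamental lemma of the calculus of variations exclude this. -/
theorem H10_eq_zero (hΩo : IsOpen Ω) (hΩb : Bornology.IsBounded Ω) {u : H10 ℝ Ω}
    (h : sobFun u =ᵐ[volume.restrict Ω] 0) : u = 0 := by
  have := isFiniteMeasure_restrict hΩb
  have h1 : ∀ k, ∀ᵐ x ∂volume.restrict Ω, sobGrad u x k = 0 := by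
    intro k
    have hint : IntegrableOn (fun x => sobGrad u x k) Ω := by
      have h2 : MemLp (fun x => sobGrad u x k) 2 (volume.restrict Ω) :=
        (memLp_sobGrad u).mono
          ((PiLp.continuous_apply 2 _ k).comp_aestronglyMeasurable (aestronglyMeasurable_sobGrad u))
          (Filter.Eventually.of_forall fun x => PiLp.norm_apply_le _ k)
      exact h2.integrable (by norm_num)
    rw [ae_restrict_iff' hΩo.measurableSet]
    refine hΩo.ae_eq_zero_of_integral_contDiff_smul_eq_zero hint.locallyIntegrableOn
      fun g hg hgc hgs => ?_
    have hw := weak_gradient u (g := g) ⟨hg, hgc, hgs⟩ k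
    have h0 : ∫ x in Ω, grad ℝ g x k * sobFun u x = 0 := by
      rw [integral_congr_ae (g := fun _ => (0 : ℝ)) (h.mono fun x hx => by simp [hx])]
      simp
    rw [h0, neg_zero] at hw
    rw [← setIntegral_eq_integral_of_forall_compl_eq_zero (s := Ω) fun x hx => by
        rw [image_eq_zero_of_notMem_tsupport fun h' => hx (hgs h'), zero_smul]]
    exact hw
  have h2 : (u : GraphSpace ℝ Ω).snd = 0 := by
    rw [Lp.eq_zero_iff_ae_eq_zero]
    filter_upwards [ae_all_iff.2 h1] with x hx
    ext k
    exact hx k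
  have h3 : (u : GraphSpace ℝ Ω).fst = 0 := by
    rw [Lp.eq_zero_iff_ae_eq_zero]
    exact h
  ext1
  refine (WithLp.equiv 2 _).injective ?_
  exact Prod.ext h3 h2

theorem exists_test_ne_zero (hΩo : IsOpen Ω) (hΩn : Ω.Nonempty) :
    ∃ φ : Space N → ℝ, IsTest ℝ Ω φ ∧ ∃ x ∈ Ω, φ x ≠ 0 := by
  obtain ⟨x, hx⟩ := hΩn
  obtain ⟨φ, hφ1, hφ2, hφ3, -, hφ5⟩ := exists_contDiff_tsupport_subset (n := ⊤)
    (hΩo.mem_nhds hx)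
  exact ⟨φ, ⟨hφ3, hφ2, hφ1⟩, x, hx, by rw [hφ5]; exact one_ne_zero⟩

theorem nonempty_ne_zero (hΩo : IsOpen Ω) (hΩn : Ω.Nonempty) :
    Nonempty {u : H10 ℝ Ω // u ≠ 0} := by
  obtain ⟨φ, hφ, x, hx, hφx⟩ := exists_test_ne_zero hΩo hΩn
  obtain ⟨u, hu⟩ := hφ.exists_represents
  refine ⟨⟨u, fun h0 => ?_⟩⟩
  have h1 : sobFun u =ᵐ[volume.restrict Ω] 0 := by
    rw [h0]
    exact Lp.coeFn_zero _ _ _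
  have h2 : φ =ᵐ[volume.restrict Ω] 0 := hu.1.symm.trans h1
  have h3 := (Measure.eqOn_open_of_ae_eq h2 hΩo hφ.smooth.continuous.continuousOn
    continuousOn_const)
  exact hφx (h3 hx)

/-- The only comparison with `S` that is needed. The opposite inequality, which says that `S` does
not depend on `Ω`, plays no role. -/
theorem talentiConst_le_sobolevConst (hN : 4 ≤ N) (hΩo : IsOpen Ω) (hΩn : Ω.Nonempty)
    (hΩb : Bornology.IsBounded Ω) : talentiConst N ≤ sobolevConst Ω := by
  have := nonempty_ne_zero hΩo hΩn
  have hp2 := critExp_gt_two hN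
  refine le_ciInf fun u => ?_
  obtain ⟨h1, h2⟩ := H10_real_sobolev hN u.1
  have h0 : 0 ≤ ∫ x in Ω, ‖sobFun u.1 x‖ ^ critExp N := integral_nonneg fun _ => by positivity
  rcases h0.eq_or_lt with h | h
  · exfalso
    refine u.2 (H10_eq_zero hΩo hΩb ?_)
    have hint := (integrable_norm_rpow_iff (aestronglyMeasurable_sobFun u.1)
      (by simpa using (by linarith : 0 < critExp N)) ENNReal.ofReal_ne_top).2 h1
    rw [ENNReal.toReal_ofReal (by linarith)] at hint
    have h3 := (integral_eq_zero_iff_of_nonneg (fun _ => by positivity) hint).1 h.symm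
    filter_upwards [h3] with x hx
    have := (Real.rpow_eq_zero (norm_nonneg _) (by linarith)).1 hx
    simpa using this
  · rw [le_div_iff₀ (Real.rpow_pos_of_pos h _)]
    exact h2

end Real

end MagneticBN

/-! ### Mountain pass geometry -/

namespace MagneticBN

section Geometry

variable {N : ℕ} {Ω : Set (Space N)} {A : Space N → Space N} {μ q : ℝ}

theorem magGrad_zero (x : Space N) (h : sobFun (0 : H10 ℂ Ω) x = 0)
    (h' : sobGrad (0 : H10 ℂ Ω) x = 0) : magGrad A μ (0 : H10 ℂ Ω) x = 0 := by
  rw [magGrad_eq, h, h', smul_zero, zero_smul, sub_zero]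

theorem magEnergy_zero :
    ∫ x in Ω, ‖magGrad A μ (0 : H10 ℂ Ω) x‖ ^ 2 = 0 := by
  rw [integral_congr_ae (g := fun _ => (0 : ℝ)), integral_zero]
  have h1 : sobFun (0 : H10 ℂ Ω) =ᵐ[volume.restrict Ω] 0 := Lp.coeFn_zero _ _ _
  have h2 : sobGrad (0 : H10 ℂ Ω) =ᵐ[volume.restrict Ω] 0 := Lp.coeFn_zero _ _ _
  filter_upwards [h1, h2] with x h1 h2
  simp [magGrad_zero x h1 h2]

theorem magEnergy_nonneg (u : H10 ℂ Ω) : 0 ≤ ∫ x in Ω, ‖magGrad A μ u x‖ ^ 2 :=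
  integral_nonneg fun _ => sq_nonneg _

theorem lambdaOne_mul_le (u : H10 ℂ Ω) :
    lambdaOne A Ω μ * (∫ x in Ω, ‖sobFun u x‖ ^ 2) ≤ ∫ x in Ω, ‖magGrad A μ u x‖ ^ 2 := by
  have h0 : 0 ≤ ∫ x in Ω, ‖sobFun u x‖ ^ 2 := integral_nonneg fun _ => sq_nonneg _
  rcases h0.eq_or_lt with h | h
  · rw [← h, mul_zero]
    exact magEnergy_nonneg u
  have hu : u ≠ 0 := by
    rintro rfl
    have h1 : sobFun (0 : H10 ℂ Ω) =ᵐ[volume.restrict Ω] 0 := Lp.coeFn_zero _ _ _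
    rw [integral_congr_ae (g := fun _ => (0 : ℝ)) (h1.mono fun x hx => by simp [hx]),
      integral_zero] at h
    exact lt_irrefl _ h
  rw [← le_div_iff₀ h]
  refine ciInf_le (f := fun u : {u : H10 ℂ Ω // u ≠ 0} =>
    (∫ x in Ω, ‖magGrad A μ u.1 x‖ ^ 2) / (∫ x in Ω, ‖sobFun u.1 x‖ ^ 2)) ⟨0, ?_⟩ ⟨u, hu⟩
  rintro _ ⟨v, rfl⟩
  exact div_nonneg (magEnergy_nonneg v.1) (integral_nonneg fun _ => sq_nonneg _)

/-- Below the threshold `t` the first term suffices, above it the second. Choosing `t` later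
replaces Hölder's inequality on a domain of finite measure. -/
theorem rpow_le_rpow_add_mul_rpow {p s t : ℝ} (hs : 0 ≤ s) (ht : 0 < t) (hq : 0 ≤ q)
    (hqp : q ≤ p) : s ^ q ≤ t ^ q + t ^ (q - p) * s ^ p := by
  rcases le_or_gt s t with h | h
  · have h1 := Real.rpow_le_rpow hs h hq
    have h2 : 0 ≤ t ^ (q - p) * s ^ p := by positivity
    linarith
  · have hs0 : 0 < s := ht.trans h
    have h1 : s ^ (q - p) ≤ t ^ (q - p) :=
      Real.rpow_le_rpow_of_nonpos ht h.le (by linarith)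
    have h2 := mul_le_mul_of_nonneg_right h1 (Real.rpow_nonneg hs p)
    rw [← Real.rpow_add hs0, sub_add_cancel] at h2
    have h3 : 0 ≤ t ^ q := by positivity
    linarith

theorem integrable_sobFun_critExp (hN : 4 ≤ N) (hA : Continuous A)
    (hAb : ∃ C : ℝ, ∀ x, ‖A x‖ ≤ C) (u : H10 ℂ Ω) :
    Integrable (fun x => ‖sobFun u x‖ ^ critExp N) (volume.restrict Ω) := by
  have hp2 := critExp_gt_two hN
  have h := (integrable_norm_rpow_iff (aestronglyMeasurable_sobFun u)
      (by simpa using (by linarith : 0 < critExp N)) ENNReal.ofReal_ne_top).2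
      (H10_magnetic_sobolev (μ := 0) hN hA hAb u).1
  rwa [ENNReal.toReal_ofReal (by linarith)] at h

theorem integral_critExp_le (hN : 4 ≤ N) (hA : Continuous A) (hAb : ∃ C : ℝ, ∀ x, ‖A x‖ ≤ C)
    (u : H10 ℂ Ω) :
    ∫ x in Ω, ‖sobFun u x‖ ^ critExp N ≤
      (talentiConst N)⁻¹ ^ (critExp N / 2) *
        (∫ x in Ω, ‖magGrad A μ u x‖ ^ 2) ^ (critExp N / 2) := by
  have hp2 := critExp_gt_two hN
  have hC := talentiConst_pos hN
  have h := (H10_magnetic_sobolev (μ := μ) hN hA hAb u).2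
  have h0 : 0 ≤ ∫ x in Ω, ‖sobFun u x‖ ^ critExp N := integral_nonneg fun _ => by positivity
  have h1 : (∫ x in Ω, ‖sobFun u x‖ ^ critExp N) ^ (2 / critExp N) ≤
      (talentiConst N)⁻¹ * ∫ x in Ω, ‖magGrad A μ u x‖ ^ 2 := by
    rw [← div_eq_inv_mul, le_div_iff₀ hC, mul_comm]
    exact h
  have h2 := Real.rpow_le_rpow (Real.rpow_nonneg h0 _) h1 (by linarith : 0 ≤ critExp N / 2)
  rw [← Real.rpow_mul h0, Real.mul_rpow (by positivity) (magEnergy_nonneg u)] at h2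
  have e : 2 / critExp N * (critExp N / 2) = 1 := by
    field_simp
  rwa [e, Real.rpow_one] at h2

theorem integrable_sobFun_rpow (hN : 4 ≤ N) (hΩb : Bornology.IsBounded Ω) (hA : Continuous A)
    (hAb : ∃ C : ℝ, ∀ x, ‖A x‖ ≤ C) (hq : 0 < q) (hqp : q ≤ critExp N) (u : H10 ℂ Ω) :
    Integrable (fun x => ‖sobFun u x‖ ^ q) (volume.restrict Ω) := by
  have := isFiniteMeasure_restrict hΩb
  have h := ((H10_magnetic_sobolev (μ := 0) hN hA hAb u).1.mono_exponent
    (ENNReal.ofReal_le_ofReal hqp)).integrable_norm_rpow (by simpa using hq) ENNReal.ofReal_ne_top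
  rwa [ENNReal.toReal_ofReal hq.le] at h

/-- Cut at the height `√E`: the two terms of the pointwise bound then both scale as `E^(q/2)`. -/
theorem integral_rpow_le (hN : 4 ≤ N) (hΩb : Bornology.IsBounded Ω) (hA : Continuous A)
    (hAb : ∃ C : ℝ, ∀ x, ‖A x‖ ≤ C) (hq : 0 < q) (hqp : q ≤ critExp N) (u : H10 ℂ Ω) :
    ∫ x in Ω, ‖sobFun u x‖ ^ q ≤
      (volume.real Ω + (talentiConst N)⁻¹ ^ (critExp N / 2)) *
        (∫ x in Ω, ‖magGrad A μ u x‖ ^ 2) ^ (q / 2) := by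
  have := isFiniteMeasure_restrict hΩb
  have hp2 := critExp_gt_two hN
  have hC := talentiConst_pos hN
  set E := ∫ x in Ω, ‖magGrad A μ u x‖ ^ 2 with hE
  set κ := (talentiConst N)⁻¹ ^ (critExp N / 2)
  have hκ : 0 ≤ κ := by positivity
  have main : ∀ e : ℝ, 0 < e → E ≤ e → ∫ x in Ω, ‖sobFun u x‖ ^ q ≤
      (volume.real Ω + κ) * e ^ (q / 2) := by
    intro e he hEe
    have h1 : ∫ x in Ω, ‖sobFun u x‖ ^ q ≤
        ∫ x in Ω, ((√e) ^ q + (√e) ^ (q - critExp N) * ‖sobFun u x‖ ^ critExp N) :=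
      integral_mono (integrable_sobFun_rpow hN hΩb hA hAb hq hqp u)
        ((integrable_const _).add
          ((integrable_sobFun_critExp hN hA hAb u).const_mul _))
        fun x => rpow_le_rpow_add_mul_rpow (norm_nonneg _) (Real.sqrt_pos.2 he) hq.le hqp
    rw [integral_add (integrable_const _)
      ((integrable_sobFun_critExp hN hA hAb u).const_mul _), integral_const_mul,
      integral_const, measureReal_restrict_apply_univ, smul_eq_mul] at h1
    have h2 := integral_critExp_le (μ := μ) hN hA hAb u
    have h3 : E ^ (critExp N / 2) ≤ e ^ (critExp N / 2) :=
      Real.rpow_le_rpow (magEnergy_nonneg u) hEe (by linarith)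
    have h4 := mul_le_mul_of_nonneg_left (h2.trans (mul_le_mul_of_nonneg_left h3 hκ))
      (Real.rpow_nonneg (Real.sqrt_nonneg e) (q - critExp N))
    have e1 : (√e) ^ q = e ^ (q / 2) := by
      rw [Real.sqrt_eq_rpow, ← Real.rpow_mul he.le]
      congr 1
      ring
    have e2 : (√e) ^ (q - critExp N) * (κ * e ^ (critExp N / 2)) = κ * e ^ (q / 2) := by
      rw [Real.sqrt_eq_rpow, ← Real.rpow_mul he.le, mul_left_comm, ← Real.rpow_add he]
      congr 2
      ring
    rw [e1] at h1
    rw [e2] at h4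
    linarith
  -- For `E = 0` the height `√E` is not admissible; positive `e` are used instead and sent to `0`.
  rcases (magEnergy_nonneg u : 0 ≤ E).eq_or_lt with h | h
  · change 0 = E at h
    rw [← h, Real.zero_rpow (by positivity), mul_zero]
    have hlim : Filter.Tendsto (fun e : ℝ => (volume.real Ω + κ) * e ^ (q / 2))
        (nhdsWithin 0 (Set.Ioi 0)) (nhds 0) := by
      have hc : Continuous fun e : ℝ => (volume.real Ω + κ) * e ^ (q / 2) :=
        continuous_const.mul (Real.continuous_rpow_const (by positivity))
      have h1 := (hc.tendsto 0).mono_left (nhdsWithin_le_nhds (s := Set.Ioi 0))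
      simpa [Real.zero_rpow (by positivity : q / 2 ≠ 0)] using h1
    refine ge_of_tendsto hlim ?_
    filter_upwards [self_mem_nhdsWithin] with e he
    exact main e he (h ▸ (Set.mem_Ioi.1 he).le)
  · exact main E h le_rfl

theorem energy_le (hN : 4 ≤ N) (hq : 0 < q) (hμ : 0 < μ) (u : H10 ℂ Ω) :
    energy A Ω q μ u ≤ (1 / 2) * ∫ x in Ω, ‖magGrad A μ u x‖ ^ 2 := by
  have hp2 := critExp_gt_two hN
  have h1 : 0 ≤ μ / q * (∫ x in Ω, ‖sobFun u x‖ ^ q) :=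
    mul_nonneg (by positivity) (integral_nonneg fun _ => by positivity)
  have h2 : 0 ≤ 1 / critExp N * (∫ x in Ω, ‖sobFun u x‖ ^ critExp N) :=
    mul_nonneg (by positivity) (integral_nonneg fun _ => by positivity)
  rw [energy]
  linarith

/-- A lower bound of the functional by a function of the magnetic energy. -/
theorem energy_ge (hN : 4 ≤ N) (hΩb : Bornology.IsBounded Ω) (hA : Continuous A)
    (hAb : ∃ C : ℝ, ∀ x, ‖A x‖ ≤ C) (hq2 : 2 ≤ q) (hqp : q ≤ critExp N) (hμ : 0 < μ)
    (hμq : q = 2 → μ < lambdaOne A Ω μ) :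
    ∃ κ a r s : ℝ, 0 < κ ∧ 0 ≤ a ∧ 1 < r ∧ 1 < s ∧ ∀ u : H10 ℂ Ω,
      κ * (∫ x in Ω, ‖magGrad A μ u x‖ ^ 2) - a * (∫ x in Ω, ‖magGrad A μ u x‖ ^ 2) ^ r -
        a * (∫ x in Ω, ‖magGrad A μ u x‖ ^ 2) ^ s ≤ energy A Ω q μ u := by
  have hp2 := critExp_gt_two hN
  have hC := talentiConst_pos hN
  set κ₀ := (talentiConst N)⁻¹ ^ (critExp N / 2) with hκ₀
  have hκ₀0 : 0 ≤ κ₀ := by positivity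
  set V := volume.real Ω + κ₀ with hV
  have hV0 : 0 ≤ V := by positivity
  have hcrit : ∀ u : H10 ℂ Ω, 1 / critExp N * (∫ x in Ω, ‖sobFun u x‖ ^ critExp N) ≤
      κ₀ * (∫ x in Ω, ‖magGrad A μ u x‖ ^ 2) ^ (critExp N / 2) := by
    intro u
    have h1 := integral_critExp_le (μ := μ) hN hA hAb u
    have h2 : 1 / critExp N ≤ 1 := by rw [div_le_one (by linarith)]; linarith
    have h3 : 0 ≤ ∫ x in Ω, ‖sobFun u x‖ ^ critExp N := integral_nonneg fun _ => by positivity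
    exact (mul_le_of_le_one_left h3 h2).trans h1
  rcases hq2.eq_or_lt with h | h
  · subst h
    have hlam := hμq rfl
    have hlam0 : 0 < lambdaOne A Ω μ := hμ.trans hlam
    refine ⟨(1 - μ / lambdaOne A Ω μ) / 2, κ₀, 2, critExp N / 2, ?_, hκ₀0, by norm_num,
      by linarith, fun u => ?_⟩
    · have : μ / lambdaOne A Ω μ < 1 := (div_lt_one hlam0).2 hlam
      linarith
    · have h1 := lambdaOne_mul_le (A := A) (μ := μ) u
      have h2 := hcrit u
      have h3 : (∫ x in Ω, ‖sobFun u x‖ ^ (2 : ℝ)) ≤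
          (∫ x in Ω, ‖magGrad A μ u x‖ ^ 2) / lambdaOne A Ω μ := by
        rw [le_div_iff₀ hlam0, mul_comm]
        simpa only [Real.rpow_two] using h1
      have h4 := mul_le_mul_of_nonneg_left h3 (by positivity : 0 ≤ μ / 2)
      have h5 : 0 ≤ κ₀ * (∫ x in Ω, ‖magGrad A μ u x‖ ^ 2) ^ (2 : ℝ) :=
        mul_nonneg hκ₀0 (Real.rpow_nonneg (magEnergy_nonneg u) _)
      rw [energy]
      have e : (1 - μ / lambdaOne A Ω μ) / 2 * (∫ x in Ω, ‖magGrad A μ u x‖ ^ 2) =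
          1 / 2 * (∫ x in Ω, ‖magGrad A μ u x‖ ^ 2) -
            μ / 2 * ((∫ x in Ω, ‖magGrad A μ u x‖ ^ 2) / lambdaOne A Ω μ) := by ring
      rw [e]
      linarith
  · refine ⟨1 / 2, μ / q * V + κ₀, q / 2, critExp N / 2, by norm_num, by positivity, by linarith,
      by linarith, fun u => ?_⟩
    have h1 := mul_le_mul_of_nonneg_left
      (integral_rpow_le (μ := μ) hN hΩb hA hAb (by linarith : 0 < q) hqp u)
      (by positivity : 0 ≤ μ / q)
    have h2 := hcrit u
    have h3 : 0 ≤ κ₀ * (∫ x in Ω, ‖magGrad A μ u x‖ ^ 2) ^ (q / 2) :=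
      mul_nonneg hκ₀0 (Real.rpow_nonneg (magEnergy_nonneg u) _)
    have h4 : 0 ≤ μ / q * V * (∫ x in Ω, ‖magGrad A μ u x‖ ^ 2) ^ (critExp N / 2) :=
      mul_nonneg (by positivity) (Real.rpow_nonneg (magEnergy_nonneg u) _)
    rw [energy]
    linarith

/-- After division by `t` the error is `a t^(r-1) + a t^(s-1)`, which is continuous and vanishes at
`0` because `r, s > 1`. -/
theorem exists_pos_forall_mul_le {κ a r s : ℝ} (hκ : 0 < κ) (hr : 1 < r)
    (hs : 1 < s) :
    ∃ e : ℝ, 0 < e ∧ ∀ t, 0 ≤ t → t ≤ e → κ / 2 * t ≤ κ * t - a * t ^ r - a * t ^ s := by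
  have hc : Continuous fun t : ℝ => a * t ^ (r - 1) + a * t ^ (s - 1) :=
    (continuous_const.mul (Real.continuous_rpow_const (by linarith))).add
      (continuous_const.mul (Real.continuous_rpow_const (by linarith)))
  have h0 : a * (0 : ℝ) ^ (r - 1) + a * (0 : ℝ) ^ (s - 1) < κ / 2 := by
    rw [Real.zero_rpow (by linarith), Real.zero_rpow (by linarith)]
    linarith
  have hev := hc.continuousAt.eventually_lt_const h0
  obtain ⟨e, he, hball⟩ := Metric.eventually_nhds_iff.1 hev
  refine ⟨e / 2, by positivity, fun t ht hte => ?_⟩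
  rcases ht.eq_or_lt with rfl | ht
  · rw [Real.zero_rpow (by linarith), Real.zero_rpow (by linarith)]
    simp
  have h1 := hball (y := t) (by rw [Real.dist_eq, sub_zero, abs_of_pos ht]; linarith)
  have h2 := mul_le_mul_of_nonneg_left h1.le ht.le
  have e1 : t * t ^ (r - 1) = t ^ r := by
    nth_rw 1 [← Real.rpow_one t]
    rw [← Real.rpow_add ht]
    congr 1
    ring
  have e2 : t * t ^ (s - 1) = t ^ s := by
    nth_rw 1 [← Real.rpow_one t]
    rw [← Real.rpow_add ht]
    congr 1
    ring
  rw [mul_add, mul_left_comm, e1, mul_left_comm, e2] at h2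
  linarith

/-- The mountain pass geometry: along every admissible path the functional exceeds a positive
constant. -/
theorem exists_pos_le_iSup_energy (hN : 4 ≤ N) (hΩb : Bornology.IsBounded Ω) (hA : Continuous A)
    (hAb : ∃ C : ℝ, ∀ x, ‖A x‖ ≤ C) (hq2 : 2 ≤ q) (hqp : q ≤ critExp N) (hμ : 0 < μ)
    (hμq : q = 2 → μ < lambdaOne A Ω μ) :
    ∃ b : ℝ, 0 < b ∧ ∀ γ : mountainPaths A Ω q μ,
      b ≤ ⨆ t : unitInterval, energy A Ω q μ (γ.1 t) := by
  obtain ⟨κ, a, r, s, hκ, ha, hr, hs, hge⟩ := energy_ge hN hΩb hA hAb hq2 hqp hμ hμq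
  obtain ⟨e, he, hle⟩ := exists_pos_forall_mul_le (a := a) hκ hr hs
  refine ⟨κ / 2 * e, by positivity, fun γ => ?_⟩
  set f : unitInterval → ℝ := fun t => ∫ x in Ω, ‖magGrad A μ (γ.1 t) x‖ ^ 2 with hf
  have hfc : Continuous f := (continuous_magEnergy hA hAb).comp γ.1.continuous
  have hf0 : f 0 = 0 := by
    simp only [hf]
    rw [γ.2.1, magEnergy_zero]
  -- A magnetic energy below `e` would make the functional nonnegative at the endpoint.
  have hf1 : e ≤ f 1 := by
    by_contra! hlt
    have h1 := hle (f 1) (magEnergy_nonneg _) hlt.le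
    have h2 := hge (γ.1 1)
    have h3 := γ.2.2
    have h4 : 0 ≤ κ / 2 * f 1 := mul_nonneg (by positivity) (magEnergy_nonneg _)
    linarith
  obtain ⟨t, ht⟩ := mem_range_of_exists_le_of_exists_ge hfc ⟨0, hf0.le.trans he.le⟩ ⟨1, hf1⟩
  -- Without this the real supremum could be the default value `0`. Since `energy ≤ E / 2`,
  -- compactness and continuity of `E` are enough, and continuity of the functional is not needed.
  have hbdd : BddAbove (Set.range fun t : unitInterval => energy A Ω q μ (γ.1 t)) := by
    obtain ⟨B, hB⟩ := (isCompact_range hfc).bddAbove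
    refine ⟨1 / 2 * B, ?_⟩
    rintro _ ⟨t, rfl⟩
    refine (energy_le hN (by linarith) hμ _).trans ?_
    exact mul_le_mul_of_nonneg_left (hB ⟨t, rfl⟩) (by norm_num)
  have h1 := hle (f t) (magEnergy_nonneg _) ht.le
  have h2 := hge (γ.1 t)
  refine le_trans ?_ (le_ciSup hbdd t)
  rw [← ht]
  exact h1.trans h2

end Geometry

end MagneticBN

/-! ### Truncated Talenti functions -/

namespace MagneticBN

/-- A smooth convex function that vanishes for `z ≤ κ` and is at least `z - 2κ`. -/
noncomputable def softCut (κ z : ℝ) : ℝ :=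
  κ * ∫ t in (1 : ℝ)..(z / κ), Real.smoothTransition (t - 1)

theorem continuous_smoothTransition_sub :
    Continuous fun t : ℝ => Real.smoothTransition (t - 1) :=
  Real.smoothTransition.continuous.comp (continuous_id.sub continuous_const)

section Cut

variable {κ : ℝ}

theorem hasDerivAt_softCut (hκ : 0 < κ) (z : ℝ) :
    HasDerivAt (softCut κ) (Real.smoothTransition (z / κ - 1)) z := by
  have h1 := hasDerivAt_primitive continuous_smoothTransition_sub 1 (z / κ)
  have h2 := (h1.comp z ((hasDerivAt_id z).div_const κ)).const_mul κ
  have e : κ * (Real.smoothTransition (z / κ - 1) * (1 / κ)) =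
      Real.smoothTransition (z / κ - 1) := by
    field_simp
  rw [← e]
  exact h2

theorem contDiff_softCut (hκ : 0 < κ) : ContDiff ℝ ∞ (softCut κ) := by
  rw [contDiff_infty_iff_deriv]
  refine ⟨fun z => (hasDerivAt_softCut hκ z).differentiableAt, ?_⟩
  have e : deriv (softCut κ) = fun z => Real.smoothTransition (z / κ - 1) :=
    funext fun z => (hasDerivAt_softCut hκ z).deriv
  rw [e]
  exact (Real.smoothTransition.contDiff (n := ⊤)).comp
    ((contDiff_id.div_const κ).sub contDiff_const)

theorem softCut_of_le (hκ : 0 < κ) {z : ℝ} (hz : z ≤ κ) : softCut κ z = 0 := by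
  have h1 : z / κ ≤ 1 := (div_le_one hκ).2 hz
  rw [softCut, intervalIntegral.integral_congr (g := fun _ => (0 : ℝ))]
  · simp
  · intro t ht
    rw [Set.uIcc_of_ge h1] at ht
    exact Real.smoothTransition.zero_of_nonpos (by linarith [ht.2])

theorem monotone_softCut (hκ : 0 < κ) : Monotone (softCut κ) :=
  monotone_of_hasDerivAt_nonneg (hasDerivAt_softCut hκ) fun _ => Real.smoothTransition.nonneg _

theorem softCut_nonneg (hκ : 0 < κ) (z : ℝ) : 0 ≤ softCut κ z := by
  rcases le_total z κ with h | h
  · rw [softCut_of_le hκ h]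
  · rw [← softCut_of_le hκ le_rfl]
    exact monotone_softCut hκ h

theorem antitone_softCut_sub (hκ : 0 < κ) : Antitone fun z => softCut κ z - z :=
  antitone_of_hasDerivAt_nonpos (fun z => (hasDerivAt_softCut hκ z).sub (hasDerivAt_id z))
    fun _ => sub_nonpos.2 (Real.smoothTransition.le_one _)

theorem softCut_le (hκ : 0 < κ) {z : ℝ} (hz : 0 ≤ z) : softCut κ z ≤ z := by
  have h := antitone_softCut_sub hκ hz
  simp only [softCut_of_le hκ hκ.le] at h
  linarith

theorem le_softCut (hκ : 0 < κ) (z : ℝ) : z - 2 * κ ≤ softCut κ z := by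
  rcases le_total z (2 * κ) with h | h
  · linarith [softCut_nonneg hκ z]
  · have hm : MonotoneOn (fun z => softCut κ z - z) (Set.Ici (2 * κ)) := by
      refine monotoneOn_of_hasDerivWithinAt_nonneg (convex_Ici _)
        ((contDiff_softCut hκ).continuous.sub continuous_id).continuousOn
        (fun x _ => ((hasDerivAt_softCut hκ x).sub (hasDerivAt_id x)).hasDerivWithinAt) ?_
      intro x hx
      rw [interior_Ici] at hx
      have h1 : 2 ≤ x / κ := by rw [le_div_iff₀ hκ]; exact (Set.mem_Ioi.1 hx).le
      rw [Real.smoothTransition.one_of_one_le (by linarith), sub_self]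
    have h1 := hm Set.self_mem_Ici h h
    simp only at h1
    linarith [softCut_nonneg hκ (2 * κ)]

end Cut

/-- A smooth truncation of the Talenti function `(1 + |y|²)^(-(N-2)/2)` at height `κ`. -/
noncomputable def talentiCut {N : ℕ} (κ : ℝ) (y : Space N) : ℝ :=
  softCut κ (bracketPow (((N : ℝ) - 2) / 2) y)

section Truncation

variable {N : ℕ} {κ : ℝ}

theorem talentiCut_nonneg (hκ : 0 < κ) (y : Space N) : 0 ≤ talentiCut κ y := softCut_nonneg hκ _

theorem talentiCut_le (hκ : 0 < κ) (y : Space N) :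
    talentiCut κ y ≤ bracketPow (((N : ℝ) - 2) / 2) y := softCut_le hκ (bracketPow_pos _ _).le

theorem contDiff_talentiCut (hκ : 0 < κ) : ContDiff ℝ ∞ (talentiCut κ : Space N → ℝ) :=
  (contDiff_softCut hκ).comp (contDiff_bracketPow _)

theorem talentiCut_eq_zero (hN : 4 ≤ N) {R : ℝ} (hR : 0 ≤ R)
    (hκ : κ = (1 + R ^ 2) ^ (-(((N : ℝ) - 2) / 2))) {y : Space N} (hy : R ≤ ‖y‖) :
    talentiCut κ y = 0 := by
  have h4 : (4 : ℝ) ≤ N := by exact_mod_cast hN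
  have hκ0 : 0 < κ := by rw [hκ]; positivity
  refine softCut_of_le hκ0 ?_
  rw [hκ, bracketPow]
  exact Real.rpow_le_rpow_of_nonpos (by positivity) (by gcongr) (by linarith)

/-- Truncation by height rather than by a spatial cutoff pays off here: `softCut` has slope in `[0,
1]`, so the gradient shrinks pointwise and the Dirichlet energy has no error term. -/
theorem sum_fderiv_talentiCut_sq_le (hκ : 0 < κ) (y : Space N) :
    ∑ k, fderiv ℝ (talentiCut κ) y (EuclideanSpace.single k (1 : ℝ)) ^ 2 ≤
      ((N : ℝ) - 2) ^ 2 * (‖y‖ ^ 2 * bracketPow (N : ℝ) y) := by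
  set s := ((N : ℝ) - 2) / 2 with hs
  set σ := Real.smoothTransition (bracketPow s y / κ - 1)
  have h1 : ∀ k : Fin N, fderiv ℝ (talentiCut κ) y (EuclideanSpace.single k (1 : ℝ)) ^ 2 =
      σ ^ 2 * (((N : ℝ) - 2) ^ 2 * bracketPow (s + 1) y ^ 2) * y k ^ 2 := by
    intro k
    have hd : HasFDerivAt (talentiCut κ) (σ • fderiv ℝ (bracketPow s) y) y :=
      (hasDerivAt_softCut hκ _).comp_hasFDerivAt y
        ((contDiff_bracketPow s).differentiable (by simp) y).hasFDerivAt
    rw [hd.fderiv, smul_apply, fderiv_bracketPow, EuclideanSpace.inner_single_right]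
    simp only [smul_eq_mul, hs]
    simp
    ring
  have h2 : bracketPow (s + 1) y ^ 2 = bracketPow (N : ℝ) y := by
    rw [sq, bracketPow_mul]
    congr 1
    rw [hs]
    ring
  have hσ : σ ^ 2 ≤ 1 :=
    pow_le_one₀ (Real.smoothTransition.nonneg _) (Real.smoothTransition.le_one _)
  simp only [h1, h2]
  rw [← Finset.mul_sum, sum_coord_sq]
  have h3 : 0 ≤ ((N : ℝ) - 2) ^ 2 * bracketPow (N : ℝ) y * ‖y‖ ^ 2 := by
    have := bracketPow_pos (N : ℝ) y
    positivity
  nlinarith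

theorem hasCompactSupport_talentiCut (hN : 4 ≤ N) {R : ℝ} (hR : 0 ≤ R)
    (hκ : κ = (1 + R ^ 2) ^ (-(((N : ℝ) - 2) / 2))) :
    HasCompactSupport (talentiCut κ : Space N → ℝ) :=
  HasCompactSupport.intro (isCompact_closedBall (0 : Space N) R) fun y hy =>
    talentiCut_eq_zero hN hR hκ (by
      rw [mem_closedBall_zero_iff, not_le] at hy
      exact hy.le)

theorem critExp_mul (hN : 4 ≤ N) : ((N : ℝ) - 2) / 2 * critExp N = N := by
  have h4 : (4 : ℝ) ≤ N := by exact_mod_cast hN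
  have : (N : ℝ) - 2 ≠ 0 := by linarith
  rw [critExp]
  field_simp

/-- Bernoulli's inequality for truncated powers. -/
theorem rpow_sub_le {p U v κ : ℝ} (hp : 1 ≤ p) (hU : 0 < U) (hv0 : 0 ≤ v)
    (hv : U - 2 * κ ≤ v) : U ^ p - 2 * κ * p * U ^ (p - 1) ≤ v ^ p := by
  have e : U ^ p - 2 * κ * p * U ^ (p - 1) = U ^ p * (1 + p * (-(2 * κ / U))) := by
    rw [Real.rpow_sub_one hU.ne']
    field_simp
    ring
  rw [e]
  rcases le_total (2 * κ) U with h | h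
  · have h1 := one_add_mul_self_le_rpow_one_add (s := -(2 * κ / U)) (by
      rw [neg_le_neg_iff, div_le_one hU]; exact h) hp
    refine (mul_le_mul_of_nonneg_left h1 (Real.rpow_nonneg hU.le p)).trans ?_
    have h2 : 0 ≤ 1 + -(2 * κ / U) := by
      rw [← sub_eq_add_neg, sub_nonneg, div_le_one hU]; exact h
    rw [← Real.mul_rpow hU.le h2]
    refine Real.rpow_le_rpow (mul_nonneg hU.le h2) ?_ (by linarith)
    have : U * (1 + -(2 * κ / U)) = U - 2 * κ := by field_simp; ring
    rw [this]
    exact hv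
  · have h1 : 1 ≤ 2 * κ / U := by rw [le_div_iff₀ hU]; linarith
    have h2 : 1 + p * (-(2 * κ / U)) ≤ 0 := by nlinarith
    exact (mul_nonpos_of_nonneg_of_nonpos (Real.rpow_nonneg hU.le p) h2).trans
      (Real.rpow_nonneg hv0 p)

theorem integrable_talentiCut_rpow (hN : 4 ≤ N) {R : ℝ} (hR : 0 ≤ R)
    (hκ : κ = (1 + R ^ 2) ^ (-(((N : ℝ) - 2) / 2))) {q : ℝ} (hq : 0 < q) :
    Integrable fun y : Space N => talentiCut κ y ^ q := by
  have hκ0 : 0 < κ := by rw [hκ]; positivity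
  refine Continuous.integrable_of_hasCompactSupport
    ((contDiff_talentiCut hκ0).continuous.rpow_const fun y => Or.inr hq.le) ?_
  refine HasCompactSupport.intro (isCompact_closedBall (0 : Space N) R) fun y hy => ?_
  rw [talentiCut_eq_zero hN hR hκ (by
      rw [mem_closedBall_zero_iff, not_le] at hy
      exact hy.le), Real.zero_rpow hq.ne']

/-- The loss is linear in `κ`, since `v ≥ U - 2κ` and `U^{2*-1} = (1 + |y|²)^(-(N+2)/2)` is
integrable. -/
theorem le_integral_talentiCut_critExp (hN : 4 ≤ N) {R : ℝ} (hR : 0 ≤ R)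
    (hκ : κ = (1 + R ^ 2) ^ (-(((N : ℝ) - 2) / 2))) :
    talentiMass N - 2 * κ * critExp N * (∫ y : Space N, bracketPow (((N : ℝ) + 2) / 2) y) ≤
      ∫ y : Space N, talentiCut κ y ^ critExp N := by
  have h4 : (4 : ℝ) ≤ N := by exact_mod_cast hN
  have hp2 := critExp_gt_two hN
  have hκ0 : 0 < κ := by rw [hκ]; positivity
  have hi1 : Integrable (bracketPow (N : ℝ) : Space N → ℝ) := integrable_bracketPow (by linarith)
  have hi2 : Integrable (bracketPow (((N : ℝ) + 2) / 2) : Space N → ℝ) :=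
    integrable_bracketPow (by linarith)
  rw [talentiMass, ← integral_const_mul, ← integral_sub hi1 (hi2.const_mul _)]
  refine integral_mono (hi1.sub (hi2.const_mul _))
    (integrable_talentiCut_rpow hN hR hκ (by linarith)) fun y => ?_
  have h := rpow_sub_le (p := critExp N) (by linarith) (bracketPow_pos (((N : ℝ) - 2) / 2) y)
    (talentiCut_nonneg hκ0 y) (le_softCut hκ0 _)
  rw [bracketPow_rpow, bracketPow_rpow, critExp_mul hN, mul_sub, critExp_mul hN] at h
  have e : (N : ℝ) - ((N : ℝ) - 2) / 2 * 1 = ((N : ℝ) + 2) / 2 := by ring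
  rw [e] at h
  exact h

/-- For `N = 4` the square of `U` just fails to be integrable. Sacrificing a power `σ` of the radius
of the support restores integrability and treats all dimensions alike. -/
theorem integral_talentiCut_sq_le (hN : 4 ≤ N) {R : ℝ} (hR : 0 ≤ R)
    (hκ : κ = (1 + R ^ 2) ^ (-(((N : ℝ) - 2) / 2))) {σ : ℝ} (hσ : 0 < σ) :
    ∫ y : Space N, talentiCut κ y ^ (2 : ℝ) ≤
      (1 + R ^ 2) ^ σ * ∫ y : Space N, bracketPow ((N : ℝ) - 2 + σ) y := by
  have h4 : (4 : ℝ) ≤ N := by exact_mod_cast hN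
  have hκ0 : 0 < κ := by rw [hκ]; positivity
  rw [← integral_const_mul]
  refine integral_mono (integrable_talentiCut_rpow hN hR hκ two_pos)
    ((integrable_bracketPow (by linarith)).const_mul _) fun y => ?_
  have hb := bracketPow_pos ((N : ℝ) - 2 + σ) y
  rcases le_total R ‖y‖ with h | h
  · simp only [talentiCut_eq_zero hN hR hκ h]
    rw [Real.zero_rpow two_ne_zero]
    positivity
  · refine (Real.rpow_le_rpow (talentiCut_nonneg hκ0 y) (talentiCut_le hκ0 y) two_pos.le).trans ?_
    rw [bracketPow_rpow]
    have e : bracketPow (((N : ℝ) - 2) / 2 * 2) y =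
        (1 + ‖y‖ ^ 2) ^ σ * bracketPow ((N : ℝ) - 2 + σ) y := by
      rw [bracketPow, bracketPow, ← Real.rpow_add (by positivity)]
      congr 1
      ring
    rw [e]
    gcongr

/-- Lower bound of `∫ v^q` for the truncated Talenti function by an integral over a fixed ball. -/
theorem le_integral_talentiCut_rpow (hN : 4 ≤ N) {R : ℝ} (hR : 0 ≤ R)
    (hκ : κ = (1 + R ^ 2) ^ (-(((N : ℝ) - 2) / 2))) {q : ℝ} (hq : 0 < q) {r : ℝ}
    (hr : 4 * κ ≤ (1 + r ^ 2) ^ (-(((N : ℝ) - 2) / 2))) :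
    (2 : ℝ)⁻¹ ^ q * (∫ y in Metric.ball (0 : Space N) r, bracketPow (((N : ℝ) - 2) / 2 * q) y) ≤
      ∫ y : Space N, talentiCut κ y ^ q := by
  have h4 : (4 : ℝ) ≤ N := by exact_mod_cast hN
  have hκ0 : 0 < κ := by rw [hκ]; positivity
  have hint := integrable_talentiCut_rpow hN hR hκ hq
  refine le_trans ?_ (setIntegral_le_integral (s := Metric.ball (0 : Space N) r) hint
    (Filter.Eventually.of_forall fun y => Real.rpow_nonneg (talentiCut_nonneg hκ0 y) q))
  rw [← integral_const_mul]
  refine setIntegral_mono_on ?_ hint.integrableOn measurableSet_ball fun y hy => ?_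
  · refine IntegrableOn.mono_set ?_ Metric.ball_subset_closedBall
    exact ((continuous_const.mul (continuous_bracketPow _)).continuousOn).integrableOn_compact
      (isCompact_closedBall _ _)
  · rw [mem_ball_zero_iff] at hy
    rw [← bracketPow_rpow, ← Real.mul_rpow (by norm_num) (bracketPow_pos _ _).le]
    refine Real.rpow_le_rpow (mul_nonneg (by norm_num) (bracketPow_pos _ _).le) ?_ hq.le
    have h1 : (1 + r ^ 2) ^ (-(((N : ℝ) - 2) / 2)) ≤ bracketPow (((N : ℝ) - 2) / 2) y :=
      Real.rpow_le_rpow_of_nonpos (by positivity) (by gcongr) (by linarith)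
    have h2 : bracketPow (((N : ℝ) - 2) / 2) y - 2 * κ ≤ talentiCut κ y := le_softCut hκ0 _
    linarith

theorem integral_ball_bracketPow_pos (s : ℝ) :
    0 < ∫ y in Metric.ball (0 : Space N) 1, bracketPow s y := by
  have hint : IntegrableOn (bracketPow s) (Metric.ball (0 : Space N) 1) :=
    IntegrableOn.mono_set ((continuous_bracketPow _).continuousOn.integrableOn_compact
      (isCompact_closedBall _ _)) Metric.ball_subset_closedBall
  rw [setIntegral_pos_iff_support_of_nonneg_ae
    (Filter.Eventually.of_forall fun y => (bracketPow_pos s y).le) hint]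
  have h : Function.support (bracketPow s : Space N → ℝ) = Set.univ :=
    Set.eq_univ_of_forall fun y => (bracketPow_pos s y).ne'
  rw [h, Set.univ_inter]
  exact Metric.measure_ball_pos volume _ one_pos

/-- In polar coordinates the integrand is `r³ (1 + r²)^(-2)`, at least `1 / (4r)` for `r > 1`. This
logarithmic divergence settles the borderline case `N = 4`, `q = 2`. -/
theorem not_integrable_bracketPow_two : ¬ Integrable (bracketPow 2 : Space 4 → ℝ) := by
  intro h
  have h1 := (integrable_fun_norm_addHaar (volume : Measure (Space 4))
    (f := fun r : ℝ => (1 + r ^ 2) ^ (-(2 : ℝ)))).1 h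
  simp only [finrank_euclideanSpace, Fintype.card_fin, smul_eq_mul] at h1
  have h2 := h1.mono_set (Set.Ioi_subset_Ioi (zero_le_one' ℝ))
  refine not_integrableOn_Ioi_inv (a := 1) ?_
  refine Integrable.mono' (h2.const_mul 4) (by fun_prop) ?_
  filter_upwards [ae_restrict_mem measurableSet_Ioi] with r hr
  have hr1 : 1 < r := hr
  have hr0 : 0 < r := by linarith
  rw [Real.norm_of_nonneg (by positivity), Real.rpow_neg (by positivity), Real.rpow_two,
    ← div_eq_mul_inv, inv_eq_one_div, ← mul_div_assoc, div_le_div_iff₀ hr0 (by positivity)]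
  norm_num
  nlinarith [sq_nonneg (r ^ 2 - 1), sq_nonneg r, mul_pos hr0 hr0, pow_pos hr0 4]

theorem exists_integral_ball_bracketPow_two_ge (M : ℝ) :
    ∃ r : ℝ, 0 < r ∧ M ≤ ∫ y in Metric.ball (0 : Space 4) r, bracketPow 2 y := by
  by_contra! hcon
  refine not_integrable_bracketPow_two ?_
  have hcov : AECover volume Filter.atTop fun n : ℕ => Metric.ball (0 : Space 4) (n : ℝ) :=
    aecover_ball tendsto_natCast_atTop_atTop
  refine hcov.integrable_of_integral_bounded_of_nonneg_ae M (fun n => ?_)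
    (Filter.Eventually.of_forall fun y => (bracketPow_pos _ y).le) ?_
  · exact IntegrableOn.mono_set ((continuous_bracketPow _).continuousOn.integrableOn_compact
      (isCompact_closedBall _ _)) Metric.ball_subset_closedBall
  · filter_upwards [Filter.eventually_gt_atTop 0] with n hn
    exact (hcon n (by exact_mod_cast hn)).le

end Truncation

end MagneticBN

/-! ### Concentration at a point with a gauge phase -/

namespace MagneticBN

section Concentration

variable {N : ℕ} {Ω : Set (Space N)} {A : Space N → Space N} {μ : ℝ}

theorem integral_comp_scale (g : Space N → ℝ) {l : ℝ} (hl : 0 < l) (x₀ : Space N) :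
    ∫ x, g (l • (x - x₀)) = l ^ (-(N : ℝ)) * ∫ y, g y := by
  rw [integral_sub_right_eq_self (fun x => g (l • x)) x₀,
    Measure.integral_comp_smul_of_nonneg volume g l (hR := hl.le), finrank_euclideanSpace,
    Fintype.card_fin, smul_eq_mul, Real.rpow_neg hl.le, Real.rpow_natCast]

/-- The function `v`, concentrated at `x₀` at the scale `1 / l` and multiplied by the phase that
removes the constant vector potential `a`. -/
noncomputable def concentrated (v : Space N → ℝ) (a x₀ : Space N) (l : ℝ) (x : Space N) : ℂ :=
  Complex.exp (Complex.I * (inner ℝ a x : ℝ)) *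
    ((l ^ (((N : ℝ) - 2) / 2) * v (l • (x - x₀)) : ℝ) : ℂ)

theorem norm_concentrated {v : Space N → ℝ} (hv0 : ∀ y, 0 ≤ v y) (a x₀ : Space N) {l : ℝ}
    (hl : 0 < l) (x : Space N) :
    ‖concentrated v a x₀ l x‖ = l ^ (((N : ℝ) - 2) / 2) * v (l • (x - x₀)) := by
  have h0 : 0 ≤ l ^ (((N : ℝ) - 2) / 2) * v (l • (x - x₀)) :=
    mul_nonneg (Real.rpow_nonneg hl.le _) (hv0 _)
  rw [concentrated, norm_mul, mul_comm Complex.I, Complex.norm_exp_ofReal_mul_I, one_mul,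
    Complex.norm_real, Real.norm_of_nonneg h0]

theorem integral_norm_concentrated_rpow {v : Space N → ℝ} (hv0 : ∀ y, 0 ≤ v y) (a x₀ : Space N)
    {l : ℝ} (hl : 0 < l) (q : ℝ) :
    ∫ x, ‖concentrated v a x₀ l x‖ ^ q =
      l ^ (((N : ℝ) - 2) / 2 * q - N) * ∫ y, v y ^ q := by
  have e : ∀ x, ‖concentrated v a x₀ l x‖ ^ q =
      l ^ (((N : ℝ) - 2) / 2 * q) * v (l • (x - x₀)) ^ q := by
    intro x
    rw [norm_concentrated hv0 a x₀ hl, Real.mul_rpow (Real.rpow_nonneg hl.le _) (hv0 _),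
      ← Real.rpow_mul hl.le]
  simp only [e]
  rw [integral_const_mul, integral_comp_scale (fun y => v y ^ q) hl, ← mul_assoc,
    ← Real.rpow_add hl]
  rfl

theorem contDiff_concentrated {v : Space N → ℝ} (hv : ContDiff ℝ ∞ v) (a x₀ : Space N) (l : ℝ) :
    ContDiff ℝ ∞ (concentrated v a x₀ l) := by
  have h1 : ContDiff ℝ ∞ fun x : Space N => ((inner ℝ a x : ℝ) : ℂ) :=
    Complex.ofRealCLM.contDiff.comp (contDiff_const.inner ℝ contDiff_id)
  have h2 : ContDiff ℝ ∞ fun x : Space N => l • (x - x₀) :=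
    (contDiff_id.sub contDiff_const).const_smul l
  exact (contDiff_const.mul h1).cexp.mul
    (Complex.ofRealCLM.contDiff.comp (contDiff_const.mul (hv.comp h2)))

theorem fderiv_concentrated {v : Space N → ℝ} (hv : ContDiff ℝ ∞ v) (a x₀ : Space N) (l : ℝ)
    (x : Space N) (k : Fin N) :
    fderiv ℝ (concentrated v a x₀ l) x (EuclideanSpace.single k (1 : ℝ)) =
      Complex.exp (Complex.I * (inner ℝ a x : ℝ)) *
        ((l ^ (((N : ℝ) - 2) / 2) * (l * fderiv ℝ v (l • (x - x₀)) (EuclideanSpace.single k 1)) : ℝ)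
          + Complex.I * (a k : ℝ) *
            ((l ^ (((N : ℝ) - 2) / 2) * v (l • (x - x₀)) : ℝ) : ℂ)) := by
  have h1 : HasFDerivAt (fun x : Space N => inner ℝ a x) (innerSL ℝ a) x :=
    (innerSL ℝ a).hasFDerivAt
  have h2 : HasFDerivAt (fun x : Space N => ((inner ℝ a x : ℝ) : ℂ))
      (Complex.ofRealCLM.comp (innerSL ℝ a)) x := Complex.ofRealCLM.hasFDerivAt.comp x h1
  have h3 := (h2.const_mul Complex.I).cexp
  have h4 : HasFDerivAt (fun x : Space N => l • (x - x₀)) (l • ContinuousLinearMap.id ℝ _) x :=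
    ((hasFDerivAt_id x).sub_const x₀).const_smul l
  have h5 : HasFDerivAt (fun x : Space N => v (l • (x - x₀)))
      ((fderiv ℝ v (l • (x - x₀))).comp (l • ContinuousLinearMap.id ℝ _)) x :=
    (hv.differentiable (by simp) _).hasFDerivAt.comp x h4
  have h6 : HasFDerivAt
      (fun x : Space N => ((l ^ (((N : ℝ) - 2) / 2) * v (l • (x - x₀)) : ℝ) : ℂ)) _ x :=
    Complex.ofRealCLM.hasFDerivAt.comp x (h5.const_mul (l ^ (((N : ℝ) - 2) / 2)))
  have h7 : HasFDerivAt (concentrated v a x₀ l) _ x := h3.mul h6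
  rw [h7.fderiv]
  simp [EuclideanSpace.inner_single_right]
  ring

/-- The square of the magnetic gradient of the concentrated function. -/
theorem norm_sq_magnetic_concentrated {v : Space N → ℝ} (hv : ContDiff ℝ ∞ v) (a x₀ : Space N)
    {l : ℝ} (hl : 0 < l) (x : Space N) :
    ‖(-Complex.I) • grad ℂ (concentrated v a x₀ l) x - concentrated v a x₀ l x • potential A μ x‖
        ^ 2 =
      l ^ (N : ℝ) * (∑ k, fderiv ℝ v (l • (x - x₀)) (EuclideanSpace.single k (1 : ℝ)) ^ 2) +
        l ^ ((N : ℝ) - 2) * (‖a - A (μ • x)‖ ^ 2 * v (l • (x - x₀)) ^ 2) := by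
  rw [EuclideanSpace.norm_sq_eq]
  set L := l ^ (((N : ℝ) - 2) / 2) with hL
  set d : Fin N → ℝ := fun k => fderiv ℝ v (l • (x - x₀)) (EuclideanSpace.single k 1)
  set w := v (l • (x - x₀))
  have hL2 : L ^ 2 = l ^ ((N : ℝ) - 2) := by
    rw [hL, ← Real.rpow_natCast, ← Real.rpow_mul hl.le]
    congr 1
    push_cast
    ring
  have hL3 : L ^ 2 * l ^ 2 = l ^ (N : ℝ) := by
    rw [hL2, ← Real.rpow_natCast l 2, ← Real.rpow_add hl]
    congr 1
    push_cast
    ring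
  have hk : ∀ k, ‖((-Complex.I) • grad ℂ (concentrated v a x₀ l) x -
      concentrated v a x₀ l x • potential A μ x) k‖ ^ 2 =
      l ^ (N : ℝ) * d k ^ 2 + l ^ ((N : ℝ) - 2) * ((a - A (μ • x)) k ^ 2 * w ^ 2) := by
    intro k
    -- Up to the phase, the potential difference gives the real part and the derivative of the real
    -- profile the imaginary part. The squares therefore add without a cross term, and the error is
    -- quadratic in `a - A`.
    have e : ((-Complex.I) • grad ℂ (concentrated v a x₀ l) x -
        concentrated v a x₀ l x • potential A μ x) k =
        Complex.exp (Complex.I * (inner ℝ a x : ℝ)) *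
          (((a - A (μ • x)) k * (L * w) : ℝ) + (-(L * (l * d k)) : ℝ) * Complex.I) := by
      have e1 : ((-Complex.I) • grad ℂ (concentrated v a x₀ l) x -
        concentrated v a x₀ l x • potential A μ x) k = -Complex.I *
          fderiv ℝ (concentrated v a x₀ l) x (EuclideanSpace.single k (1 : ℝ)) -
          concentrated v a x₀ l x * (A (μ • x) k : ℝ) := rfl
      have e2 : concentrated v a x₀ l x =
        Complex.exp (Complex.I * (inner ℝ a x : ℝ)) * ((L * w : ℝ) : ℂ) := rfl
      rw [e1, fderiv_concentrated hv a x₀, e2]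
      change -Complex.I * (Complex.exp (Complex.I * (inner ℝ a x : ℝ)) *
        ((L * (l * d k) : ℝ) + Complex.I * (a k : ℝ) * ((L * w : ℝ) : ℂ))) - _ = _
      rw [PiLp.sub_apply]
      push_cast
      linear_combination (-(Complex.exp (Complex.I * (inner ℝ a x : ℝ))) * (a k : ℝ) *
        ((L : ℂ) * w)) * Complex.I_sq
    rw [e, norm_mul, mul_comm Complex.I, Complex.norm_exp_ofReal_mul_I, one_mul,
      Complex.sq_norm, Complex.normSq_add_mul_I, ← hL3, ← hL2]
    ring
  simp only [hk]
  rw [Finset.sum_add_distrib, ← Finset.mul_sum, ← Finset.mul_sum, ← Finset.sum_mul, sum_coord_sq]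

/-- The concentrated function as an element of `H¹₀(Ω, ℂ)`, with its integrals. -/
theorem exists_concentrated (hA : Continuous A) {v : Space N → ℝ} (hv : ContDiff ℝ ∞ v)
    (hvc : HasCompactSupport v) (hv0 : ∀ y, 0 ≤ v y) {x₀ : Space N} {l ρ δ : ℝ} (hl : 0 < l)
    (hvρ : ∀ y, ρ * l ≤ ‖y‖ → v y = 0) (hρΩ : Metric.closedBall x₀ ρ ⊆ Ω)
    (hδ : ∀ x ∈ Metric.closedBall x₀ ρ, ‖A (μ • x₀) - A (μ • x)‖ ^ 2 ≤ δ) :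
    ∃ u : H10 ℂ Ω,
      (∀ q : ℝ, 0 < q → ∫ x in Ω, ‖sobFun u x‖ ^ q =
        l ^ (((N : ℝ) - 2) / 2 * q - N) * ∫ y, v y ^ q) ∧
      ∫ x in Ω, ‖magGrad A μ u x‖ ^ 2 ≤
        (∫ y, ∑ k, fderiv ℝ v y (EuclideanSpace.single k (1 : ℝ)) ^ 2) +
          δ * l ^ (-(2 : ℝ)) * ∫ y, v y ^ (2 : ℝ) := by
  set a := A (μ • x₀) with ha
  set φ := concentrated v a x₀ l with hφ
  have hout : ∀ x, x ∉ Metric.closedBall x₀ ρ → v (l • (x - x₀)) = 0 := by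
    intro x hx
    rw [mem_closedBall_iff_norm, not_le] at hx
    refine hvρ _ ?_
    rw [norm_smul, Real.norm_of_nonneg hl.le, mul_comm]
    gcongr
  have hφout : ∀ x, x ∉ Metric.closedBall x₀ ρ → φ x = 0 := by
    intro x hx
    simp only [hφ, concentrated, hout x hx]
    simp
  have hts : tsupport φ ⊆ Metric.closedBall x₀ ρ :=
    closure_minimal (fun x hx => by
      by_contra h
      exact hx (hφout x h)) Metric.isClosed_closedBall
  have htest : IsTest ℂ Ω φ :=
    ⟨contDiff_concentrated hv a x₀ l,
      HasCompactSupport.intro (isCompact_closedBall x₀ ρ) hφout, hts.trans hρΩ⟩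
  obtain ⟨u, hu1, hu2⟩ := htest.exists_represents
  refine ⟨u, fun q hq => ?_, ?_⟩
  · rw [← integral_norm_concentrated_rpow hv0 a x₀ hl q,
      ← setIntegral_eq_integral_of_forall_compl_eq_zero (s := Ω) (f := fun x => ‖φ x‖ ^ q)]
    · exact integral_congr_ae (hu1.mono fun x hx => by simp only [hx])
    · intro x hx
      have h0 : φ x = 0 := hφout x fun h' => hx (hρΩ h')
      change ‖φ x‖ ^ q = 0
      rw [h0, norm_zero, Real.zero_rpow hq.ne']
  · have e1 : ∫ x in Ω, ‖magGrad A μ u x‖ ^ 2 =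
        ∫ x, ‖(-Complex.I) • grad ℂ φ x - φ x • potential A μ x‖ ^ 2 := by
      rw [← setIntegral_eq_integral_of_forall_compl_eq_zero (s := Ω)
        (f := fun x => ‖(-Complex.I) • grad ℂ φ x - φ x • potential A μ x‖ ^ 2)]
      · refine integral_congr_ae ?_
        filter_upwards [hu1, hu2] with x h1 h2
        rw [magGrad_eq, h1, h2]
      · intro x hx
        rw [hφout x fun h' => hx (hρΩ h'),
          grad_eq_zero_of_notMem_tsupport fun h' => hx (hρΩ (hts h'))]
        simp
    have hpot := continuous_potential (μ := μ) hA
    have hgr := htest.continuous_grad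
    have hφc := htest.smooth.continuous
    have hi1 : Integrable fun x => ‖(-Complex.I) • grad ℂ φ x - φ x • potential A μ x‖ ^ 2 := by
      refine Continuous.integrable_of_hasCompactSupport (by fun_prop) ?_
      refine HasCompactSupport.intro htest.compact fun x hx => ?_
      rw [image_eq_zero_of_notMem_tsupport hx, grad_eq_zero_of_notMem_tsupport hx]
      simp
    set g : Space N → ℝ := fun y => ∑ k, fderiv ℝ v y (EuclideanSpace.single k (1 : ℝ)) ^ 2
      with hg
    have hgc : Continuous g := continuous_finsetSum _ fun k _ =>
      ((hv.continuous_fderiv (by simp)).clm_apply continuous_const).pow 2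
    have hgi : Integrable g := by
      refine hgc.integrable_of_hasCompactSupport (HasCompactSupport.intro hvc fun y hy => ?_)
      have h : fderiv ℝ v y = 0 := by
        by_contra h0
        exact hy (support_fderiv_subset ℝ h0)
      simp [hg, h]
    have hvi : Integrable fun y => v y ^ (2 : ℝ) := by
      refine Continuous.integrable_of_hasCompactSupport
        (hv.continuous.rpow_const fun y => Or.inr two_pos.le)
        (HasCompactSupport.intro hvc fun y hy => ?_)
      rw [image_eq_zero_of_notMem_tsupport hy, Real.zero_rpow two_ne_zero]
    have hsc : ∀ {f : Space N → ℝ}, Integrable f → Integrable fun x => f (l • (x - x₀)) :=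
      fun hf => ((hf.comp_smul hl.ne').comp_sub_right x₀)
    rw [e1]
    have hle : ∫ x, ‖(-Complex.I) • grad ℂ φ x - φ x • potential A μ x‖ ^ 2 ≤
        ∫ x, (l ^ (N : ℝ) * g (l • (x - x₀)) +
          δ * l ^ ((N : ℝ) - 2) * v (l • (x - x₀)) ^ (2 : ℝ)) := by
      refine integral_mono hi1 (((hsc hgi).const_mul _).add ((hsc hvi).const_mul _)) fun x => ?_
      simp only [hφ]
      rw [norm_sq_magnetic_concentrated hv a x₀ hl, Real.rpow_two, mul_comm δ, mul_assoc _ δ]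
      refine add_le_add le_rfl (mul_le_mul_of_nonneg_left ?_ (Real.rpow_nonneg hl.le _))
      by_cases hx : x ∈ Metric.closedBall x₀ ρ
      · exact mul_le_mul_of_nonneg_right (hδ x hx) (sq_nonneg _)
      · simp [hout x hx]
    refine hle.trans (le_of_eq ?_)
    rw [integral_add ((hsc hgi).const_mul _) ((hsc hvi).const_mul _), integral_const_mul,
      integral_const_mul, integral_comp_scale g hl,
      integral_comp_scale (fun y => v y ^ (2 : ℝ)) hl, ← mul_assoc, ← Real.rpow_add hl,
      add_neg_cancel, Real.rpow_zero, one_mul, ← mul_assoc, mul_assoc δ, ← Real.rpow_add hl]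
    congr 4
    ring

end Concentration

end MagneticBN

/-! ### The functional along a ray -/

namespace MagneticBN

section Fiber

/-- Bernoulli's inequality for the power `p / 2` at `σ²`; equality holds at `σ = 1`. -/
theorem sq_sub_rpow_le {p σ : ℝ} (hp : 2 < p) (hσ : 0 ≤ σ) :
    σ ^ 2 / 2 - σ ^ p / p ≤ 1 / 2 - 1 / p := by
  have h := one_add_mul_self_le_rpow_one_add (s := σ ^ 2 - 1) (by nlinarith [sq_nonneg σ])
    (p := p / 2) (by linarith)
  have e : (1 + (σ ^ 2 - 1)) ^ (p / 2) = σ ^ p := by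
    rw [add_sub_cancel, ← Real.rpow_natCast, ← Real.rpow_mul hσ]
    congr 1
    push_cast
    ring
  rw [e] at h
  have hp0 : 0 < p := by linarith
  have h1 : σ ^ 2 / 2 - σ ^ p / p - (1 / 2 - 1 / p) =
      (1 + p / 2 * (σ ^ 2 - 1) - σ ^ p) / p := by
    field_simp
    ring
  have h2 : (1 + p / 2 * (σ ^ 2 - 1) - σ ^ p) / p ≤ 0 :=
    div_nonpos_of_nonpos_of_nonneg (by linarith) hp0.le
  linarith

/-- The maximum of a fibre of the functional without the perturbation. -/
theorem fiber_le {p K M s : ℝ} (hp : 2 < p) (hK : 0 < K) (hM : 0 < M) (hs : 0 ≤ s) :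
    s ^ 2 * K / 2 - s ^ p * M / p ≤
      (1 / 2 - 1 / p) * (K / M ^ (2 / p)) ^ (p / (p - 2)) := by
  have hp0 : 0 < p := by linarith
  have hp2 : 0 < p - 2 := by linarith
  -- The critical point of the fibre. Substituting `s = τ σ` reduces the claim to the normalised
  -- inequality.
  set τ := (K / M) ^ (1 / (p - 2)) with hτ
  have hτ0 : 0 < τ := Real.rpow_pos_of_pos (div_pos hK hM) _
  have hKτ : K = M * τ ^ (p - 2) := by
    rw [hτ, ← Real.rpow_mul (div_pos hK hM).le, one_div_mul_cancel hp2.ne', Real.rpow_one]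
    field_simp
  have e1 : (K / M ^ (2 / p)) ^ (p / (p - 2)) = M * τ ^ p := by
    have e : K / M ^ (2 / p) = (M * τ ^ p) ^ ((p - 2) / p) := by
      rw [Real.mul_rpow hM.le (Real.rpow_nonneg hτ0.le _), ← Real.rpow_mul hτ0.le,
        mul_div_cancel₀ _ hp0.ne', hKτ, sub_div, div_self hp0.ne', Real.rpow_sub hM,
        Real.rpow_one]
      ring
    rw [e, ← Real.rpow_mul (by positivity), div_mul_div_comm, mul_comm p, div_self (by positivity),
      Real.rpow_one]
  have e2 : τ ^ 2 * K = M * τ ^ p := by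
    rw [hKτ, Real.rpow_sub hτ0, Real.rpow_two]
    field_simp
  have h := sq_sub_rpow_le hp (div_nonneg hs hτ0.le)
  have h' := mul_le_mul_of_nonneg_right h (by positivity : 0 ≤ M * τ ^ p)
  rw [e1]
  refine le_trans (le_of_eq ?_) h'
  rw [Real.div_rpow hs hτ0.le, sub_mul]
  nth_rewrite 1 [← e2]
  field_simp

/-- A fibre of the functional stays below the critical level if the errors are small compared
with the perturbation. -/
theorem exists_fiber_lt {p K M c q μ : ℝ} (hp : 2 < p) (hK : 0 < K) (hM : 0 < M) (hc : 0 < c)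
    (hle : ∀ s : ℝ, 0 ≤ s → s ^ 2 * K / 2 - s ^ p * M / p ≤ c) (hq : 2 ≤ q) (hμ : 0 < μ) :
    ∃ s₀ s₁ : ℝ, 0 < s₀ ∧ 0 < s₁ ∧ ∀ E J Q ε₁ ε₂ : ℝ, E ≤ K + ε₁ → 0 ≤ ε₁ → ε₁ ≤ K →
      M - ε₂ ≤ J → 0 ≤ ε₂ → ε₂ ≤ M / 2 → 0 < Q →
      ε₁ / 2 ≤ μ / (2 * q) * s₀ ^ (q - 2) * Q →
      ε₂ * s₁ ^ p / p ≤ μ / (4 * q) * s₀ ^ q * Q →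
      ∃ c' < c, (∀ s : ℝ, 0 ≤ s → s ^ 2 * E / 2 - μ / q * (s ^ q * Q) - s ^ p * J / p ≤ c') ∧
        s₁ ^ 2 * E / 2 - μ / q * (s₁ ^ q * Q) - s₁ ^ p * J / p < 0 := by
  have hp0 : 0 < p := by linarith
  have hp2 : 0 < p - 2 := by linarith
  have hq0 : 0 < q := by linarith
  -- Since `E ≤ 2K` and `J ≥ M / 2`, the quadratic term is at most `c / 2` up to `s₀`, and the
  -- critical term dominates it from `s₁` on. Both numbers depend on `K`, `M`, `c`, `p` only, so
  -- they are fixed before the concentration scale.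
  refine ⟨√(c / (2 * K)), (2 * p * K / M) ^ (1 / (p - 2)), Real.sqrt_pos.2 (by positivity),
    by positivity, ?_⟩
  set s₀ := √(c / (2 * K)) with hs₀
  set s₁ := (2 * p * K / M) ^ (1 / (p - 2)) with hs₁
  have h0 : 0 < s₀ := Real.sqrt_pos.2 (by positivity)
  have h1 : 0 < s₁ := by positivity
  have h0' : s₀ ^ 2 * K = c / 2 := by
    rw [hs₀, Real.sq_sqrt (by positivity)]
    field_simp
  have h1' : s₁ ^ (p - 2) * M = 2 * p * K := by
    rw [hs₁, ← Real.rpow_mul (by positivity), one_div_mul_cancel hp2.ne', Real.rpow_one]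
    field_simp
  intro E J Q ε₁ ε₂ hE hε₁ hε₁K hJ hε₂ hε₂M hQ hi hii
  have hbig : ∀ s : ℝ, s₁ ≤ s → s ^ 2 * E / 2 - s ^ p * J / p ≤ 0 := by
    intro s hs
    have hs0 : 0 < s := h1.trans_le hs
    have e : s ^ p = s ^ 2 * s ^ (p - 2) := by
      rw [Real.rpow_sub hs0, Real.rpow_two]
      field_simp
    have a1 : 2 * p * K ≤ s ^ (p - 2) * M := by
      rw [← h1']
      gcongr
    have a2 : s ^ (p - 2) * (M / 2) ≤ s ^ (p - 2) * J := by
      gcongr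
      linarith
    have a3 : E ≤ 2 * K := by linarith
    have a4 : E / 2 ≤ s ^ (p - 2) * J / p := by
      rw [le_div_iff₀ hp0]
      nlinarith
    rw [e]
    have := mul_le_mul_of_nonneg_left a4 (sq_nonneg s)
    calc s ^ 2 * E / 2 - s ^ 2 * s ^ (p - 2) * J / p
        = s ^ 2 * (E / 2) - s ^ 2 * (s ^ (p - 2) * J / p) := by ring
      _ ≤ 0 := by linarith
  have hpos : ∀ s : ℝ, 0 ≤ s → 0 ≤ μ / q * (s ^ q * Q) := fun s hs => by positivity
  -- Between `s₀` and `s₁` the error `ε₁` uses up half of the perturbation and `ε₂` at most a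
  -- quarter of its value at `s₀`. A quarter remains as the gap.
  refine ⟨max (c / 2) (c - μ / (4 * q) * s₀ ^ q * Q), max_lt (by linarith) ?_, ?_, ?_⟩
  · have : 0 < μ / (4 * q) * s₀ ^ q * Q := by positivity
    linarith
  · intro s hs
    have hJ0 : 0 ≤ J := by linarith
    rcases le_or_gt s s₀ with hs0 | hs0
    · refine le_max_of_le_left ?_
      have b1 : s ^ 2 * E ≤ s₀ ^ 2 * (2 * K) :=
        (mul_le_mul_of_nonneg_left (by linarith) (sq_nonneg s)).trans
          (mul_le_mul_of_nonneg_right (by gcongr) (by positivity))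
      have b2 : 0 ≤ s ^ p * J / p := by positivity
      linarith [hpos s hs]
    · have hs' : 0 < s := h0.trans hs0
      rcases le_or_gt s₁ s with hs1 | hs1
      · exact le_max_of_le_left (by linarith [hbig s hs1, hpos s hs])
      · refine le_max_of_le_right ?_
        have b1 : s ^ 2 * E / 2 ≤ s ^ 2 * K / 2 + μ / (2 * q) * s ^ q * Q := by
          have b2 : s ^ 2 * (ε₁ / 2) ≤ s ^ 2 * (μ / (2 * q) * s ^ (q - 2) * Q) := by
            refine mul_le_mul_of_nonneg_left (hi.trans ?_) (sq_nonneg s)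
            have : s₀ ^ (q - 2) ≤ s ^ (q - 2) :=
              Real.rpow_le_rpow h0.le hs0.le (by linarith)
            gcongr
          have b3 : s ^ 2 * (μ / (2 * q) * s ^ (q - 2) * Q) = μ / (2 * q) * s ^ q * Q := by
            rw [Real.rpow_sub hs', Real.rpow_two]
            field_simp
          have b4 := mul_le_mul_of_nonneg_left hE (sq_nonneg s)
          linarith
        have b5 : s ^ p * M / p - μ / (4 * q) * s₀ ^ q * Q ≤ s ^ p * J / p := by
          have b6 : s ^ p * ε₂ / p ≤ μ / (4 * q) * s₀ ^ q * Q := by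
            refine le_trans ?_ hii
            rw [mul_comm ε₂]
            gcongr
          have b7 : s ^ p * M / p - s ^ p * ε₂ / p ≤ s ^ p * J / p := by
            rw [← sub_div, ← mul_sub]
            gcongr
          linarith
        have b8 : μ / q * (s ^ q * Q) - μ / (2 * q) * s ^ q * Q = μ / (2 * q) * s ^ q * Q := by
          field_simp
          ring
        have b9 : μ / (2 * q) * s₀ ^ q * Q ≤ μ / (2 * q) * s ^ q * Q := by gcongr
        have b10 : μ / (2 * q) * s₀ ^ q * Q = 2 * (μ / (4 * q) * s₀ ^ q * Q) := by
          field_simp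
          ring
        linarith [hle s hs]
  · have : 0 < μ / q * (s₁ ^ q * Q) := by positivity
    linarith [hbig s₁ le_rfl]

end Fiber

/-! ### Comparison of the errors with the perturbation as `l` tends to infinity -/

section Asymptotics

open Filter Topology

variable {N : ℕ} {ρ : ℝ}

/-- The value of the Talenti bubble at distance `ρ l` from its centre. -/
noncomputable def cutLevel (N : ℕ) (ρ l : ℝ) : ℝ :=
  (1 + (ρ * l) ^ 2) ^ (-(((N : ℝ) - 2) / 2))

theorem cutLevel_pos (N : ℕ) (ρ l : ℝ) : 0 < cutLevel N ρ l := by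
  unfold cutLevel
  positivity

theorem cutLevel_le (hN : 4 ≤ N) (hρ : 0 < ρ) {l : ℝ} (hl : 0 < l) :
    cutLevel N ρ l ≤ ρ ^ (-((N : ℝ) - 2)) * l ^ (-((N : ℝ) - 2)) := by
  have h4 : (4 : ℝ) ≤ N := by exact_mod_cast hN
  rw [← Real.mul_rpow hρ.le hl.le]
  have e : (ρ * l) ^ (-((N : ℝ) - 2)) = ((ρ * l) ^ 2) ^ (-(((N : ℝ) - 2) / 2)) := by
    rw [← Real.rpow_natCast, ← Real.rpow_mul (by positivity)]
    congr 1
    push_cast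
    ring
  rw [e]
  exact Real.rpow_le_rpow_of_nonpos (by positivity) (by linarith) (by linarith)

theorem tendsto_cutLevel (hN : 4 ≤ N) (hρ : 0 < ρ) : Tendsto (cutLevel N ρ) atTop (𝓝 0) := by
  have h4 : (4 : ℝ) ≤ N := by exact_mod_cast hN
  have h := (tendsto_rpow_neg_atTop (y := (N : ℝ) - 2) (by linarith)).const_mul
    (ρ ^ (-((N : ℝ) - 2)))
  rw [mul_zero] at h
  refine squeeze_zero' (Eventually.of_forall fun l => (cutLevel_pos N ρ l).le) ?_ h
  filter_upwards [eventually_gt_atTop 0] with l hl using cutLevel_le hN hρ hl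

theorem eventually_integral_talentiCut_sq_le (hN : 4 ≤ N) (hρ : 0 < ρ) {σ : ℝ} (hσ : 0 < σ) :
    ∃ C : ℝ, ∀ᶠ l in atTop,
      ∫ y : Space N, talentiCut (cutLevel N ρ l) y ^ (2 : ℝ) ≤ C * l ^ (2 * σ) := by
  refine ⟨(2 * ρ ^ 2) ^ σ * ∫ y : Space N, bracketPow ((N : ℝ) - 2 + σ) y, ?_⟩
  filter_upwards [eventually_ge_atTop (1 / ρ)] with l hl
  have hl0 : 0 < l := (by positivity : 0 < 1 / ρ).trans_le hl
  refine (integral_talentiCut_sq_le hN (by positivity) rfl hσ).trans ?_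
  have h1 : 1 ≤ ρ * l := by
    rw [div_le_iff₀ hρ] at hl
    linarith
  have h2 : (1 + (ρ * l) ^ 2) ^ σ ≤ (2 * ρ ^ 2) ^ σ * l ^ (2 * σ) := by
    rw [Real.rpow_mul hl0.le, Real.rpow_two, ← Real.mul_rpow (by positivity) (by positivity)]
    exact Real.rpow_le_rpow (by positivity) (by nlinarith) hσ.le
  rw [mul_right_comm]
  exact mul_le_mul_of_nonneg_right h2 (integral_nonneg fun y => (bracketPow_pos _ y).le)

theorem eventually_le_integral_talentiCut_rpow (hN : 4 ≤ N) (hρ : 0 < ρ) {q : ℝ} (hq : 0 < q)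
    (r : ℝ) :
    ∀ᶠ l in atTop, (2 : ℝ)⁻¹ ^ q *
      (∫ y in Metric.ball (0 : Space N) r, bracketPow (((N : ℝ) - 2) / 2 * q) y) ≤
        ∫ y : Space N, talentiCut (cutLevel N ρ l) y ^ q := by
  have h := (tendsto_cutLevel hN hρ).const_mul 4
  rw [mul_zero] at h
  filter_upwards [h.eventually_lt_const
    (by positivity : 0 < (1 + r ^ 2) ^ (-(((N : ℝ) - 2) / 2))), eventually_ge_atTop 0] with l hl hl0
  exact le_integral_talentiCut_rpow hN (by positivity) rfl hq hl.le

theorem exists_eventually_le_integral (hN : 4 ≤ N) (hρ : 0 < ρ) {q : ℝ} (hq : 0 < q) :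
    ∃ d : ℝ, 0 < d ∧
      ∀ᶠ l in atTop, d ≤ ∫ y : Space N, talentiCut (cutLevel N ρ l) y ^ q :=
  ⟨_, mul_pos (by positivity) (integral_ball_bracketPow_pos _),
    eventually_le_integral_talentiCut_rpow hN hρ hq 1⟩

/-- Compares the magnetic error with the perturbation. For `q = 2` the two sides coincide, and
smallness has to come from the factor `δ`; for `q > 2` the right side wins by a power of `l`. -/
theorem eventually_sq_le_rpow (hN : 4 ≤ N) (hρ : 0 < ρ) {q : ℝ} (hq : 2 ≤ q) :
    ∀ᶠ l in atTop, l ^ (-(2 : ℝ)) * (∫ y : Space N, talentiCut (cutLevel N ρ l) y ^ (2 : ℝ)) ≤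
      l ^ (((N : ℝ) - 2) / 2 * q - N) * ∫ y : Space N, talentiCut (cutLevel N ρ l) y ^ q := by
  have h4 : (4 : ℝ) ≤ N := by exact_mod_cast hN
  rcases hq.eq_or_lt with rfl | hq2
  · have e : ((N : ℝ) - 2) / 2 * 2 - N = -2 := by ring
    rw [e]
    exact Eventually.of_forall fun l => le_rfl
  · set σ := ((N : ℝ) - 2) * (q - 2) / 8 with hσ
    have hσ0 : 0 < σ := by
      have : 0 < ((N : ℝ) - 2) * (q - 2) := mul_pos (by linarith) (by linarith)
      positivity
    obtain ⟨C, hC⟩ := eventually_integral_talentiCut_sq_le hN hρ hσ0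
    obtain ⟨d, hd, hD⟩ := exists_eventually_le_integral hN hρ (by linarith : 0 < q)
    filter_upwards [hC, hD, (tendsto_rpow_atTop (by positivity : 0 < 2 * σ)).eventually_ge_atTop
      (C / d), eventually_gt_atTop 0] with l h1 h2 h3 hl
    have e : l ^ (((N : ℝ) - 2) / 2 * q - N) = l ^ (-(2 : ℝ)) * (l ^ (2 * σ) * l ^ (2 * σ)) := by
      rw [← Real.rpow_add hl, ← Real.rpow_add hl]
      congr 1
      rw [hσ]
      ring
    rw [e, mul_assoc]
    refine mul_le_mul_of_nonneg_left ?_ (by positivity)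
    calc ∫ y : Space N, talentiCut (cutLevel N ρ l) y ^ (2 : ℝ)
        ≤ C * l ^ (2 * σ) := h1
      _ = l ^ (2 * σ) * C := by ring
      _ ≤ l ^ (2 * σ) * (l ^ (2 * σ) * d) := by
          rw [div_le_iff₀ hd] at h3
          exact mul_le_mul_of_nonneg_left h3 (by positivity)
      _ ≤ l ^ (2 * σ) * l ^ (2 * σ) * ∫ y : Space N, talentiCut (cutLevel N ρ l) y ^ q := by
          rw [← mul_assoc]
          gcongr

theorem eventually_sq_le_const (hN : 4 ≤ N) (hρ : 0 < ρ) (δ : ℝ) {ε : ℝ} (hε : 0 < ε) :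
    ∀ᶠ l in atTop,
      δ * l ^ (-(2 : ℝ)) * (∫ y : Space N, talentiCut (cutLevel N ρ l) y ^ (2 : ℝ)) ≤ ε := by
  obtain ⟨C, hC⟩ := eventually_integral_talentiCut_sq_le hN hρ (by norm_num : (0 : ℝ) < 1 / 2)
  have h := (tendsto_rpow_neg_atTop (zero_lt_one' ℝ)).const_mul (|δ| * C)
  rw [mul_zero] at h
  filter_upwards [hC, h.eventually_lt_const hε, eventually_gt_atTop 0] with l h1 h2 hl
  have hV : 0 ≤ ∫ y : Space N, talentiCut (cutLevel N ρ l) y ^ (2 : ℝ) :=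
    integral_nonneg fun y => Real.rpow_nonneg (talentiCut_nonneg (cutLevel_pos _ _ _) y) _
  calc δ * l ^ (-(2 : ℝ)) * ∫ y : Space N, talentiCut (cutLevel N ρ l) y ^ (2 : ℝ)
      ≤ |δ| * l ^ (-(2 : ℝ)) * (C * l ^ (2 * (1 / 2 : ℝ))) := by
        gcongr
        exact le_abs_self δ
    _ = |δ| * C * l ^ (-(1 : ℝ)) := by
        have e : l ^ (-(1 : ℝ)) = l ^ (-(2 : ℝ)) * l ^ (2 * (1 / 2 : ℝ)) := by
          rw [← Real.rpow_add hl]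
          norm_num
        rw [e]
        ring
    _ ≤ ε := h2.le

/-- Compares the truncation error with the perturbation. After removing `l^(-(N-2))` the exponent `e
= (N-2)q/2 - 2` is nonnegative and vanishes only for `N = 4`, `q = 2`. There a large ball makes `∫
U²` exceed any given constant. -/
theorem eventually_cutLevel_le (hN : 4 ≤ N) (hρ : 0 < ρ) {q : ℝ} (hq : 2 ≤ q) {β : ℝ}
    (hβ : 0 ≤ β) :
    ∀ᶠ l in atTop, β * cutLevel N ρ l ≤
      l ^ (((N : ℝ) - 2) / 2 * q - N) * ∫ y : Space N, talentiCut (cutLevel N ρ l) y ^ q := by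
  have h4 : (4 : ℝ) ≤ N := by exact_mod_cast hN
  set e := ((N : ℝ) - 2) / 2 * q - 2 with he
  set B := β * ρ ^ (-((N : ℝ) - 2)) with hB
  have key : ∀ᶠ l in atTop, B ≤ l ^ e * ∫ y : Space N, talentiCut (cutLevel N ρ l) y ^ q := by
    have he0 : 0 ≤ e := by nlinarith
    rcases he0.eq_or_lt with h0 | h0
    · have hN4 : N = 4 := by
        have : (N : ℝ) ≤ 4 := by nlinarith
        exact le_antisymm (by exact_mod_cast this) hN
      subst hN4
      have hq2 : q = 2 := by
        push_cast at he
        linarith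
      -- The `4` compensates the factor `(1/2)^q = 1/4` lost when `v` is bounded below by `U / 2`.
      obtain ⟨r, -, hr⟩ := exists_integral_ball_bracketPow_two_ge (4 * B)
      filter_upwards [eventually_le_integral_talentiCut_rpow hN hρ (by linarith : 0 < q) r]
        with l hl
      rw [← h0, Real.rpow_zero, one_mul]
      refine le_trans ?_ hl
      have e2 : (((4 : ℕ) : ℝ) - 2) / 2 * q = 2 := by
        rw [hq2]
        norm_num
      rw [e2, hq2, Real.rpow_two]
      linarith
    · obtain ⟨d, hd, hD⟩ := exists_eventually_le_integral hN hρ (by linarith : 0 < q)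
      filter_upwards [hD, (tendsto_rpow_atTop h0).eventually_ge_atTop (B / d),
        eventually_gt_atTop 0] with l h1 h2 hl
      rw [div_le_iff₀ hd] at h2
      refine h2.trans ?_
      gcongr
  filter_upwards [key, eventually_gt_atTop 0] with l h hl
  have e1 : l ^ (((N : ℝ) - 2) / 2 * q - N) = l ^ (-((N : ℝ) - 2)) * l ^ e := by
    rw [← Real.rpow_add hl]
    congr 1
    rw [he]
    ring
  calc β * cutLevel N ρ l
      ≤ β * (ρ ^ (-((N : ℝ) - 2)) * l ^ (-((N : ℝ) - 2))) := by
        gcongr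
        exact cutLevel_le hN hρ hl
    _ = l ^ (-((N : ℝ) - 2)) * B := by rw [hB]; ring
    _ ≤ _ := by
        rw [e1, mul_assoc]
        gcongr

end Asymptotics

end MagneticBN

/-! ### The ray below the critical level, and the conclusion -/

namespace MagneticBN

section Level

variable {N : ℕ} {Ω : Set (Space N)} {A : Space N → Space N} {μ q : ℝ}

theorem integral_norm_sobFun_smul_rpow (u : H10 ℂ Ω) {s : ℝ} (hs : 0 ≤ s) (q : ℝ) :
    ∫ x in Ω, ‖sobFun ((s : ℂ) • u) x‖ ^ q = s ^ q * ∫ x in Ω, ‖sobFun u x‖ ^ q := by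
  rw [← integral_const_mul]
  refine integral_congr_ae ?_
  have h : sobFun ((s : ℂ) • u) =ᵐ[volume.restrict Ω] (s : ℂ) • sobFun u :=
    Lp.coeFn_smul _ _
  filter_upwards [h] with x hx
  simp only [hx, Pi.smul_apply, norm_smul, Complex.norm_real, Real.norm_of_nonneg hs]
  exact Real.mul_rpow hs (norm_nonneg _)

theorem energy_smul (hA : Continuous A) (hAb : ∃ C : ℝ, ∀ x, ‖A x‖ ≤ C) (u : H10 ℂ Ω) {s : ℝ}
    (hs : 0 ≤ s) :
    energy A Ω q μ ((s : ℂ) • u) = s ^ 2 * (∫ x in Ω, ‖magGrad A μ u x‖ ^ 2) / 2 -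
      μ / q * (s ^ q * ∫ x in Ω, ‖sobFun u x‖ ^ q) -
      s ^ critExp N * (∫ x in Ω, ‖sobFun u x‖ ^ critExp N) / critExp N := by
  rw [energy, magEnergy_smul hA hAb, integral_norm_sobFun_smul_rpow u hs,
    integral_norm_sobFun_smul_rpow u hs, Complex.norm_real, Real.norm_of_nonneg hs]
  ring

theorem integral_sum_fderiv_talentiCut_sq_le (hN : 4 ≤ N) {κ : ℝ} (hκ : 0 < κ) :
    ∫ y : Space N, ∑ k, fderiv ℝ (talentiCut κ) y (EuclideanSpace.single k (1 : ℝ)) ^ 2 ≤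
      talentiEnergy N := by
  have h4 : (4 : ℝ) ≤ N := by exact_mod_cast hN
  rw [talentiEnergy, ← integral_const_mul]
  exact integral_mono_of_nonneg
    (Filter.Eventually.of_forall fun y => Finset.sum_nonneg fun k _ => sq_nonneg _)
    ((integrable_norm_sq_mul_bracketPow (by linarith)).const_mul _)
    (Filter.Eventually.of_forall fun y => sum_fderiv_talentiCut_sq_le hκ y)

/-- A direction along which the functional stays below the critical level. -/
theorem exists_ray_lt (hN : 4 ≤ N) (hΩo : IsOpen Ω) (hΩn : Ω.Nonempty) (hA : Continuous A)
    (hAb : ∃ C : ℝ, ∀ x, ‖A x‖ ≤ C) (hq : 2 ≤ q) (hμ : 0 < μ) :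
    ∃ u : H10 ℂ Ω, ∃ c T : ℝ, 0 < T ∧ c < 1 / (N : ℝ) * talentiConst N ^ ((N : ℝ) / 2) ∧
      (∀ s : ℝ, 0 ≤ s → energy A Ω q μ ((s : ℂ) • u) ≤ c) ∧
      energy A Ω q μ ((T : ℂ) • u) < 0 := by
  have h4 : (4 : ℝ) ≤ N := by exact_mod_cast hN
  have hp := critExp_gt_two hN
  have hK := talentiEnergy_pos hN
  have hM := talentiMass_pos hN
  have hS := talentiConst_pos hN
  set p := critExp N with hpdef
  have hq0 : 0 < q := by linarith
  have hp0 : 0 < p := by linarith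
  have hN2 : (N : ℝ) - 2 ≠ 0 := by linarith
  have hpe : p = 2 * (N : ℝ) / ((N : ℝ) - 2) := rfl
  have e1 : 1 / 2 - 1 / p = 1 / (N : ℝ) := by
    rw [hpe]
    field_simp
    ring
  have e2 : p / (p - 2) = (N : ℝ) / 2 := by
    have : p - 2 = 4 / ((N : ℝ) - 2) := by
      rw [hpe]
      field_simp
      ring
    rw [this, hpe]
    field_simp
    ring
  obtain ⟨s₀, s₁, hs₀, hs₁, hfib⟩ := exists_fiber_lt hp hK hM
    (c := 1 / (N : ℝ) * talentiConst N ^ ((N : ℝ) / 2)) (by positivity)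
    (fun s hs => by
      have h := fiber_le hp hK hM hs
      rwa [e1, e2] at h) hq hμ
  obtain ⟨x₀, hx₀⟩ := hΩn
  -- The oscillation of `A` allowed near `x₀`: `δ / 2` is exactly the coefficient of `Q` permitted
  -- by the condition on `ε₁`.
  set δ := μ / q * s₀ ^ (q - 2) with hδ
  have hδ0 : 0 < δ := by positivity
  have hcont : Continuous fun x => ‖A (μ • x₀) - A (μ • x)‖ ^ 2 := by fun_prop
  have hnhds : Ω ∩ {x | ‖A (μ • x₀) - A (μ • x)‖ ^ 2 < δ} ∈ nhds x₀ :=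
    Filter.inter_mem (hΩo.mem_nhds hx₀)
      ((isOpen_lt hcont continuous_const).mem_nhds (by simpa using hδ0))
  obtain ⟨ρ, hρ, hball⟩ := Metric.nhds_basis_closedBall.mem_iff.1 hnhds
  set B := ∫ y : Space N, bracketPow (((N : ℝ) + 2) / 2) y with hB
  have hB0 : 0 ≤ B := integral_nonneg fun y => (bracketPow_pos _ y).le
  have hε₂ := ((tendsto_cutLevel hN hρ).const_mul (2 * p * B)).eventually_le_const
    (u := talentiMass N / 2) (by rw [mul_zero]; positivity)
  obtain ⟨d, hd, hD⟩ := exists_eventually_le_integral hN hρ hq0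
  -- One scale `l` meets all the smallness conditions. The constant `β` is the condition on `ε₂ = 2
  -- p B κ` solved for `κ`.
  obtain ⟨l, hl, hDl, hi, hi', hii, hii'⟩ := ((Filter.eventually_gt_atTop (0 : ℝ)).and
    (hD.and ((eventually_sq_le_rpow hN hρ hq).and
    ((eventually_sq_le_const hN hρ δ hK).and (hε₂.and (eventually_cutLevel_le hN hρ hq
      (β := 2 * p * B * s₁ ^ p / p / (μ / (4 * q) * s₀ ^ q)) (by positivity))))))).exists
  set κ := cutLevel N ρ l with hκ
  have hκ0 : 0 < κ := cutLevel_pos N ρ l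
  have hR : 0 ≤ ρ * l := by positivity
  obtain ⟨u, hu, huE⟩ := exists_concentrated (Ω := Ω) (μ := μ) hA (contDiff_talentiCut hκ0)
    (hasCompactSupport_talentiCut hN hR rfl) (talentiCut_nonneg hκ0) hl
    (fun y hy => talentiCut_eq_zero hN hR rfl hy) (fun x hx => (hball hx).1)
    (fun x hx => (hball hx).2.le)
  have hV0 : 0 ≤ ∫ y : Space N, talentiCut κ y ^ (2 : ℝ) :=
    integral_nonneg fun y => Real.rpow_nonneg (talentiCut_nonneg hκ0 y) _
  have hJ : ∫ x in Ω, ‖sobFun u x‖ ^ p = ∫ y : Space N, talentiCut κ y ^ p := by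
    rw [hu p hp0, hpdef, critExp_mul hN, sub_self, Real.rpow_zero, one_mul]
  have hJ' : talentiMass N - 2 * p * B * κ ≤ ∫ x in Ω, ‖sobFun u x‖ ^ p := by
    rw [hJ]
    refine le_trans (le_of_eq ?_) (le_integral_talentiCut_critExp hN hR rfl)
    ring
  have hQ : 0 < ∫ x in Ω, ‖sobFun u x‖ ^ q := by
    rw [hu q hq0]
    exact mul_pos (by positivity) (hd.trans_le hDl)
  rw [← hu q hq0] at hi hii'
  obtain ⟨c, hc, hle, hneg⟩ := hfib _ _ _ (δ * l ^ (-(2 : ℝ)) * ∫ y, talentiCut κ y ^ (2 : ℝ))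
    (2 * p * B * κ) (huE.trans (by gcongr; exact integral_sum_fderiv_talentiCut_sq_le hN hκ0))
    (by positivity) hi' hJ' (by positivity) hii hQ
    (by
      calc δ * l ^ (-(2 : ℝ)) * (∫ y, talentiCut κ y ^ (2 : ℝ)) / 2
          = δ / 2 * (l ^ (-(2 : ℝ)) * ∫ y, talentiCut κ y ^ (2 : ℝ)) := by ring
        _ ≤ δ / 2 * ∫ x in Ω, ‖sobFun u x‖ ^ q := by gcongr
        _ = μ / (2 * q) * s₀ ^ (q - 2) * ∫ x in Ω, ‖sobFun u x‖ ^ q := by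
          rw [hδ]
          field_simp)
    (by
      have hpos : 0 < μ / (4 * q) * s₀ ^ q := by positivity
      have := mul_le_mul_of_nonneg_left hii' hpos.le
      refine le_trans (le_of_eq ?_) this
      field_simp)
  refine ⟨u, c, s₁, hs₁, hc, fun s hs => ?_, ?_⟩
  · rw [energy_smul hA hAb u hs]
    exact hle s hs
  · rw [energy_smul hA hAb u hs₁.le]
    exact hneg

/-- The segment from `0` to `T u`. -/
noncomputable def rayPath (u : H10 ℂ Ω) (T : ℝ) : C(unitInterval, H10 ℂ Ω) where
  toFun t := ((t * T : ℝ) : ℂ) • u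
  continuous_toFun := by fun_prop

end Level

end MagneticBN

theorem lemma3p3 (N : ℕ) (hN : 4 ≤ N)
    (Ω : Set (EuclideanSpace ℝ (Fin N)))
    (hΩo : IsOpen Ω) (hΩn : Ω.Nonempty) (hΩb : Bornology.IsBounded Ω)
    (A : EuclideanSpace ℝ (Fin N) → EuclideanSpace ℝ (Fin N))
    (hAc : Continuous A) (hAb : ∃ C : ℝ, ∀ x, ‖A x‖ ≤ C)
    (q : ℝ) (hq2 : 2 ≤ q) (hqc : q < MagneticBN.critExp N)
    (μ : ℝ) (hμ : 0 < μ) (hμq : q = 2 → μ < MagneticBN.lambdaOne A Ω μ) :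
    0 < MagneticBN.mountainPassLevel A Ω q μ ∧
      MagneticBN.mountainPassLevel A Ω q μ
        < 1 / (N : ℝ) * MagneticBN.sobolevConst Ω ^ ((N : ℝ) / 2) := by
  obtain ⟨u, c, T, hT, hc, hle, hneg⟩ :=
    MagneticBN.exists_ray_lt hN hΩo hΩn hAc hAb hq2 hμ
  obtain ⟨b, hb, hge⟩ :=
    MagneticBN.exists_pos_le_iSup_energy hN hΩb hAc hAb hq2 hqc.le hμ hμq
  have hmem : MagneticBN.rayPath u T ∈ MagneticBN.mountainPaths A Ω q μ := by
    constructor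
    · simp [MagneticBN.rayPath]
    · simpa [MagneticBN.rayPath] using hneg
  have : Nonempty (MagneticBN.mountainPaths A Ω q μ) := ⟨⟨_, hmem⟩⟩
  refine ⟨hb.trans_le (le_ciInf hge), ?_⟩
  have h1 : MagneticBN.mountainPassLevel A Ω q μ ≤ c := by
    -- The uniform lower bound `b` also serves as the boundedness that the real infimum requires.
    refine (ciInf_le ⟨b, ?_⟩ ⟨_, hmem⟩).trans
      (ciSup_le fun t => hle (t * T) (mul_nonneg t.2.1 hT.le))
    rintro _ ⟨γ, rfl⟩
    exact hge γ
  refine h1.trans_lt (hc.trans_le ?_)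
  have h2 := MagneticBN.talentiConst_le_sobolevConst hN hΩo hΩn hΩb
  have h3 := (MagneticBN.talentiConst_pos hN).le
  gcongr
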